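/- Let $d\in\mathbb N_0$, $x_0\in\mathbb R^d$, let $b:\mathbb R^d\to\mathbb R^d$ be continuously differentiable with $\|b\|$ and $\|Db\|$ bounded, and let $x\mapsto\mu_x$ be a stochastic kernel on $\mathbb R^d$ (each $\mu_x$ is a Borel probability measure) that is continuous for the topology of weak convergence, with $\int y\,\mu_x(dy)=0$ for every $x$ and, for some $\lambda>0$, $K_{\rm mgf}<\infty$, $$\sup_{x}\sup_{\|\alpha\|\le\lambda}\log\int e^{\langle y,\alpha\rangle}\mu_x(dy)\le K_{\rm mgf}.$$ Let $A_{ij}(x)=\int y_iy_j\,\mu_x(dy)$, and let $\|\alpha\|^2_{A^{-1}(x)}=\sum_i\langle e_i,\alpha\rangle^2/l_i\in[0,\infty]$, where $(e_i)$ is an orthonormal basis of eigenvectors of $A(x)$ with eigenvalues $l_i$ and where $c/0=\infty$ for $c>0$ and $0/0=0$. Let $X^0\in C([0,1]:\mathbb R^d)$ solve $X^0(t)=x_0+\int_0^tb(X^0(s))\,ds$. Let $a(n)$ be real numbers with $a(n)\to0$ and $a(n)\sqrt n\to\infty$. For each $n\in\mathbb N=\{1,2,\dots\}$ let $\eta^n$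 be a probability measure on $(\mathbb R^d)^n$, let $(\bar\upsilon^n_0,\dots,\bar\upsilon^n_{n-1})$ have distribution $\eta^n$, and let $\eta^n_i$ be the conditional distribution of $\bar\upsilon^n_i$ given $(\bar\upsilon^n_0,\dots,\bar\upsilon^n_{i-1})$. Define $X^{n,0}_0=\bar X^n_0=x_0$, $\bar Y^n_0=0$ and, for $0\le i<n$, $$X^{n,0}_{i+1}=X^{n,0}_i+\tfrac1n b(X^{n,0}_i),\qquad \bar X^n_{i+1}=\bar X^n_i+\tfrac1n b(\bar X^n_i)+\tfrac1n\bar\upsilon^n_i,$$ $$\bar Y^n_{i+1}=\bar Y^n_i+\tfrac{a(n)}{\sqrt n}\bigl(b(\bar X^n_i)-b(X^{n,0}_i)\bigr)+\tfrac{a(n)}{\sqrt n}\bar\upsilon^n_i,$$ and let $\bar Y^n(t)=(i+1-nt)\bar Y^n_i+(nt-i)\bar Y^n_{i+1}$ for $t\in[i/n,(i+1)/n]$. Let $\hat w^n(t)=a(n)\sqrt n\int y\,\eta^n_i(dy)$ for $t\in[i/n,(i+1)/n)$, and let $\hat\eta^n(dy\otimes dt)=\delta_{\hat w^n(t)}(dy)\,dt$,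 a random probability measure on $\mathbb R^d\times[0,1]$. With $R(\cdot\|\cdot)$ denoting relative entropy, put $$C_n=a(n)^2\,n\,E\Bigl[\frac1n\sum_{i=0}^{n-1}R\bigl(\eta^n_i\,\|\,\mu_{\bar X^n_i}\bigr)\Bigr]\in[0,\infty],$$ and suppose that $\sup_{n}C_n\le K_E$ for some $K_E<\infty$. Then the sequence $\{(\hat\eta^n,\bar Y^n)\}_{n\in\mathbb N}$ of random elements of $\mathcal P(\mathbb R^d\times[0,1])\times C([0,1]:\mathbb R^d)$ (weak topology and uniform topology) is tight. Moreover, if $(\hat\eta^n,\bar Y^n)$ converges in distribution along a subsequence to $(\hat\eta,\hat Y)$, then with probability 1 the second marginal $\hat\eta_2(dt)$ of $\hat\eta$ is Lebesgue measure on $[0,1]$, $\int\|y\|\,\hat\eta(dy\otimes dt)<\infty$, and, with $\hat w(t)=\int y\,\hat\eta_{1|2}(dy\,|\,t)$, where $\hat\eta_{1|2}$ is the conditional distribution on $\mathbb R^d$ given the second coordinate, $\hat w$ is integrable on $[0,1]$ and $$\hat Y(t)=\int_0^tDb(X^0(s))\hat Y(s)\,ds+\int_0^t\hat w(s)\,ds\qquad\text{for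 all }t\in[0,1];$$ and, with the lower limit taken along this subsequence, $$\liminf_{n\to\infty}C_n\ \ge\ E\Bigl[\int_0^1\tfrac12\|\hat w(s)\|^2_{A^{-1}(X^0(s))}\,ds\Bigr].$$ -/

import Mathlib

open MeasureTheory ProbabilityTheory Filter Topology Set unitInterval InformationTheory
open scoped ENNReal NNReal

noncomputable section

namespace ModerateDeviations

/-- The state space `ℝᵈ` with its Euclidean norm. -/
abbrev E (d : ℕ) : Type := EuclideanSpace ℝ (Fin d)

variable {d : ℕ}

/-! ### The noise kernel and the standing assumptions -/

/-- The log moment generating function `H_c(x, α) = log ∫ e^{⟨y, α⟩} μ_x(dy)`, with values in the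
extended reals (it is `+∞` exactly when the integral diverges). -/
def logMGF (μ : Kernel (E d) (E d)) (x α : E d) : EReal :=
  ENNReal.log (∫⁻ y, ENNReal.ofReal (Real.exp (inner ℝ y α)) ∂(μ x))

/-- Standing assumptions on the noise distributions `μ_x` and the drift `b`. -/
structure StandingAssumptions (μ : Kernel (E d) (E d)) [IsMarkovKernel μ] (b : E d → E d) :
    Prop where
  /-- The noise has mean zero (integrability follows from `mgf_bound`). -/
  mean_zero : ∀ x, ∫ y, y ∂(μ x) = 0
  mgf_bound : ∃ (lam : ℝ) (K : ℝ), 0 < lam ∧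
    ∀ x α : E d, ‖α‖ ≤ lam → logMGF μ x α ≤ (K : EReal)
  weak_cont : Continuous (Y := ProbabilityMeasure (E d)) fun x => ⟨μ x, inferInstance⟩
  drift_contDiff : ContDiff ℝ 1 b
  drift_bound : ∃ K : ℝ, ∀ x, ‖b x‖ ≤ K ∧ ‖fderiv ℝ b x‖ ≤ K

/-- The matrix `A(x)` of second moments of `μ_x`. -/
def secondMoment (μ : Kernel (E d) (E d)) (x : E d) : Matrix (Fin d) (Fin d) ℝ :=
  Matrix.of fun i j => ∫ y, y i * y j ∂(μ x)

theorem secondMoment_isHermitian (μ : Kernel (E d) (E d)) (x : E d) :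
    (secondMoment μ x).IsHermitian := by
  ext i j
  simp [secondMoment, mul_comm]

/-- For a symmetric nonnegative definite matrix `A` with orthonormal eigenvectors `e_i` and
eigenvalues `l_i`, the quantity `‖α‖²_{A⁻¹} = ∑ ⟨e_i, α⟩² / l_i`, with values in `[0, ∞]`. By the
conventions `c / 0 = ∞` for `c ≠ 0` and `0 / 0 = 0` of `ℝ≥0∞`, it is infinite if `α` is not in the
span of the eigenvectors with positive eigenvalues, and has the standard value on that span. -/
def invNormSq {A : Matrix (Fin d) (Fin d) ℝ} (hA : A.IsHermitian) (α : E d) : ℝ≥0∞ :=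
  ∑ i, ENNReal.ofReal (inner ℝ (hA.eigenvectorBasis i) α ^ 2) / ENNReal.ofReal (hA.eigenvalues i)

/-- `X⁰` solves `X⁰(t) = x₀ + ∫₀ᵗ b(X⁰(s)) ds` on `[0,1]`. -/
def IsNoiselessLimit (b : E d → E d) (x₀ : E d) (X0 : C(I, E d)) : Prop :=
  ∀ t : I, X0 t = x₀ + ∫ s in Iic t, b (X0 s)

/-! ### Piecewise linear interpolation -/

/-- The piecewise linear interpolation of `z₀, z₁, …, z_n` with mesh `1/n`, at time `t`: for
`t ∈ [i/n, (i+1)/n]` it equals `(i + 1 - n t) z_i + (n t - i) z_{i+1}`. -/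
def interpFun (n : ℕ) (z : ℕ → E d) (t : I) : E d :=
  ((⌊(n * t : ℝ)⌋₊ : ℝ) + 1 - n * t) • z ⌊(n * t : ℝ)⌋₊ +
    ((n * t : ℝ) - ⌊(n * t : ℝ)⌋₊) • z (⌊(n * t : ℝ)⌋₊ + 1)

theorem interpFun_eq (n : ℕ) (z : ℕ → E d) (t : I) (i : ℕ) (h₁ : (i : ℝ) ≤ n * t)
    (h₂ : (n * t : ℝ) ≤ i + 1) :
    interpFun n z t = ((i : ℝ) + 1 - n * t) • z i + ((n * t : ℝ) - i) • z (i + 1) := by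
  rcases h₂.lt_or_eq with h | h
  · have : ⌊(n * t : ℝ)⌋₊ = i := (Nat.floor_eq_iff ((Nat.cast_nonneg i).trans h₁)).2 ⟨h₁, h⟩
    simp only [interpFun, this]
  · have : ⌊(n * t : ℝ)⌋₊ = i + 1 := by
      rw [h]; exact_mod_cast Nat.floor_natCast (i + 1)
    rw [interpFun, this, h]
    push_cast
    simp

theorem continuous_interpFun (n : ℕ) (z : ℕ → E d) : Continuous (interpFun n z) := by
  refine (locallyFinite_of_finite
    (fun i : Fin (n + 1) => {t : I | ((i : ℕ) : ℝ) ≤ n * t ∧ (n * t : ℝ) ≤ (i : ℕ) + 1})).continuous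
    ?_ ?_ ?_
  · refine eq_univ_of_forall fun t => mem_iUnion.2 ?_
    have h0 : (0 : ℝ) ≤ n * t := mul_nonneg (Nat.cast_nonneg n) t.2.1
    have h1 : (n * t : ℝ) ≤ n := mul_le_of_le_one_right (Nat.cast_nonneg n) t.2.2
    refine ⟨⟨⌊(n * t : ℝ)⌋₊, Nat.lt_succ_of_le (Nat.floor_le_of_le h1)⟩, Nat.floor_le h0, ?_⟩
    exact (Nat.lt_floor_add_one _).le
  · intro i
    have hc : Continuous fun t : I => (n * t : ℝ) := by fun_prop
    exact (isClosed_le continuous_const hc).inter (isClosed_le hc continuous_const)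
  · intro i
    refine ContinuousOn.congr (f := fun t : I =>
      (((i : ℕ) : ℝ) + 1 - n * t) • z i + ((n * t : ℝ) - (i : ℕ)) • z (i + 1))
      (Continuous.continuousOn (by fun_prop)) ?_
    intro t ht
    exact interpFun_eq n z t i ht.1 ht.2

/-- The interpolation as an element of `C([0,1] : ℝᵈ)`. -/
def interp (n : ℕ) (z : ℕ → E d) : C(I, E d) := ⟨interpFun n z, continuous_interpFun n z⟩

/-! ### The controlled processes -/

/-- A finite family of noises `(v_0, …, v_{n-1})`, extended by zero (only `i < n` matters). -/
def noise {n : ℕ} (v : Fin n → E d) (i : ℕ) : E d := if h : i < n then v ⟨i, h⟩ else 0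

/-- `X_{i+1}^{n,0} = X_i^{n,0} + b(X_i^{n,0})/n`, `X_0^{n,0} = x₀`. -/
def noiselessX (b : E d → E d) (x₀ : E d) (n : ℕ) : ℕ → E d
  | 0 => x₀
  | i + 1 => noiselessX b x₀ n i + (1 / n : ℝ) • b (noiselessX b x₀ n i)

/-- `X̄_{i+1}^n = X̄_i^n + b(X̄_i^n)/n + v_i/n`, `X̄_0^n = x₀`, as a function of the noises `v`. -/
def controlledX (b : E d → E d) (x₀ : E d) {n : ℕ} (v : Fin n → E d) : ℕ → E d
  | 0 => x₀
  | i + 1 => controlledX b x₀ v i + (1 / n : ℝ) • b (controlledX b x₀ v i) + (1 / n : ℝ) • noise v i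

/-- `Ȳ_{i+1}^n = Ȳ_i^n + (a(n)/√n)(b(X̄_i^n) - b(X_i^{n,0})) + (a(n)/√n) v_i`, `Ȳ_0^n = 0`. -/
def controlledY (a : ℕ → ℝ) (b : E d → E d) (x₀ : E d) {n : ℕ} (v : Fin n → E d) : ℕ → E d
  | 0 => 0
  | i + 1 => controlledY a b x₀ v i
      + (a n / √n) • (b (controlledX b x₀ v i) - b (noiselessX b x₀ n i))
      + (a n / √n) • noise v i

/-- The path `Ȳⁿ ∈ C([0,1] : ℝᵈ)`. -/
def controlledPath (a : ℕ → ℝ) (b : E d → E d) (x₀ : E d) {n : ℕ} (v : Fin n → E d) : C(I, E d) :=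
  interp n (controlledY a b x₀ v)

/-- The first `i` noises `(v_0, …, v_{i-1})`. -/
def past {n : ℕ} (i : Fin n) (v : Fin n → E d) : Fin i → E d :=
  fun j => v (Fin.castLE i.2.le j)

/-- `η_i`: under the joint law `η` of the noises, the (regular) conditional distribution of `v_i`
given `(v_0, …, v_{i-1})`, as a random measure (a function of the noises `v`). -/
def control {n : ℕ} (η : Measure (Fin n → E d)) [IsProbabilityMeasure η] (i : Fin n)
    (v : Fin n → E d) : Measure (E d) :=
  condDistrib (fun u : Fin n → E d => u i) (past i) η (past i v)

/-- `wⁿ(t) = ∫ y η_i(dy)` for `t ∈ [i/n, (i+1)/n)`, `i < n` (set to `0` at the end point `t = 1`). -/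
def condMean {n : ℕ} (η : Measure (Fin n → E d)) [IsProbabilityMeasure η]
    (v : Fin n → E d) (t : I) : E d :=
  if h : ⌊(n * t : ℝ)⌋₊ < n then ∫ y, y ∂(control η ⟨⌊(n * t : ℝ)⌋₊, h⟩ v) else 0

/-- The amplified conditional mean `ŵⁿ(t) = a(n) √n wⁿ(t)`. -/
def ampMean (a : ℕ → ℝ) {n : ℕ} (η : Measure (Fin n → E d)) [IsProbabilityMeasure η]
    (v : Fin n → E d) (t : I) : E d :=
  (a n * √n) • condMean η v t

theorem measurable_ampMean (a : ℕ → ℝ) {n : ℕ} (η : Measure (Fin n → E d))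
    [IsProbabilityMeasure η] (v : Fin n → E d) : Measurable (ampMean a η v) := by
  have h : Measurable fun t : I => ⌊(n * t : ℝ)⌋₊ := Nat.measurable_floor.comp (by fun_prop)
  have h' : Measurable fun k : ℕ => (a n * √n) •
      (if h : k < n then ∫ y, y ∂(control η ⟨k, h⟩ v) else (0 : E d)) := measurable_from_nat
  exact h'.comp h

/-- The random measure `η̂ⁿ(dy ⊗ dt) = δ_{ŵⁿ(t)}(dy) dt` on `ℝᵈ × [0,1]`, i.e. the image of Lebesgue
measure on `[0,1]` under `t ↦ (ŵⁿ(t), t)`. -/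
def occMeasure (a : ℕ → ℝ) {n : ℕ} (η : Measure (Fin n → E d)) [IsProbabilityMeasure η]
    (v : Fin n → E d) : ProbabilityMeasure (E d × I) :=
  ⟨(volume : Measure I).map fun t => (ampMean a η v t, t),
    Measure.isProbabilityMeasure_map
      ((measurable_ampMean a η v).prodMk measurable_id).aemeasurable⟩

/-- The scaled cost `a(n)² n E[(1/n) ∑_{i<n} R(η_i ‖ μ_{X̄_i^n})]`, where `R` is relative entropy. -/
def scaledCost (a : ℕ → ℝ) (μ : Kernel (E d) (E d)) (b : E d → E d) (x₀ : E d) {n : ℕ}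
    (η : Measure (Fin n → E d)) [IsProbabilityMeasure η] : ℝ≥0∞ :=
  ENNReal.ofReal (a n ^ 2 * n) *
    ∫⁻ v, (n : ℝ≥0∞)⁻¹ * ∑ i : Fin n, klDiv (control η i v) (μ (controlledX b x₀ v i)) ∂η

/-! ### The space of pairs and the limit control -/

/-- The space `𝒫(ℝᵈ × [0,1]) × C([0,1] : ℝᵈ)` with the product of the topology of weak convergence
and the topology of uniform convergence, and with its Borel `σ`-algebra. -/
def PairSpace (d : ℕ) : Type := ProbabilityMeasure (E d × I) × C(I, E d)

instance : TopologicalSpace (PairSpace d) :=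
  inferInstanceAs (TopologicalSpace (ProbabilityMeasure (E d × I) × C(I, E d)))

instance : MeasurableSpace (PairSpace d) := borel _

instance : BorelSpace (PairSpace d) := ⟨rfl⟩

/-- The random element `(η̂ⁿ, Ȳⁿ)` as a function of the noises. -/
def controlPair (a : ℕ → ℝ) (b : E d → E d) (x₀ : E d) {n : ℕ} (η : Measure (Fin n → E d))
    [IsProbabilityMeasure η] (v : Fin n → E d) : PairSpace d :=
  (occMeasure a η v, controlledPath a b x₀ v)

/-- `ŵ(t) = ∫ y ν_{1|2}(dy | t)`, where `ν_{1|2}` is the (regular) conditional distribution of the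
first coordinate given the second one under `ν`. -/
def limitMean (ν : ProbabilityMeasure (E d × I)) (t : I) : E d :=
  ∫ y, y ∂(condDistrib Prod.fst Prod.snd (ν : Measure (E d × I)) t)

end ModerateDeviations

end

open ModerateDeviations

/-!
The proof rests on the entropy inequality `⟨∫ y dν, α⟩ ≤ R(ν ‖ ρ) + ∫ (e^{⟨y, α⟩} - 1) dρ` for a
centred `ρ` with exponential moments, where the last term is `½⟨α, Aα⟩ + O(‖α‖³)`. Write
`s = a(n) √n`. With `α / s` in place of `α`, and after multiplication by `s²`
(`ExpMoment.ofReal_inner_smul_mean_sub_le`), it reads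
`⟨s ∫ y dν, α⟩ ≤ s² R(ν ‖ ρ) + ½⟨α, Aα⟩ + O(1 / s)`, and `s² R` is exactly what the scaled cost
averages. Three consequences carry the theorem.

* *Uniform integrability.* With `‖α‖` of order `M`, the part of the amplified conditional means
  above level `C M` has expected `L¹` norm at most `K_E / M`
  (`ModerateRegime.exists_lintegral_controlExcess_le`).
* *The noise averages out.* The path `Ȳⁿ` is driven by `(a(n) / √n) ∑ vᵢ`, which differs from the
  integral of the amplified conditional means by a sum of centred variables. These are split at
  level `√n`. The bounded parts, with their conditional means removed, are orthogonal increments, to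
  which a maximal inequality applies, and the large parts are small in `L¹`; in both cases the
  second moments and tails under the conditional laws are controlled by the relative entropies
  (`ModerateRegime.tendsto_ampNoise`). A discrete Gronwall estimate and the continuity of `Db` then
  show that `Ȳⁿ` solves the limit equation, with `ŵⁿ` as control, up to a small error
  (`ModerateRegime.eventually_limit_equation`).
* *The lower bound.* Finite maxima over test vectors `α` of `⟨w, α⟩ - ½⟨α, A(X⁰(t))α⟩` have an
  expected integral of at most the scaled cost plus a vanishing error
  (`ModerateRegime.eventually_lintegral_affineMax_le`), and their supremum over a dense sequence is
  `½‖w‖²_{A⁻¹(X⁰(t))}`.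

Tightness of the occupation measures follows from Prokhorov's theorem, and tightness of the paths
from Arzelà–Ascoli, since clipping the control at a high level changes the path very little.

For the limit points only functionals that are increasing limits of bounded continuous ones are
used, and their expectations are lower semicontinuous under convergence in distribution. The map
`(ν, y) ↦ y(t) - ∫₀ᵗ Db(X⁰) y ds - ∫_{s ≤ t} w dν` is not continuous, so the indicator is replaced
by a ramp and `w` is clipped; uniform integrability makes the defect vanish, in expectation, as the
ramp gets steeper and the level higher (`ModerateRegime.ae_limit_equation_at`). The lower bound
passes from `ν` to the conditional means `ŵ(t)` by Jensen's inequality, applied to the affine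
functionals (`ModerateRegime.lintegral_half_invNormSq_le`).
-/

/-! ### The entropy inequality -/

/-- Young's inequality for the conjugate pair `x log x - x + 1` and `e^f - 1`. -/
theorem mul_le_klFun_add_exp {x : ℝ} (hx : 0 ≤ x) (f : ℝ) :
    x * f ≤ klFun x + (Real.exp f - 1) := by
  rcases hx.eq_or_lt with rfl | hx
  · simp [klFun_zero, Real.exp_nonneg]
  · have h := Real.add_one_le_exp (f - Real.log x)
    have h2 : x * Real.exp (f - Real.log x) = Real.exp f := by
      rw [Real.exp_sub, Real.exp_log hx]; field_simp
    have := mul_le_mul_of_nonneg_left h hx.le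
    rw [klFun_apply]
    nlinarith

/-- The entropy inequality for nonnegative functions, where no integrability is needed. -/
theorem lintegral_le_klDiv_add {α : Type*} [MeasurableSpace α] (ν ρ : Measure α)
    [IsFiniteMeasure ν] [IsFiniteMeasure ρ] {f : α → ℝ} (hf : Measurable f) (h0 : ∀ x, 0 ≤ f x) :
    ∫⁻ x, ENNReal.ofReal (f x) ∂ν ≤
      klDiv ν ρ + ∫⁻ x, ENNReal.ofReal (Real.exp (f x) - 1) ∂ρ := by
  by_cases hac : ν ≪ ρ
  swap
  · simp [klDiv_of_not_ac hac]
  rw [← lintegral_rnDeriv_mul hac (by fun_prop), klDiv_eq_lintegral_klFun_of_ac hac,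
    ← lintegral_add_right _ (by fun_prop)]
  refine lintegral_mono_ae ?_
  filter_upwards [ν.rnDeriv_lt_top ρ] with x hx
  rw [← ENNReal.ofReal_toReal hx.ne, ← ENNReal.ofReal_mul ENNReal.toReal_nonneg,
    ENNReal.toReal_ofReal ENNReal.toReal_nonneg,
    ← ENNReal.ofReal_add (klFun_nonneg ENNReal.toReal_nonneg)
      (by linarith [Real.add_one_le_exp (f x), h0 x])]
  exact ENNReal.ofReal_le_ofReal (mul_le_klFun_add_exp ENNReal.toReal_nonneg _)

theorem integral_le_klDiv_add {α : Type*} [MeasurableSpace α] {ν ρ : Measure α}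
    [IsFiniteMeasure ν] [IsFiniteMeasure ρ] {f : α → ℝ} (hf : Integrable f ν)
    (hexp : Integrable (fun x => Real.exp (f x)) ρ) (hkl : klDiv ν ρ ≠ ∞) :
    ∫ x, f x ∂ν ≤ (klDiv ν ρ).toReal + ∫ x, (Real.exp (f x) - 1) ∂ρ := by
  obtain ⟨hac, hllr⟩ := klDiv_ne_top_iff.1 hkl
  have hi := (integrable_klFun_rnDeriv_iff hac).2 hllr
  have he : Integrable (fun x => Real.exp (f x) - 1) ρ := hexp.sub (integrable_const _)
  rw [toReal_klDiv_eq_integral_klFun hac, ← integral_rnDeriv_smul hac, ← integral_add hi he]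
  refine integral_mono ((integrable_rnDeriv_smul_iff hac).2 hf) (hi.add he) fun x => ?_
  exact mul_le_klFun_add_exp ENNReal.toReal_nonneg _

/-! ### Measures with exponential moments -/

section ExponentialMoments

variable {d : ℕ}

/-- `ρ` is centred and `∫ e^{2c‖y‖} ρ(dy) ≤ D`. The factor `2` leaves room to absorb powers of `‖y‖`
into the exponential. -/
structure ExpMoment (ρ : Measure (E d)) (c D : ℝ) : Prop where
  integrable : Integrable (fun y => Real.exp (2 * c * ‖y‖)) ρ
  integral_le : ∫ y, Real.exp (2 * c * ‖y‖) ∂ρ ≤ D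
  mean_zero : ∫ y, y ∂ρ = 0

theorem exp_norm_le (lam : ℝ) (hl : 0 < lam) (y : E d) :
    Real.exp (lam / (d + 1) * ‖y‖) ≤
      1 + ∑ i, (Real.exp (lam * y i) + Real.exp (-(lam * y i))) := by
  have hpos : ∀ i, 0 ≤ Real.exp (lam * y i) + Real.exp (-(lam * y i)) := fun i => by positivity
  have hn : ‖y‖ ≤ ∑ i, |y i| := by
    have := norm_sum_le Finset.univ (fun i => EuclideanSpace.single i (y i) : Fin d → E d)
    have h2 : ∑ i, (EuclideanSpace.single i (y i) : E d) = y := by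
      ext j; simp [Finset.sum_apply]
    simpa [h2] using this
  by_cases h : ∃ i, ‖y‖ ≤ (d + 1) * |y i|
  · obtain ⟨i, hi⟩ := h
    have h1 : lam / (d + 1) * ‖y‖ ≤ |lam * y i| := by
      rw [abs_mul, abs_of_pos hl, div_mul_eq_mul_div, div_le_iff₀ (by positivity)]
      nlinarith
    calc Real.exp (lam / (d + 1) * ‖y‖) ≤ Real.exp |lam * y i| := Real.exp_le_exp.2 h1
      _ ≤ Real.exp (lam * y i) + Real.exp (-(lam * y i)) := Real.exp_abs_le _
      _ ≤ ∑ i, (Real.exp (lam * y i) + Real.exp (-(lam * y i))) :=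
        Finset.single_le_sum (f := fun i => Real.exp (lam * y i) + Real.exp (-(lam * y i)))
          (fun i _ => hpos i) (Finset.mem_univ i)
      _ ≤ _ := by linarith
  · push Not at h
    have h0 : ‖y‖ ≤ 0 := by
      have : ∑ i, |y i| ≤ ∑ _i : Fin d, ‖y‖ / (d + 1) := Finset.sum_le_sum fun i _ => by
        rw [le_div_iff₀ (by positivity)]; linarith [h i]
      simp only [Finset.sum_const, Finset.card_univ, Fintype.card_fin, nsmul_eq_mul] at this
      have h3 : ‖y‖ * (d + 1) ≤ d * ‖y‖ := by
        have := hn.trans this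
        rw [mul_div_assoc', le_div_iff₀ (by positivity)] at this
        exact this
      nlinarith
    have h1 : ‖y‖ = 0 := le_antisymm h0 (norm_nonneg _)
    rw [h1]
    have := Finset.sum_nonneg (s := Finset.univ) (fun i _ => hpos i)
    simp only [mul_zero, Real.exp_zero]; linarith

theorem lintegral_exp_le_of_logMGF_le {μ : Kernel (E d) (E d)} {x α : E d} {K : ℝ}
    (h : logMGF μ x α ≤ (K : EReal)) :
    ∫⁻ y, ENNReal.ofReal (Real.exp (inner ℝ y α)) ∂(μ x) ≤ ENNReal.ofReal (Real.exp K) := by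
  have := EReal.exp_le_exp_iff.2 h
  rwa [logMGF, ENNReal.exp_log, EReal.exp_coe] at this

theorem ModerateDeviations.StandingAssumptions.exists_expMoment {μ : Kernel (E d) (E d)}
    [IsMarkovKernel μ] {b : E d → E d} (h : StandingAssumptions μ b) :
    ∃ c D : ℝ, 0 < c ∧ 0 ≤ D ∧ ∀ x, ExpMoment (μ x) c D := by
  obtain ⟨lam, K, hl, hK⟩ := h.mgf_bound
  have hb : ∀ x, ∫⁻ y, ENNReal.ofReal (Real.exp (2 * (lam / (d + 1) / 2) * ‖y‖)) ∂(μ x) ≤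
      ENNReal.ofReal (1 + ∑ _i : Fin d, (Real.exp K + Real.exp K)) := by
    intro x
    have hone : ∀ (ε : ℝ) (i : Fin d), |ε| = 1 →
        ∫⁻ y : E d, ENNReal.ofReal (Real.exp (ε * (lam * y i))) ∂(μ x) ≤
          ENNReal.ofReal (Real.exp K) := by
      intro ε i hε
      have := lintegral_exp_le_of_logMGF_le
        (hK x (EuclideanSpace.single i (ε * lam)) (by simp [hε, abs_of_pos hl]))
      convert this using 5 with y
      simp [EuclideanSpace.inner_single_right]; ring
    calc ∫⁻ y, ENNReal.ofReal (Real.exp (2 * (lam / (d + 1) / 2) * ‖y‖)) ∂(μ x)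
        ≤ ∫⁻ y : E d, (1 + ∑ i, (ENNReal.ofReal (Real.exp (1 * (lam * y i))) +
            ENNReal.ofReal (Real.exp (-1 * (lam * y i))))) ∂(μ x) := by
          refine lintegral_mono fun y => ?_
          refine (ENNReal.ofReal_le_ofReal ((by ring_nf : Real.exp _ = _).le.trans
            (exp_norm_le lam hl y))).trans ?_
          rw [ENNReal.ofReal_add zero_le_one (Finset.sum_nonneg fun i _ => by positivity),
            ENNReal.ofReal_sum_of_nonneg (fun i _ => by positivity)]
          simp only [ENNReal.ofReal_one, one_mul, neg_mul]
          gcongr with i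
          exact (ENNReal.ofReal_add (by positivity) (by positivity)).le
      _ ≤ _ := by
          rw [lintegral_add_left measurable_const, lintegral_finsetSum _ (fun i _ => by fun_prop),
            ENNReal.ofReal_add zero_le_one (Finset.sum_nonneg fun i _ => by positivity),
            ENNReal.ofReal_sum_of_nonneg (fun i _ => by positivity)]
          simp only [lintegral_const, measure_univ, mul_one, ENNReal.ofReal_one]
          gcongr with i
          rw [lintegral_add_left (by fun_prop), ENNReal.ofReal_add (by positivity) (by positivity)]
          exact add_le_add (hone 1 i (by simp)) (hone (-1) i (by simp))
  have hD : 0 ≤ 1 + ∑ _i : Fin d, (Real.exp K + Real.exp K) := by positivity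
  refine ⟨lam / (d + 1) / 2, _, by positivity, hD, fun x => ?_⟩
  have hi : Integrable (fun y => Real.exp (2 * (lam / (d + 1) / 2) * ‖y‖)) (μ x) := by
    refine (lintegral_ofReal_ne_top_iff_integrable (by fun_prop)
      (ae_of_all _ fun _ => Real.exp_nonneg _)).1 ?_
    exact ((hb x).trans_lt ENNReal.ofReal_lt_top).ne
  refine ⟨hi, ?_, h.mean_zero x⟩
  have := hb x
  rwa [← ofReal_integral_eq_lintegral_ofReal hi (ae_of_all _ fun _ => Real.exp_nonneg _),
    ENNReal.ofReal_le_ofReal_iff hD] at this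

namespace ExpMoment

variable {ρ : Measure (E d)} {c D : ℝ}

theorem norm_pow_le (hc : 0 < c) (k : ℕ) (y : E d) :
    ‖y‖ ^ k ≤ k.factorial / c ^ k * Real.exp (c * ‖y‖) := by
  have h := Real.pow_div_factorial_le_exp (c * ‖y‖) (by positivity) k
  rw [div_le_iff₀ (by positivity), mul_pow] at h
  rw [div_mul_eq_mul_div, le_div_iff₀ (by positivity)]
  linarith

theorem norm_pow_mul_exp_le (hc : 0 < c) (k : ℕ) (y : E d) :
    ‖y‖ ^ k * Real.exp (c * ‖y‖) ≤ k.factorial / c ^ k * Real.exp (2 * c * ‖y‖) := by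
  have h := mul_le_mul_of_nonneg_right (norm_pow_le hc k y) (Real.exp_nonneg (c * ‖y‖))
  rwa [mul_assoc, ← Real.exp_add, ← two_mul, ← mul_assoc] at h

theorem integrable_norm_pow_mul_exp (h : ExpMoment ρ c D) (hc : 0 < c) (k : ℕ) :
    Integrable (fun y => ‖y‖ ^ k * Real.exp (c * ‖y‖)) ρ := by
  refine (h.integrable.const_mul (k.factorial / c ^ k)).mono' (by fun_prop)
    (ae_of_all _ fun y => ?_)
  rw [Real.norm_of_nonneg (by positivity)]
  exact norm_pow_mul_exp_le hc k y

theorem integral_norm_pow_mul_exp_le (h : ExpMoment ρ c D) (hc : 0 < c) (k : ℕ) :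
    ∫ y, ‖y‖ ^ k * Real.exp (c * ‖y‖) ∂ρ ≤ k.factorial / c ^ k * D := by
  calc ∫ y, ‖y‖ ^ k * Real.exp (c * ‖y‖) ∂ρ
      ≤ ∫ y, k.factorial / c ^ k * Real.exp (2 * c * ‖y‖) ∂ρ :=
        integral_mono (h.integrable_norm_pow_mul_exp hc k) (h.integrable.const_mul _)
          (norm_pow_mul_exp_le hc k)
    _ ≤ _ := by
        rw [integral_const_mul]
        exact mul_le_mul_of_nonneg_left h.integral_le (by positivity)

theorem norm_pow_le_mul_exp (hc : 0 < c) (k : ℕ) (y : E d) :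
    ‖y‖ ^ k ≤ ‖y‖ ^ k * Real.exp (c * ‖y‖) :=
  le_mul_of_one_le_right (by positivity) (Real.one_le_exp (by positivity))

theorem integrable_norm_pow (h : ExpMoment ρ c D) (hc : 0 < c) (k : ℕ) :
    Integrable (fun y => ‖y‖ ^ k) ρ :=
  (h.integrable_norm_pow_mul_exp hc k).mono' (by fun_prop) (ae_of_all _ fun y => by
    rw [Real.norm_of_nonneg (by positivity)]; exact norm_pow_le_mul_exp hc k y)

theorem integral_norm_pow_le (h : ExpMoment ρ c D) (hc : 0 < c) (k : ℕ) :
    ∫ y, ‖y‖ ^ k ∂ρ ≤ k.factorial / c ^ k * D :=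
  (integral_mono (h.integrable_norm_pow hc k) (h.integrable_norm_pow_mul_exp hc k)
    (norm_pow_le_mul_exp hc k)).trans (h.integral_norm_pow_mul_exp_le hc k)

theorem integrable_id (h : ExpMoment ρ c D) (hc : 0 < c) : Integrable (fun y : E d => y) ρ := by
  have := h.integrable_norm_pow hc 1
  simp only [pow_one] at this
  exact (integrable_norm_iff (by fun_prop)).1 this

end ExpMoment

/-- The quadratic form `⟨α, A α⟩` of the second moments of `ρ`. -/
noncomputable def quadForm (ρ : Measure (E d)) (α : E d) : ℝ := ∫ y, inner ℝ y α ^ 2 ∂ρ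

theorem quadForm_nonneg (ρ : Measure (E d)) (α : E d) : 0 ≤ quadForm ρ α :=
  integral_nonneg fun _ => sq_nonneg _

theorem inner_pow_le (y α : E d) (k : ℕ) : |inner ℝ y α| ^ k ≤ ‖α‖ ^ k * ‖y‖ ^ k := by
  rw [← mul_pow]
  have := abs_real_inner_le_norm y α
  rw [mul_comm] at this
  gcongr

namespace ExpMoment

variable {ρ : Measure (E d)} {c D : ℝ}

theorem integrable_inner_pow (h : ExpMoment ρ c D) (hc : 0 < c) (α : E d) (k : ℕ) :
    Integrable (fun y => inner ℝ y α ^ k) ρ :=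
  ((h.integrable_norm_pow hc k).const_mul (‖α‖ ^ k)).mono' (by fun_prop)
    (ae_of_all _ fun y => by rw [norm_pow, Real.norm_eq_abs]; exact inner_pow_le y α k)

theorem quadForm_le (h : ExpMoment ρ c D) (hc : 0 < c) (α : E d) :
    quadForm ρ α ≤ 2 * D / c ^ 2 * ‖α‖ ^ 2 := by
  calc quadForm ρ α ≤ ∫ y, ‖α‖ ^ 2 * ‖y‖ ^ 2 ∂ρ := by
        refine integral_mono (h.integrable_inner_pow hc α 2)
          ((h.integrable_norm_pow hc 2).const_mul _) fun y => ?_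
        have := inner_pow_le y α 2
        rwa [sq_abs] at this
    _ ≤ _ := by
        rw [integral_const_mul]
        have := mul_le_mul_of_nonneg_left (h.integral_norm_pow_le hc 2) (sq_nonneg ‖α‖)
        norm_num at this
        refine this.trans (le_of_eq ?_)
        ring

theorem integrable_exp_inner (h : ExpMoment ρ c D) (hc : 0 < c) {α : E d} (hα : ‖α‖ ≤ c) :
    Integrable (fun y => Real.exp (inner ℝ y α)) ρ := by
  refine h.integrable.mono' (by fun_prop) (ae_of_all _ fun y => ?_)
  rw [Real.norm_of_nonneg (by positivity)]
  refine Real.exp_le_exp.2 ?_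
  have := (le_abs_self _).trans (abs_real_inner_le_norm y α)
  nlinarith [norm_nonneg y]

theorem _root_.exp_sub_taylor_two_le (u : ℝ) :
    Real.exp u - 1 - u - u ^ 2 / 2 ≤ |u| ^ 3 * Real.exp |u| := by
  have h := Complex.norm_exp_sub_sum_le_norm_mul_exp (u : ℂ) 3
  rw [Complex.norm_real, Real.norm_eq_abs] at h
  refine le_trans ?_ h
  have : Complex.exp u - ∑ m ∈ Finset.range 3, (u : ℂ) ^ m / m.factorial =
      ((Real.exp u - 1 - u - u ^ 2 / 2 : ℝ) : ℂ) := by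
    simp [Finset.sum_range_succ]; ring
  rw [this, Complex.norm_real]
  exact Real.le_norm_self _

/-- Taylor expansion of the moment generating function: the first-order term vanishes because the
measure is centred. -/
theorem integral_exp_inner_sub_one_le [IsProbabilityMeasure ρ] (h : ExpMoment ρ c D) (hc : 0 < c)
    {α : E d} (hα : ‖α‖ ≤ c) :
    ∫ y, (Real.exp (inner ℝ y α) - 1) ∂ρ ≤
      quadForm ρ α / 2 + 6 / c ^ 3 * D * ‖α‖ ^ 3 := by
  have h1 : ∫ y, inner ℝ y α ∂ρ = 0 := by
    have := integral_inner (𝕜 := ℝ) (h.integrable_id hc) α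
    simp only [h.mean_zero, inner_zero_right] at this
    simpa only [real_inner_comm] using this
  have hi1 : Integrable (fun y => inner ℝ y α) ρ := by
    simpa using h.integrable_inner_pow hc α 1
  have hi2 := (h.integrable_inner_pow hc α 2).div_const 2
  have hi12 : Integrable (fun y => inner ℝ y α + inner ℝ y α ^ 2 / 2) ρ := hi1.add hi2
  have hi3 := (h.integrable_norm_pow_mul_exp hc 3).const_mul (‖α‖ ^ 3)
  have hmono : ∫ y, (Real.exp (inner ℝ y α) - 1) ∂ρ ≤ ∫ y, (inner ℝ y α + inner ℝ y α ^ 2 / 2 +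
      ‖α‖ ^ 3 * (‖y‖ ^ 3 * Real.exp (c * ‖y‖))) ∂ρ := by
    refine integral_mono ((h.integrable_exp_inner hc hα).sub (integrable_const _))
      (hi12.add hi3) fun y => ?_
    have ht := exp_sub_taylor_two_le (inner ℝ y α)
    have h3 := inner_pow_le y α 3
    have he : Real.exp |inner ℝ y α| ≤ Real.exp (c * ‖y‖) := by
      refine Real.exp_le_exp.2 ?_
      have := abs_real_inner_le_norm y α
      nlinarith [norm_nonneg y]
    have := mul_le_mul h3 he (Real.exp_nonneg _) (by positivity)
    simp only
    nlinarith
  refine hmono.trans ?_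
  rw [integral_add hi12 hi3, integral_add hi1 hi2, h1, integral_div, integral_const_mul,
    quadForm, zero_add]
  have := mul_le_mul_of_nonneg_left (h.integral_norm_pow_mul_exp_le hc 3)
    (pow_nonneg (norm_nonneg α) 3)
  have h6 : ((3 : ℕ).factorial : ℝ) = 6 := by norm_num [Nat.factorial]
  rw [h6] at this
  linarith

theorem lintegral_norm_le [IsProbabilityMeasure ρ] (h : ExpMoment ρ c D) (hc : 0 < c)
    (ν : Measure (E d)) [IsProbabilityMeasure ν] :
    ∫⁻ y, ENNReal.ofReal (c * ‖y‖) ∂ν ≤ klDiv ν ρ + ENNReal.ofReal D := by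
  refine (lintegral_le_klDiv_add ν ρ (by fun_prop) fun y => by positivity).trans ?_
  gcongr
  calc ∫⁻ y, ENNReal.ofReal (Real.exp (c * ‖y‖) - 1) ∂ρ
      ≤ ∫⁻ y, ENNReal.ofReal (Real.exp (2 * c * ‖y‖)) ∂ρ := by
        refine lintegral_mono fun y => ENNReal.ofReal_le_ofReal ?_
        have : Real.exp (c * ‖y‖) ≤ Real.exp (2 * c * ‖y‖) :=
          Real.exp_le_exp.2 (by nlinarith [norm_nonneg y])
        linarith
    _ ≤ _ := by
        rw [← ofReal_integral_eq_lintegral_ofReal h.integrable (ae_of_all _ fun _ =>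
          Real.exp_nonneg _)]
        exact ENNReal.ofReal_le_ofReal h.integral_le

theorem integrable_of_klDiv_ne_top [IsProbabilityMeasure ρ] (h : ExpMoment ρ c D) (hc : 0 < c)
    {ν : Measure (E d)} [IsProbabilityMeasure ν] (hkl : klDiv ν ρ ≠ ∞) :
    Integrable (fun y : E d => y) ν := by
  have h1 : Integrable (fun y : E d => c * ‖y‖) ν := by
    refine (lintegral_ofReal_ne_top_iff_integrable (by fun_prop)
      (ae_of_all _ fun _ => by positivity)).1 ?_
    exact ne_top_of_le_ne_top (by finiteness) (h.lintegral_norm_le hc ν)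
  have h2 : Integrable (fun y : E d => ‖y‖) ν := by
    refine (h1.const_mul c⁻¹).congr (ae_of_all _ fun y => ?_)
    simp only; field_simp
  exact (integrable_norm_iff (by fun_prop)).1 h2

/-- The relative entropy controls the mean of `ν` through the quadratic form of `ρ`, up to a cubic
error. -/
theorem inner_mean_le [IsProbabilityMeasure ρ] (h : ExpMoment ρ c D) (hc : 0 < c)
    (ν : Measure (E d)) [IsProbabilityMeasure ν] {α : E d} (hα : ‖α‖ ≤ c) :
    ENNReal.ofReal (inner ℝ (∫ y, y ∂ν) α) ≤
      klDiv ν ρ + ENNReal.ofReal (quadForm ρ α / 2 + 6 / c ^ 3 * D * ‖α‖ ^ 3) := by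
  by_cases hkl : klDiv ν ρ = ∞
  · simp [hkl]
  have hi := h.integrable_of_klDiv_ne_top hc hkl
  have h1 : inner ℝ (∫ y, y ∂ν) α = ∫ y, inner ℝ y α ∂ν := by
    have := integral_inner (𝕜 := ℝ) hi α
    rw [real_inner_comm, ← this]
    simp only [real_inner_comm]
  have h2 := integral_le_klDiv_add (ρ := ρ) (f := fun y => inner ℝ y α) (hi.inner_const α)
    (h.integrable_exp_inner hc hα) hkl
  have h3 := h.integral_exp_inner_sub_one_le hc hα
  rw [h1]
  refine (ENNReal.ofReal_le_ofReal (h2.trans (add_le_add_right h3 _))).trans ?_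
  refine ENNReal.ofReal_add_le.trans ?_
  rw [ENNReal.ofReal_toReal hkl]

/-- Entropy bound for the part of `ν` outside the ball of radius `r`. -/
theorem lintegral_norm_gt_le [IsProbabilityMeasure ρ] (h : ExpMoment ρ c D) (hc : 0 < c)
    (ν : Measure (E d)) [IsProbabilityMeasure ν] {r : ℝ} (hr : 0 < r) :
    ∫⁻ y, ENNReal.ofReal (c * ((Metric.closedBall (0 : E d) r)ᶜ.indicator (fun y => ‖y‖) y)) ∂ν ≤
      klDiv ν ρ + ENNReal.ofReal (D / (c * r)) := by
  refine (lintegral_le_klDiv_add ν ρ ?_ fun y => ?_).trans ?_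
  · exact (measurable_norm.indicator Metric.isClosed_closedBall.measurableSet.compl).const_mul c
  · exact mul_nonneg hc.le (indicator_nonneg (fun _ _ => norm_nonneg _) _)
  gcongr
  calc _ ≤ ∫⁻ y, ENNReal.ofReal (1 / r * (‖y‖ ^ 1 * Real.exp (c * ‖y‖))) ∂ρ := by
        refine lintegral_mono fun y => ENNReal.ofReal_le_ofReal ?_
        by_cases hy : y ∈ Metric.closedBall (0 : E d) r
        · rw [indicator_of_notMem (by simpa using hy)]
          simp only [mul_zero, Real.exp_zero, sub_self]
          positivity
        · rw [indicator_of_mem (by simpa using hy)]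
          simp only [Metric.mem_closedBall, dist_zero_right, not_le] at hy
          have h1 : 1 ≤ 1 / r * ‖y‖ := by rw [one_div_mul_eq_div, le_div_iff₀ hr]; linarith
          nlinarith [Real.exp_pos (c * ‖y‖)]
    _ ≤ _ := by
        have hi := (h.integrable_norm_pow_mul_exp hc 1).const_mul (1 / r)
        rw [← ofReal_integral_eq_lintegral_ofReal hi (ae_of_all _ fun _ => by positivity),
          integral_const_mul]
        refine ENNReal.ofReal_le_ofReal ?_
        have := mul_le_mul_of_nonneg_left (h.integral_norm_pow_mul_exp_le hc 1)
          (one_div_pos.2 hr).le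
        refine this.trans (le_of_eq ?_)
        simp; field_simp

/-- Entropy bound for the second moment of `ν` inside the ball of radius `r`. -/
theorem lintegral_norm_sq_le [IsProbabilityMeasure ρ] (h : ExpMoment ρ c D) (hc : 0 < c)
    (ν : Measure (E d)) [IsProbabilityMeasure ν] {r : ℝ} (hr : 0 < r) :
    ∫⁻ y, ENNReal.ofReal
        (c / r * ((Metric.closedBall (0 : E d) r).indicator (fun y => ‖y‖ ^ 2) y)) ∂ν ≤
      klDiv ν ρ + ENNReal.ofReal (2 * D / (c * r)) := by
  refine (lintegral_le_klDiv_add ν ρ ?_ fun y => ?_).trans ?_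
  · exact (Measurable.indicator (by fun_prop) Metric.isClosed_closedBall.measurableSet).const_mul _
  · exact mul_nonneg (by positivity) (indicator_nonneg (fun _ _ => by positivity) _)
  gcongr
  calc _ ≤ ∫⁻ y, ENNReal.ofReal (c / r * (‖y‖ ^ 2 * Real.exp (c * ‖y‖))) ∂ρ := by
        refine lintegral_mono fun y => ENNReal.ofReal_le_ofReal ?_
        by_cases hy : y ∈ Metric.closedBall (0 : E d) r
        · rw [indicator_of_mem hy]
          simp only [Metric.mem_closedBall, dist_zero_right] at hy
          -- `e^u - 1 ≤ u e^u`, applied with `u = c‖y‖² / r ≤ c‖y‖`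
          have hu : c / r * ‖y‖ ^ 2 ≤ c * ‖y‖ := by
            rw [div_mul_eq_mul_div, div_le_iff₀ hr]
            have := mul_le_mul_of_nonneg_left hy (norm_nonneg y)
            nlinarith
          set u := c / r * ‖y‖ ^ 2
          have hu0 : 0 ≤ u := by positivity
          have h1 : Real.exp u - 1 ≤ u * Real.exp u := by
            have := Real.add_one_le_exp (-u)
            have h2 : Real.exp (-u) * Real.exp u = 1 := by rw [← Real.exp_add]; simp
            nlinarith [Real.exp_pos u]
          have h2 := mul_le_mul_of_nonneg_left (Real.exp_le_exp.2 hu) hu0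
          calc _ ≤ u * Real.exp (c * ‖y‖) := h1.trans h2
            _ = _ := by simp only [u]; ring
        · rw [indicator_of_notMem hy]
          simp only [mul_zero, Real.exp_zero, sub_self]
          positivity
    _ ≤ _ := by
        have hi := (h.integrable_norm_pow_mul_exp hc 2).const_mul (c / r)
        rw [← ofReal_integral_eq_lintegral_ofReal hi (ae_of_all _ fun _ => by positivity),
          integral_const_mul]
        refine ENNReal.ofReal_le_ofReal ?_
        have := mul_le_mul_of_nonneg_left (h.integral_norm_pow_mul_exp_le hc 2)
          (div_pos hc hr).le
        refine this.trans (le_of_eq ?_)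
        simp; field_simp

end ExpMoment

/-- The quadratic forms depend continuously on the point: the integrands are unbounded, but their
truncations converge uniformly because fourth moments are bounded. -/
theorem continuous_quadForm {μ : Kernel (E d) (E d)} [IsMarkovKernel μ] {b : E d → E d}
    (h : StandingAssumptions μ b) {c D : ℝ} (hc : 0 < c) (hm : ∀ x, ExpMoment (μ x) c D)
    (α : E d) : Continuous fun x => quadForm (μ x) α := by
  have hB : ∀ N : ℕ, Continuous fun x => ∫ y, min (inner ℝ y α ^ 2) (N : ℝ) ∂(μ x) := by
    intro N
    let f : BoundedContinuousFunction (E d) ℝ := BoundedContinuousFunction.ofNormedAddCommGroup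
      (fun y => min (inner ℝ y α ^ 2) (N : ℝ)) (by fun_prop) N (fun y => by
        rw [Real.norm_of_nonneg (by positivity)]; exact min_le_right _ _)
    exact (ProbabilityMeasure.continuous_integral_boundedContinuousFunction f).comp h.weak_cont
  set C := ‖α‖ ^ 4 * ((4 : ℕ).factorial / c ^ 4 * D) with hC
  have hlim : Tendsto (fun N : ℕ => C / ((N : ℝ) + 1)) atTop (𝓝 0) := by
    have := tendsto_one_div_add_atTop_nhds_zero_nat (𝕜 := ℝ)
    simpa [div_eq_mul_inv] using this.const_mul C
  have hu : TendstoUniformly (fun (N : ℕ) x => ∫ y, min (inner ℝ y α ^ 2) ((N + 1 : ℕ) : ℝ) ∂(μ x))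
      (fun x => quadForm (μ x) α) atTop := by
    rw [Metric.tendstoUniformly_iff]
    intro ε hε
    filter_upwards [hlim.eventually (gt_mem_nhds hε)] with N hN x
    refine lt_of_le_of_lt ?_ hN
    have hi2 := (hm x).integrable_inner_pow hc α 2
    have hi4 := ((hm x).integrable_norm_pow hc 4).const_mul (‖α‖ ^ 4)
    have him : Integrable (fun y => min (inner ℝ y α ^ 2) ((N + 1 : ℕ) : ℝ)) (μ x) :=
      hi2.mono' (by fun_prop) (ae_of_all _ fun y => by
        rw [Real.norm_of_nonneg (by positivity)]; exact min_le_left _ _)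
    rw [Real.dist_eq, quadForm, ← integral_sub hi2 him, abs_of_nonneg (integral_nonneg fun y => by
      simp)]
    calc ∫ y, (inner ℝ y α ^ 2 - min (inner ℝ y α ^ 2) ((N + 1 : ℕ) : ℝ)) ∂(μ x)
        ≤ ∫ y, (‖α‖ ^ 4 * ‖y‖ ^ 4) / (N + 1) ∂(μ x) := by
          refine integral_mono (hi2.sub him) (hi4.div_const _) fun y => ?_
          have h4 := inner_pow_le y α 4
          rw [le_div_iff₀ (by positivity)]
          have e4 : |inner ℝ y α| ^ 4 = (inner ℝ y α ^ 2) ^ 2 := by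
            rw [← pow_mul]; exact Even.pow_abs (by decide) _
          rw [e4] at h4
          push_cast
          set u := inner ℝ y α ^ 2
          have hu : 0 ≤ u := sq_nonneg _
          rcases le_total u (N + 1 : ℝ) with hle | hle
          · rw [min_eq_left hle]; simp; positivity
          · rw [min_eq_right hle]; nlinarith
      _ ≤ _ := by
          rw [integral_div, integral_const_mul]
          gcongr
          exact mul_le_mul_of_nonneg_left ((hm x).integral_norm_pow_le hc 4) (by positivity)
  exact hu.continuous (Frequently.of_forall fun N => hB (N + 1))

end ExponentialMoments

/-! ### A maximal inequality for orthogonal increments -/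

section Maximal

variable {Ω F : Type*} [NormedAddCommGroup F]

/-- The partial sums of `Δ`, stopped when they first reach norm `ε`. -/
noncomputable def stoppedSum (Δ : ℕ → Ω → F) (ε : ℝ) (k : ℕ) (ω : Ω) : F :=
  ∑ i ∈ Finset.range k,
    {ω | ∀ j ≤ i, ‖∑ l ∈ Finset.range j, Δ l ω‖ < ε}.indicator (Δ i) ω

theorem norm_stoppedSum_ge {Δ : ℕ → Ω → F} {ε : ℝ} {n : ℕ} {ω : Ω}
    (h : ∃ k ≤ n, ε ≤ ‖∑ l ∈ Finset.range k, Δ l ω‖) : ε ≤ ‖stoppedSum Δ ε n ω‖ := by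
  classical
  obtain ⟨hk, hkε⟩ := Nat.find_spec h
  set k := Nat.find h
  have hmin : ∀ j < k, ‖∑ l ∈ Finset.range j, Δ l ω‖ < ε := fun j hj => by
    have := Nat.find_min h hj
    simp only [not_and, not_le] at this
    exact this (hj.le.trans hk)
  have : stoppedSum Δ ε n ω = ∑ l ∈ Finset.range k, Δ l ω := by
    rw [stoppedSum, ← Finset.sum_subset (Finset.range_mono hk)]
    · refine Finset.sum_congr rfl fun i hi => ?_
      rw [indicator_of_mem]
      exact fun j hj => hmin j (hj.trans_lt (Finset.mem_range.1 hi))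
    · intro i _ hi
      rw [indicator_of_notMem]
      intro hmem
      exact absurd (hmem k (by simpa using hi)) (not_lt.2 hkε)
  rwa [this]

variable [mΩ : MeasurableSpace Ω] {P : Measure Ω} [IsProbabilityMeasure P]
  [InnerProductSpace ℝ F] [MeasurableSpace F] [BorelSpace F] [SecondCountableTopology F]

/-- **Kolmogorov's maximal inequality** for bounded increments orthogonal to the past. -/
theorem maximal_ineq_of_orthogonal {𝓕 : Filtration ℕ mΩ} {Δ : ℕ → Ω → F} {B : ℝ}
    (hB : ∀ k ω, ‖Δ k ω‖ ≤ B) (hadapt : ∀ k, Measurable[𝓕 (k + 1)] (Δ k))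
    (horth : ∀ k (ψ : Ω → F) (C : ℝ), Measurable[𝓕 k] ψ → (∀ ω, ‖ψ ω‖ ≤ C) →
      ∫ ω, inner ℝ (ψ ω) (Δ k ω) ∂P = 0) {ε : ℝ} (hε : 0 < ε) (n : ℕ) :
    P {ω | ∃ k ≤ n, ε ≤ ‖∑ l ∈ Finset.range k, Δ l ω‖} ≤
      ENNReal.ofReal ((∑ k ∈ Finset.range n, ∫ ω, ‖Δ k ω‖ ^ 2 ∂P) / ε ^ 2) := by
  have hSm : ∀ k, Measurable[𝓕 k] fun ω => ∑ l ∈ Finset.range k, Δ l ω := fun k =>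
    Finset.measurable_fun_sum _ fun l hl =>
      (hadapt l).mono (𝓕.mono (Finset.mem_range.1 hl)) le_rfl
  have hA : ∀ i, MeasurableSet[𝓕 i] {ω | ∀ j ≤ i, ‖∑ l ∈ Finset.range j, Δ l ω‖ < ε} := by
    intro i
    simp only [Set.ofPred_forall]
    refine MeasurableSet.iInter fun j => MeasurableSet.iInter fun hj => ?_
    exact (measurable_norm.comp ((hSm j).mono (𝓕.mono hj) le_rfl)) measurableSet_Iio
  have hTm : ∀ k, Measurable[𝓕 k] (stoppedSum Δ ε k) := fun k =>
    Finset.measurable_fun_sum _ fun l hl =>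
      ((hadapt l).mono (𝓕.mono (Finset.mem_range.1 hl)) le_rfl).indicator
        (𝓕.mono (Finset.mem_range.1 hl).le _ (hA l))
  have hB0 : 0 ≤ B := by
    obtain ⟨ω⟩ := nonempty_of_isProbabilityMeasure P
    exact (norm_nonneg _).trans (hB 0 ω)
  have hTB : ∀ k ω, ‖stoppedSum Δ ε k ω‖ ≤ k * B := fun k ω => by
    calc ‖stoppedSum Δ ε k ω‖ ≤ ∑ i ∈ Finset.range k, B := norm_sum_le_of_le _ fun i _ =>
          (norm_indicator_le_norm_self _ _).trans (hB i ω)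
      _ = k * B := by simp
  have hΔm : ∀ k, Measurable (Δ k) := fun k => (hadapt k).mono (𝓕.le _) le_rfl
  have hTm' : ∀ k, Measurable (stoppedSum Δ ε k) := fun k => (hTm k).mono (𝓕.le _) le_rfl
  have hiT : ∀ k, Integrable (fun ω => ‖stoppedSum Δ ε k ω‖ ^ 2) P := fun k =>
    Integrable.of_bound ((hTm' k).norm.pow_const 2).aestronglyMeasurable ((k * B) ^ 2)
      (ae_of_all _ fun ω => by
        rw [Real.norm_of_nonneg (by positivity)]
        exact pow_le_pow_left₀ (norm_nonneg _) (hTB k ω) 2)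
  have hiΔ : ∀ k, Integrable (fun ω => ‖Δ k ω‖ ^ 2) P := fun k =>
    Integrable.of_bound ((hΔm k).norm.pow_const 2).aestronglyMeasurable (B ^ 2)
      (ae_of_all _ fun ω => by
        rw [Real.norm_of_nonneg (by positivity)]
        exact pow_le_pow_left₀ (norm_nonneg _) (hB k ω) 2)
  have hmain : ∀ k, ∫ ω, ‖stoppedSum Δ ε k ω‖ ^ 2 ∂P ≤
      ∑ k ∈ Finset.range k, ∫ ω, ‖Δ k ω‖ ^ 2 ∂P := by
    intro k
    induction k with
    | zero => simp [stoppedSum]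
    | succ k ih =>
      rw [Finset.sum_range_succ]
      set A := {ω | ∀ j ≤ k, ‖∑ l ∈ Finset.range j, Δ l ω‖ < ε} with hAdef
      have hψm : Measurable[𝓕 k] (A.indicator (stoppedSum Δ ε k)) := (hTm k).indicator (hA k)
      have hψB : ∀ ω, ‖A.indicator (stoppedSum Δ ε k) ω‖ ≤ k * B := fun ω =>
        (norm_indicator_le_norm_self _ _).trans (hTB k ω)
      have h0 := horth k _ _ hψm hψB
      have hin : Integrable (fun ω => inner ℝ (A.indicator (stoppedSum Δ ε k) ω) (Δ k ω)) P := by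
        refine Integrable.of_bound ((hψm.mono (𝓕.le _) le_rfl).inner (hΔm k)).aestronglyMeasurable
          (k * B * B) (ae_of_all _ fun ω => (norm_inner_le_norm _ _).trans ?_)
        exact mul_le_mul (hψB ω) (hB k ω) (norm_nonneg _) (by positivity)
      calc ∫ ω, ‖stoppedSum Δ ε (k + 1) ω‖ ^ 2 ∂P
          ≤ ∫ ω, (‖stoppedSum Δ ε k ω‖ ^ 2 +
              2 * inner ℝ (A.indicator (stoppedSum Δ ε k) ω) (Δ k ω) + ‖Δ k ω‖ ^ 2) ∂P := by
            refine integral_mono (hiT _) (((hiT k).add (hin.const_mul 2)).add (hiΔ k)) fun ω => ?_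
            have hs : stoppedSum Δ ε (k + 1) ω = stoppedSum Δ ε k ω + A.indicator (Δ k) ω := by
              rw [stoppedSum, Finset.sum_range_succ]; rfl
            simp only [hs]
            by_cases hω : ω ∈ A
            · simp only [indicator_of_mem hω]
              rw [norm_add_sq_real]
            · simp only [indicator_of_notMem hω, inner_zero_left, add_zero, mul_zero]
              nlinarith [sq_nonneg ‖Δ k ω‖]
        _ = ∫ ω, ‖stoppedSum Δ ε k ω‖ ^ 2 ∂P + ∫ ω, ‖Δ k ω‖ ^ 2 ∂P := by
            have h12 : Integrable (fun ω => ‖stoppedSum Δ ε k ω‖ ^ 2 +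
              2 * inner ℝ (A.indicator (stoppedSum Δ ε k) ω) (Δ k ω)) P :=
              (hiT k).add (hin.const_mul 2)
            rw [integral_add h12 (hiΔ k), integral_add (hiT k) (hin.const_mul 2),
              integral_const_mul, h0]
            ring
        _ ≤ _ := by linarith
  calc P {ω | ∃ k ≤ n, ε ≤ ‖∑ l ∈ Finset.range k, Δ l ω‖}
      ≤ P {ω | ENNReal.ofReal (ε ^ 2) ≤ ENNReal.ofReal (‖stoppedSum Δ ε n ω‖ ^ 2)} := by
        refine measure_mono fun ω hω => ENNReal.ofReal_le_ofReal ?_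
        exact pow_le_pow_left₀ hε.le (norm_stoppedSum_ge hω) 2
    _ ≤ (∫⁻ ω, ENNReal.ofReal (‖stoppedSum Δ ε n ω‖ ^ 2) ∂P) / ENNReal.ofReal (ε ^ 2) :=
        meas_ge_le_lintegral_div ((hTm' n).norm.pow_const 2).ennreal_ofReal.aemeasurable
          (by simp [hε.ne']) ENNReal.ofReal_ne_top
    _ ≤ _ := by
        rw [← ofReal_integral_eq_lintegral_ofReal (hiT n) (ae_of_all _ fun _ => by positivity),
          ← ENNReal.ofReal_div_of_pos (by positivity)]
        exact ENNReal.ofReal_le_ofReal (div_le_div_of_nonneg_right (hmain n) (by positivity))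

end Maximal

/-! ### Conditional distributions of the controls -/

section Controls

variable {d n : ℕ} (η : Measure (Fin n → E d)) [IsProbabilityMeasure η]

instance (i : Fin n) (v : Fin n → E d) : IsProbabilityMeasure (control η i v) := by
  unfold ModerateDeviations.control; infer_instance

theorem measurable_past (i : Fin n) : Measurable (past (d := d) i) :=
  measurable_pi_lambda _ fun _ => measurable_pi_apply _

theorem measurable_lintegral_control (i : Fin n) {f : E d → ℝ≥0∞} (hf : Measurable f) :
    Measurable fun v => ∫⁻ y, f y ∂(control η i v) :=
  (hf.lintegral_kernel (κ := condDistrib (fun u : Fin n → E d => u i) (past i) η)).comp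
    (measurable_past i)

/-- The tower property of the conditional distributions. -/
theorem lintegral_control (i : Fin n) {f : E d → ℝ≥0∞} (hf : Measurable f) :
    ∫⁻ v, ∫⁻ y, f y ∂(control η i v) ∂η = ∫⁻ v, f (v i) ∂η := by
  have h := condDistrib_comp_map (μ := η) (X := past i) (Y := fun u : Fin n → E d => u i)
    (measurable_past i).aemeasurable (measurable_pi_apply i).aemeasurable
  have h2 : ∫⁻ y, f y ∂(η.map fun u : Fin n → E d => u i) = ∫⁻ v, f (v i) ∂η :=
    lintegral_map hf (measurable_pi_apply i)
  rw [← h2, ← h, Measure.lintegral_bind (Kernel.aemeasurable _) hf.aemeasurable,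
    lintegral_map (hf.lintegral_kernel) (measurable_past i)]
  rfl

theorem measurable_integral_control (i : Fin n) {f : E d → E d} (hf : Measurable f) :
    Measurable[MeasurableSpace.comap (past (d := d) i) inferInstance]
      fun v => ∫ y, f y ∂(control η i v) := by
  have : StronglyMeasurable fun x => ∫ y, f y ∂(condDistrib (fun u : Fin n → E d => u i)
      (past i) η x) := hf.stronglyMeasurable.integral_kernel
  exact this.measurable.comp (comap_measurable (past i))

theorem norm_integral_control_le (i : Fin n) {g : E d → E d} {r : ℝ} (hr : ∀ y, ‖g y‖ ≤ r)
    (v : Fin n → E d) : ‖∫ y, g y ∂(control η i v)‖ ≤ r := by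
  simpa using norm_integral_le_of_norm_le_const (μ := control η i v) (ae_of_all _ hr)

/-- The centred controls are orthogonal to functions of the past. -/
theorem integral_inner_control (i : Fin n) {ψ : (Fin n → E d) → E d} {C r : ℝ} {g : E d → E d}
    (hψ : Measurable[MeasurableSpace.comap (past (d := d) i) inferInstance] ψ)
    (hC : ∀ v, ‖ψ v‖ ≤ C) (hg : Measurable g) (hr : ∀ y, ‖g y‖ ≤ r) :
    ∫ v, inner ℝ (ψ v) (g (v i) - ∫ y, g y ∂(control η i v)) ∂η = 0 := by
  obtain ⟨ψ', hψ', rfl⟩ := hψ.exists_eq_measurable_comp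
  have hpast := measurable_past (d := d) i
  have hmean : Measurable fun v => ∫ y, g y ∂(control η i v) :=
    (measurable_integral_control η i hg).mono hpast.comap_le le_rfl
  have hC0 : 0 ≤ C := by
    obtain ⟨v⟩ := nonempty_of_isProbabilityMeasure η
    exact (norm_nonneg _).trans (hC v)
  have hbd : ∀ {f : (Fin n → E d) → E d}, Measurable f → (∀ v, ‖f v‖ ≤ r) →
      Integrable (fun v => inner ℝ ((ψ' ∘ past i) v) (f v)) η := fun {f} hf hfr =>
    Integrable.of_bound ((hψ'.comp hpast).inner hf).aestronglyMeasurable (C * r)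
      (ae_of_all _ fun v => (norm_inner_le_norm _ _).trans
        (mul_le_mul (hC v) (hfr v) (norm_nonneg _) hC0))
  have hi1 := hbd (f := fun v => g (v i)) (hg.comp (measurable_pi_apply i)) fun v => hr _
  have hi2 := hbd hmean fun v => norm_integral_control_le η i hr v
  have hce := condExp_prod_ae_eq_integral_condDistrib (μ := η) (X := past i)
    (Y := fun u : Fin n → E d => u i) (f := fun p : (Fin i → E d) × E d => inner ℝ (ψ' p.1) (g p.2))
    hpast (measurable_pi_apply i).aemeasurable
    ((hψ'.comp measurable_fst).inner (hg.comp measurable_snd)).stronglyMeasurable hi1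
  have h1 := integral_congr_ae hce
  rw [integral_condExp hpast.comap_le] at h1
  have h2 : ∀ v, ∫ y, inner ℝ (ψ' (past i v)) (g y)
      ∂(condDistrib (fun u : Fin n → E d => u i) (past i) η (past i v)) =
      inner ℝ ((ψ' ∘ past i) v) (∫ y, g y ∂(control η i v)) := fun v => by
    refine integral_inner (𝕜 := ℝ) ?_ _
    exact Integrable.of_bound hg.aestronglyMeasurable r (ae_of_all _ hr)
  simp only [h2] at h1
  simp only [inner_sub_right]
  rw [integral_sub hi1 hi2, sub_eq_zero]
  exact h1

theorem integral_norm_sq_control_le (i : Fin n) {r : ℝ} {g : E d → E d}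
    (hg : Measurable g) (hr : ∀ y, ‖g y‖ ≤ r) :
    ∫ v, ‖g (v i) - ∫ y, g y ∂(control η i v)‖ ^ 2 ∂η ≤ ∫ v, ‖g (v i)‖ ^ 2 ∂η := by
  have hpast := measurable_past (d := d) i
  have hmeas := measurable_integral_control η i hg
  have hmean : Measurable fun v => ∫ y, g y ∂(control η i v) := hmeas.mono hpast.comap_le le_rfl
  have hgm : Measurable fun v : Fin n → E d => g (v i) := hg.comp (measurable_pi_apply i)
  have hmr := fun v => norm_integral_control_le η i hr v
  have h0 := integral_inner_control η i hmeas hmr hg hr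
  have hi : ∀ {f : (Fin n → E d) → E d} {C : ℝ}, Measurable f → (∀ v, ‖f v‖ ≤ C) →
      Integrable (fun v => ‖f v‖ ^ 2) η := fun {f C} hf hfr =>
    Integrable.of_bound (hf.norm.pow_const 2).aestronglyMeasurable (C ^ 2)
      (ae_of_all _ fun v => by
        rw [Real.norm_of_nonneg (by positivity)]
        exact pow_le_pow_left₀ (norm_nonneg _) (hfr v) 2)
  have hr2 : ∀ v : Fin n → E d, ‖g (v i) - ∫ y, g y ∂(control η i v)‖ ≤ r + r := fun v =>
    (norm_sub_le _ _).trans (add_le_add (hr _) (hmr v))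
  have hr0 : 0 ≤ r := (norm_nonneg _).trans (hr 0)
  have hin : Integrable (fun v => inner ℝ (∫ y, g y ∂(control η i v))
      (g (v i) - ∫ y, g y ∂(control η i v))) η :=
    Integrable.of_bound (hmean.inner (hgm.sub hmean)).aestronglyMeasurable (r * (r + r))
      (ae_of_all _ fun v => (norm_inner_le_norm _ _).trans
        (mul_le_mul (hmr v) (hr2 v) (norm_nonneg _) hr0))
  calc ∫ v, ‖g (v i) - ∫ y, g y ∂(control η i v)‖ ^ 2 ∂η
      ≤ ∫ v, (‖g (v i)‖ ^ 2 - 2 * inner ℝ (∫ y, g y ∂(control η i v))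
          (g (v i) - ∫ y, g y ∂(control η i v))) ∂η := by
        refine integral_mono (hi (hgm.sub hmean) hr2) ((hi hgm fun v => hr _).sub (hin.const_mul 2))
          fun v => ?_
        simp only
        set m := ∫ y, g y ∂(control η i v)
        have h1 : ‖g (v i)‖ ^ 2 = ‖(g (v i) - m) + m‖ ^ 2 := by simp
        rw [h1, norm_add_sq_real, real_inner_comm]
        nlinarith [sq_nonneg ‖m‖]
    _ = _ := by
        rw [integral_sub (hi hgm fun v => hr _) (hin.const_mul 2), integral_const_mul, h0]
        simp

/-- The filtration generated by the noises. -/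
def noiseFiltration (d n : ℕ) :
    Filtration ℕ (inferInstance : MeasurableSpace (Fin n → E d)) where
  seq k := MeasurableSpace.comap (fun (v : Fin n → E d) (j : Fin k) => noise v j) inferInstance
  mono' k l hkl := by
    have : (fun (v : Fin n → E d) (j : Fin k) => noise v j) =
        (fun (u : Fin l → E d) (j : Fin k) => u (Fin.castLE hkl j)) ∘
          (fun (v : Fin n → E d) (j : Fin l) => noise v j) := rfl
    simp only
    rw [this, ← MeasurableSpace.comap_comp]
    exact MeasurableSpace.comap_mono (Measurable.comap_le (by fun_prop))
  le' k := by
    refine Measurable.comap_le (measurable_pi_lambda _ fun j => ?_)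
    unfold noise
    split_ifs <;> fun_prop

theorem noiseFiltration_eq (i : Fin n) :
    noiseFiltration d n i = MeasurableSpace.comap (past (d := d) i) inferInstance := by
  have : (fun (v : Fin n → E d) (j : Fin i) => noise v j) = past i := by
    ext v j : 2
    have : (j : ℕ) < n := j.2.trans i.2
    simp only [noise, this, dif_pos, past]
    rfl
  change MeasurableSpace.comap _ _ = _
  rw [this]

theorem measurable_noise (k : ℕ) :
    Measurable[noiseFiltration d n (k + 1)] fun v : Fin n → E d => noise v k :=
  (measurable_pi_apply (⟨k, k.lt_succ_self⟩ : Fin (k + 1))).comp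
    (comap_measurable (fun (v : Fin n → E d) (j : Fin (k + 1)) => noise v j))

/-- The conditional mean of `g(v_k)` given the past, extended by zero to `k ≥ n`. -/
noncomputable def predMean (g : E d → E d) (k : ℕ) (v : Fin n → E d) : E d :=
  if h : k < n then ∫ y, g y ∂(control η ⟨k, h⟩ v) else 0

theorem measurable_predMean {g : E d → E d} (hg : Measurable g) (k : ℕ) :
    Measurable[noiseFiltration d n k] (predMean η g k) := by
  unfold predMean
  split_ifs with h
  · have := measurable_integral_control η ⟨k, h⟩ hg
    rwa [← noiseFiltration_eq] at this
  · exact measurable_const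

theorem maximal_ineq_control {g : E d → E d} {r : ℝ} (hg : Measurable g) (hr : ∀ y, ‖g y‖ ≤ r)
    (hg0 : g 0 = 0) {ε : ℝ} (hε : 0 < ε) :
    η {v | ∃ k ≤ n, ε ≤ ‖∑ l ∈ Finset.range k, (g (noise v l) - predMean η g l v)‖} ≤
      ENNReal.ofReal ((∑ i, ∫ v, ‖g (v i)‖ ^ 2 ∂η) / ε ^ 2) := by
  have hr0 : 0 ≤ r := (norm_nonneg _).trans (hr 0)
  have hz : ∀ k, ¬ k < n → ∀ v, g (noise v k) - predMean η g k v = 0 := fun k hk v => by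
    simp [noise, predMean, hk, hg0]
  have hs : ∀ (k) (hk : k < n) (v : Fin n → E d), g (noise v k) - predMean η g k v =
      g (v ⟨k, hk⟩) - ∫ y, g y ∂(control η ⟨k, hk⟩ v) := fun k hk v => by
    simp [noise, predMean, hk]
  refine (maximal_ineq_of_orthogonal (P := η) (𝓕 := noiseFiltration d n) (B := r + r)
    (Δ := fun k v => g (noise v k) - predMean η g k v) ?_ ?_ ?_ hε n).trans ?_
  · intro k v
    by_cases hk : k < n
    · rw [hs k hk]
      exact (norm_sub_le _ _).trans (add_le_add (hr _) (norm_integral_control_le η _ hr v))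
    · rw [hz k hk]; simpa using by linarith
  · intro k
    exact (hg.comp (measurable_noise k)).sub
      ((measurable_predMean η hg k).mono ((noiseFiltration d n).mono k.le_succ) le_rfl)
  · intro k ψ C hψ hC
    by_cases hk : k < n
    · simp only [hs k hk]
      have hψ' := hψ
      have e := noiseFiltration_eq (d := d) (⟨k, hk⟩ : Fin n)
      simp only at e
      rw [e] at hψ'
      exact integral_inner_control η ⟨k, hk⟩ hψ' hC hg hr
    · simp [hz k hk]
  · refine ENNReal.ofReal_le_ofReal (div_le_div_of_nonneg_right ?_ (by positivity))
    rw [← Fin.sum_univ_eq_sum_range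
      (fun k => ∫ v, ‖g (noise v k) - predMean η g k v‖ ^ 2 ∂η) n]
    refine Finset.sum_le_sum fun i _ => ?_
    simp only [hs i i.2]
    exact integral_norm_sq_control_le η i hg hr

end Controls

/-! ### Entropy bounds for the controls -/

section EntropyBounds

variable {d n : ℕ} (η : Measure (Fin n → E d)) [IsProbabilityMeasure η]
  (ρ : Fin n → (Fin n → E d) → Measure (E d))

/-- The total relative entropy `E ∑ R(η_i ‖ ρ_i)`. -/
noncomputable def totalEntropy : ℝ≥0∞ := ∫⁻ v, ∑ i, klDiv (control η i v) (ρ i v) ∂η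

variable {η ρ}

theorem sum_lintegral_le_totalEntropy {f : E d → ℝ≥0∞} (hf : Measurable f) {B : ℝ≥0∞}
    (h : ∀ i v, ∫⁻ y, f y ∂(control η i v) ≤ klDiv (control η i v) (ρ i v) + B) :
    ∑ i, ∫⁻ v, f (v i) ∂η ≤ totalEntropy η ρ + n * B := by
  calc ∑ i, ∫⁻ v, f (v i) ∂η = ∫⁻ v, ∑ i, ∫⁻ y, f y ∂(control η i v) ∂η := by
        rw [lintegral_finsetSum _ fun i _ => measurable_lintegral_control η i hf]
        simp only [lintegral_control η _ hf]
    _ ≤ ∫⁻ v, (∑ i, klDiv (control η i v) (ρ i v) + n * B) ∂η := by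
        refine lintegral_mono fun v => (Finset.sum_le_sum fun i _ => h i v).trans ?_
        rw [Finset.sum_add_distrib]
        simp
    _ = _ := by rw [lintegral_add_right _ measurable_const]; simp [totalEntropy]

variable [∀ i v, IsProbabilityMeasure (ρ i v)] {c D : ℝ}

/-- The truncation `y ↦ y 1{‖y‖ ≤ r}`. -/
noncomputable def innerPart (r : ℝ) (y : E d) : E d :=
  (Metric.closedBall (0 : E d) r).indicator id y

/-- The remainder `y ↦ y 1{‖y‖ > r}` of the truncation. -/
noncomputable def outerPart (r : ℝ) (y : E d) : E d :=
  (Metric.closedBall (0 : E d) r)ᶜ.indicator id y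

theorem innerPart_add_outerPart (r : ℝ) (y : E d) : innerPart r y + outerPart r y = y :=
  indicator_self_add_compl_apply _ _ _

theorem measurable_innerPart (r : ℝ) : Measurable (innerPart (d := d) r) :=
  measurable_id.indicator Metric.isClosed_closedBall.measurableSet

theorem measurable_outerPart (r : ℝ) : Measurable (outerPart (d := d) r) :=
  measurable_id.indicator Metric.isClosed_closedBall.measurableSet.compl

theorem norm_innerPart_le {r : ℝ} (hr : 0 ≤ r) (y : E d) : ‖innerPart r y‖ ≤ r := by
  by_cases hy : y ∈ Metric.closedBall (0 : E d) r
  · rw [innerPart, indicator_of_mem hy]; simpa using hy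
  · rw [innerPart, indicator_of_notMem hy]; simpa using hr

theorem sum_integral_innerPart_le (hc : 0 < c) (hm : ∀ i v, ExpMoment (ρ i v) c D)
    (hD : 0 ≤ D) (hT : totalEntropy η ρ ≠ ∞) {r : ℝ} (hr : 0 < r) :
    ∑ i, ∫ v, ‖innerPart r (v i)‖ ^ 2 ∂η ≤
      r / c * ((totalEntropy η ρ).toReal + n * (2 * D / (c * r))) := by
  have hcr : 0 < c / r := by positivity
  have hf : Measurable fun y : E d => ENNReal.ofReal (c / r * ‖innerPart r y‖ ^ 2) := by
    have := measurable_innerPart (d := d) r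
    fun_prop
  have h := sum_lintegral_le_totalEntropy (η := η) (ρ := ρ) hf
    (B := ENNReal.ofReal (2 * D / (c * r))) (fun i v => by
      refine le_trans (le_of_eq ?_) ((hm i v).lintegral_norm_sq_le hc (control η i v) hr)
      congr 1 with y
      by_cases hy : y ∈ Metric.closedBall (0 : E d) r
      · simp only [innerPart, indicator_of_mem hy, id]
      · simp only [innerPart, indicator_of_notMem hy]; simp)
  have hi : ∀ i, Integrable (fun v : Fin n → E d => c / r * ‖innerPart r (v i)‖ ^ 2) η :=
      fun i => by
    refine (Integrable.of_bound (((measurable_innerPart r).comp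
      (measurable_pi_apply i)).norm.pow_const 2).aestronglyMeasurable (r ^ 2)
      (ae_of_all _ fun v => ?_)).const_mul _
    rw [Real.norm_of_nonneg (by positivity)]
    exact pow_le_pow_left₀ (norm_nonneg _) (norm_innerPart_le hr.le _) 2
  have h2 : ∀ i, ∫⁻ v, ENNReal.ofReal (c / r * ‖innerPart r (v i)‖ ^ 2) ∂η =
      ENNReal.ofReal (c / r * ∫ v, ‖innerPart r (v i)‖ ^ 2 ∂η) := fun i => by
    rw [← ofReal_integral_eq_lintegral_ofReal (hi i) (ae_of_all _ fun v => by positivity),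
      integral_const_mul]
  simp only [h2] at h
  have hnn : ∀ i, 0 ≤ ∫ v, ‖innerPart r (v i)‖ ^ 2 ∂η := fun i =>
    integral_nonneg fun v => by positivity
  rw [← ENNReal.ofReal_sum_of_nonneg (fun i _ => mul_nonneg hcr.le (hnn i)), ← Finset.mul_sum,
    ← ENNReal.ofReal_toReal hT, ← ENNReal.ofReal_natCast n,
    ← ENNReal.ofReal_mul (by positivity), ← ENNReal.ofReal_add (by positivity) (by positivity),
    ENNReal.ofReal_le_ofReal_iff (by positivity)] at h
  rw [div_mul_eq_mul_div, div_le_iff₀ hr] at h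
  rw [div_mul_eq_mul_div, le_div_iff₀ hc]
  nlinarith

theorem sum_lintegral_outerPart_le (hc : 0 < c) (hm : ∀ i v, ExpMoment (ρ i v) c D)
    (hD : 0 ≤ D) (hT : totalEntropy η ρ ≠ ∞) {r : ℝ} (hr : 0 < r) :
    ∑ i, ∫⁻ v, ENNReal.ofReal ‖outerPart r (v i)‖ ∂η ≤
      ENNReal.ofReal (1 / c * ((totalEntropy η ρ).toReal + n * (D / (c * r)))) := by
  have hom := measurable_outerPart (d := d) r
  have hf : Measurable fun y : E d => ENNReal.ofReal (c * ‖outerPart r y‖) := by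
    fun_prop
  have h := sum_lintegral_le_totalEntropy (η := η) (ρ := ρ) hf
    (B := ENNReal.ofReal (D / (c * r))) (fun i v => by
      refine le_trans (le_of_eq ?_) ((hm i v).lintegral_norm_gt_le hc (control η i v) hr)
      congr 1 with y
      by_cases hy : y ∈ (Metric.closedBall (0 : E d) r)ᶜ
      · simp only [outerPart, indicator_of_mem hy, id]
      · simp only [outerPart, indicator_of_notMem hy]; simp)
  have h2 : ∀ i, ∫⁻ v, ENNReal.ofReal ‖outerPart r (v i)‖ ∂η =
      ENNReal.ofReal (1 / c) * ∫⁻ v, ENNReal.ofReal (c * ‖outerPart r (v i)‖) ∂η := fun i => by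
    rw [← lintegral_const_mul' _ _ ENNReal.ofReal_ne_top]
    congr 1 with v
    rw [← ENNReal.ofReal_mul (by positivity)]
    congr 1
    field_simp
  simp only [h2]
  rw [← Finset.mul_sum, ENNReal.ofReal_mul (by positivity)]
  refine mul_le_mul_right (h.trans (le_of_eq ?_)) _
  rw [ENNReal.ofReal_add (by positivity) (by positivity), ENNReal.ofReal_toReal hT,
    ENNReal.ofReal_mul (by positivity), ENNReal.ofReal_natCast]

theorem ae_integrable_control (hc : 0 < c) (hm : ∀ i v, ExpMoment (ρ i v) c D)
    (hT : totalEntropy η ρ ≠ ∞) :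
    ∀ᵐ v ∂η, ∀ i, Integrable (fun y : E d => y) (control η i v) := by
  have hf : Measurable fun y : E d => ENNReal.ofReal (c * ‖y‖) := by fun_prop
  have h := sum_lintegral_le_totalEntropy (η := η) (ρ := ρ) hf
    (B := ENNReal.ofReal D) (fun i v => (hm i v).lintegral_norm_le hc (control η i v))
  rw [ae_all_iff]
  intro i
  have h2 : ∫⁻ v, ∫⁻ y, ENNReal.ofReal (c * ‖y‖) ∂(control η i v) ∂η ≠ ∞ := by
    rw [lintegral_control η i hf]
    refine ne_top_of_le_ne_top ?_ ((Finset.single_le_sum (f := fun i => ∫⁻ v : Fin n → E d,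
      ENNReal.ofReal (c * ‖v i‖) ∂η) (fun _ _ => zero_le) (Finset.mem_univ i)).trans h)
    finiteness
  filter_upwards [ae_lt_top (measurable_lintegral_control η i hf) h2] with v hv
  have h1 : Integrable (fun y : E d => c * ‖y‖) (control η i v) :=
    (lintegral_ofReal_ne_top_iff_integrable (by fun_prop)
      (ae_of_all _ fun _ => by positivity)).1 hv.ne
  have h2 : Integrable (fun y : E d => ‖y‖) (control η i v) := by
    refine (h1.const_mul c⁻¹).congr (ae_of_all _ fun y => ?_)
    simp only; field_simp
  exact (integrable_norm_iff (by fun_prop)).1 h2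

variable (η) in
/-- The centred sums `∑_{l<k} (v_l - E[v_l | v_0, …, v_{l-1}])`. -/
noncomputable def centredSum (k : ℕ) (v : Fin n → E d) : E d :=
  ∑ l ∈ Finset.range k, (noise v l - predMean η id l v)

/-- Maximal inequality for the centred controls. Square integrability fails, so the controls are
truncated at level `r`: the inner part obeys Kolmogorov's inequality, the outer part is bounded in
`L¹`. -/
theorem measure_centredSum_ge_le (hc : 0 < c) (hm : ∀ i v, ExpMoment (ρ i v) c D)
    (hD : 0 ≤ D) (hT : totalEntropy η ρ ≠ ∞) {r : ℝ} (hr : 0 < r) {ε : ℝ} (hε : 0 < ε) :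
    η {v | ∃ k ≤ n, 2 * ε ≤ ‖centredSum η k v‖} ≤
      ENNReal.ofReal (r / c * ((totalEntropy η ρ).toReal + n * (2 * D / (c * r))) / ε ^ 2) +
      ENNReal.ofReal (2 * (1 / c * ((totalEntropy η ρ).toReal + n * (D / (c * r)))) / ε) := by
  have hom := measurable_outerPart (d := d) r
  have hon : Measurable fun y : E d => ENNReal.ofReal ‖outerPart r y‖ := by fun_prop
  set H : (Fin n → E d) → ℝ≥0∞ := fun v => ∑ i, (ENNReal.ofReal ‖outerPart r (v i)‖ +
    ∫⁻ y, ENNReal.ofReal ‖outerPart r y‖ ∂(control η i v)) with hH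
  have hm1 : ∀ i : Fin n, Measurable fun v : Fin n → E d => ENNReal.ofReal ‖outerPart r (v i)‖ :=
    fun i => hon.comp (measurable_pi_apply i)
  have hm2 : ∀ i : Fin n, Measurable fun v : Fin n → E d => ENNReal.ofReal ‖outerPart r (v i)‖ +
      ∫⁻ y, ENNReal.ofReal ‖outerPart r y‖ ∂(control η i v) := fun i =>
    (hm1 i).add (measurable_lintegral_control η i hon)
  have hHm : Measurable H := Finset.measurable_fun_sum _ fun i _ => hm2 i
  have hHint : ∫⁻ v, H v ∂η ≤
      ENNReal.ofReal (2 * (1 / c * ((totalEntropy η ρ).toReal + n * (D / (c * r))))) := by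
    rw [lintegral_finsetSum _ fun i _ => hm2 i]
    have he : ∀ i : Fin n, ∫⁻ v, (ENNReal.ofReal ‖outerPart r (v i)‖ +
        ∫⁻ y, ENNReal.ofReal ‖outerPart r y‖ ∂(control η i v)) ∂η =
        ∫⁻ v, ENNReal.ofReal ‖outerPart r (v i)‖ ∂η +
          ∫⁻ v, ENNReal.ofReal ‖outerPart r (v i)‖ ∂η := fun i => by
      rw [lintegral_add_left (hm1 i), lintegral_control η i hon]
    simp only [he]
    rw [Finset.sum_add_distrib, ← two_mul, ENNReal.ofReal_mul (by norm_num)]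
    simp only [ENNReal.ofReal_ofNat]
    exact mul_le_mul_right (sum_lintegral_outerPart_le hc hm hD hT hr) _
  set A : Set (Fin n → E d) := {v | ∃ k ≤ n, ε ≤ ‖∑ l ∈ Finset.range k,
        (innerPart r (noise v l) - predMean η (innerPart r) l v)‖}
  set B : Set (Fin n → E d) := {v | ENNReal.ofReal ε ≤ H v}
  have hsub : ({v | ∃ k ≤ n, 2 * ε ≤ ‖centredSum η k v‖} : Set (Fin n → E d)) ≤ᵐ[η]
      (A ∪ B : Set (Fin n → E d)) := by
    filter_upwards [ae_integrable_control hc hm hT] with v hv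
    rintro ⟨k, hk, hkε⟩
    by_contra hcon
    change ¬ (_ ∨ _) at hcon
    push Not at hcon
    obtain ⟨h1, h2⟩ := hcon
    have h1 : ‖∑ l ∈ Finset.range k,
        (innerPart r (noise v l) - predMean η (innerPart r) l v)‖ < ε := by
      by_contra hcon
      exact h1 ⟨k, hk, not_lt.1 hcon⟩
    have h2 : H v < ENNReal.ofReal ε := not_le.1 h2
    have hsplit : centredSum η k v = ∑ l ∈ Finset.range k,
          (innerPart r (noise v l) - predMean η (innerPart r) l v) +
        ∑ l ∈ Finset.range k, (outerPart r (noise v l) - predMean η (outerPart r) l v) := by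
      rw [← Finset.sum_add_distrib, centredSum]
      refine Finset.sum_congr rfl fun l hl => ?_
      have hln : l < n := (Finset.mem_range.1 hl).trans_le hk
      have hg : Integrable (innerPart (d := d) r) (control η ⟨l, hln⟩ v) :=
        (hv ⟨l, hln⟩).indicator Metric.isClosed_closedBall.measurableSet
      have ho : Integrable (outerPart (d := d) r) (control η ⟨l, hln⟩ v) :=
        (hv ⟨l, hln⟩).indicator Metric.isClosed_closedBall.measurableSet.compl
      have e1 : predMean η id l v =
            predMean η (innerPart r) l v + predMean η (outerPart r) l v := by
        simp only [predMean, hln, dif_pos]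
        rw [← integral_add hg ho]
        simp only [innerPart_add_outerPart, id]
      rw [e1]
      nth_rewrite 1 [← innerPart_add_outerPart r (noise v l)]
      abel
    have h3 : ENNReal.ofReal ‖∑ l ∈ Finset.range k,
        (outerPart r (noise v l) - predMean η (outerPart r) l v)‖ ≤ H v := by
      calc _ ≤ ENNReal.ofReal (∑ l ∈ Finset.range k,
              ‖outerPart r (noise v l) - predMean η (outerPart r) l v‖) :=
            ENNReal.ofReal_le_ofReal (norm_sum_le _ _)
        _ ≤ ENNReal.ofReal (∑ l ∈ Finset.range n,
              ‖outerPart r (noise v l) - predMean η (outerPart r) l v‖) :=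
            ENNReal.ofReal_le_ofReal (Finset.sum_le_sum_of_subset_of_nonneg
              (Finset.range_mono hk) fun _ _ _ => norm_nonneg _)
        _ = ∑ i : Fin n, ENNReal.ofReal
              ‖outerPart r (noise v i) - predMean η (outerPart r) i v‖ := by
            rw [ENNReal.ofReal_sum_of_nonneg fun _ _ => norm_nonneg _,
              ← Fin.sum_univ_eq_sum_range (fun l => ENNReal.ofReal
                ‖outerPart r (noise v l) - predMean η (outerPart r) l v‖)]
        _ ≤ H v := by
            refine Finset.sum_le_sum fun i _ => ?_
            refine (ENNReal.ofReal_le_ofReal (norm_sub_le _ _)).trans ?_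
            rw [ENNReal.ofReal_add (norm_nonneg _) (norm_nonneg _)]
            simp only [noise, predMean, i.2, dif_pos, Fin.eta]
            gcongr
            rw [ofReal_norm]
            simp only [ofReal_norm]
            exact enorm_integral_le_lintegral_enorm _
    have h4 := (ENNReal.ofReal_lt_ofReal_iff hε).1 (h3.trans_lt h2)
    rw [hsplit] at hkε
    linarith [norm_add_le (∑ l ∈ Finset.range k,
          (innerPart r (noise v l) - predMean η (innerPart r) l v))
        (∑ l ∈ Finset.range k, (outerPart r (noise v l) - predMean η (outerPart r) l v))]
  refine (measure_mono_ae hsub).trans ((measure_union_le _ _).trans (add_le_add ?_ ?_))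
  · refine (maximal_ineq_control η (measurable_innerPart r) (norm_innerPart_le hr.le)
      (by simp [innerPart]) hε).trans (ENNReal.ofReal_le_ofReal ?_)
    gcongr
    exact sum_integral_innerPart_le hc hm hD hT hr
  · refine (meas_ge_le_lintegral_div hHm.aemeasurable (by simpa using hε)
      ENNReal.ofReal_ne_top).trans ?_
    rw [ENNReal.ofReal_div_of_pos hε]
    gcongr

/-- Entropy bound for the amplified conditional means `s ∫ y η_i(dy)`. -/
theorem ofReal_norm_mean_le (hc : 0 < c) (hD : 0 ≤ D) {ρ₀ ν : Measure (E d)}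
    [IsProbabilityMeasure ρ₀] [IsProbabilityMeasure ν] (hm : ExpMoment ρ₀ c D) {s M : ℝ}
    (hs : 0 < s) (hM : 0 ≤ M) (hMs : M ≤ c * s) :
    ENNReal.ofReal (M * (‖s • ∫ y, y ∂ν‖ - 7 * D / c ^ 2 * M)) ≤
      ENNReal.ofReal (s ^ 2) * klDiv ν ρ₀ := by
  set m := ∫ y, y ∂ν with hmdef
  by_cases hm0 : m = 0
  · have : M * (‖s • m‖ - 7 * D / c ^ 2 * M) ≤ 0 := by
      rw [hm0, smul_zero, norm_zero, zero_sub, mul_neg, neg_nonpos]; positivity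
    rw [ENNReal.ofReal_of_nonpos this]; exact zero_le
  have hmp : 0 < ‖m‖ := norm_pos_iff.2 hm0
  -- the test vector of length `M / s` in the direction of the mean
  set α : E d := (M / s / ‖m‖) • m with hα
  have hαn : ‖α‖ = M / s := by
    rw [hα, norm_smul, Real.norm_of_nonneg (by positivity)]; field_simp
  have hαc : ‖α‖ ≤ c := by rw [hαn, div_le_iff₀ hs]; exact hMs
  have hin : inner ℝ m α = M / s * ‖m‖ := by
    rw [hα, inner_smul_right, real_inner_self_eq_norm_sq]; field_simp
  have h := hm.inner_mean_le hc ν hαc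
  rw [← hmdef, hin] at h
  have hq := hm.quadForm_le hc α
  rw [hαn] at h hq
  have hb : quadForm ρ₀ α / 2 + 6 / c ^ 3 * D * (M / s) ^ 3 ≤ 7 * D / c ^ 2 * (M / s) ^ 2 := by
    have h1 : M / s ≤ c := by rwa [hαn] at hαc
    have h2 : 6 / c ^ 3 * D * (M / s) ^ 3 ≤ 6 / c ^ 3 * D * ((M / s) ^ 2 * c) := by
      rw [pow_succ (M / s) 2]; gcongr
    have h3 : 6 / c ^ 3 * D * ((M / s) ^ 2 * c) = 6 * D / c ^ 2 * (M / s) ^ 2 := by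
      field_simp
    have h4 : 7 * D / c ^ 2 * (M / s) ^ 2 =
      2 * D / c ^ 2 * (M / s) ^ 2 / 2 + 6 * D / c ^ 2 * (M / s) ^ 2 := by ring
    linarith
  have h' := mul_le_mul_right (h.trans (add_le_add_right (ENNReal.ofReal_le_ofReal hb) _))
    (ENNReal.ofReal (s ^ 2))
  rw [mul_add, ← ENNReal.ofReal_mul (by positivity), ← ENNReal.ofReal_mul (by positivity)] at h'
  have e1 : M * (‖s • m‖ - 7 * D / c ^ 2 * M) =
      s ^ 2 * (M / s * ‖m‖) - s ^ 2 * (7 * D / c ^ 2 * (M / s) ^ 2) := by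
    rw [norm_smul, Real.norm_of_nonneg hs.le]; field_simp
  rw [e1, ENNReal.ofReal_sub _ (by positivity)]
  exact tsub_le_iff_right.2 h'

end EntropyBounds

/-! ### Step functions on the unit interval -/

section Steps

variable {n : ℕ}

theorem floor_le_of_unitInterval (n : ℕ) (t : I) : ⌊(n * t : ℝ)⌋₊ ≤ n :=
  Nat.floor_le_of_le (mul_le_of_le_one_right (Nat.cast_nonneg n) t.2.2)

theorem measurable_floor_mul (n : ℕ) : Measurable fun t : I => ⌊(n * t : ℝ)⌋₊ :=
  Nat.measurable_floor.comp (by fun_prop)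

/-- The grid point `k / n`. -/
noncomputable def gridPoint {k n : ℕ} (hn : 0 < n) (hk : k ≤ n) : I :=
  ⟨k / n, by positivity, by
    rw [div_le_one (by exact_mod_cast hn)]; exact_mod_cast hk⟩

theorem floor_gridPoint {k : ℕ} (hn : 0 < n) (hk : k ≤ n) :
    ⌊(n * (gridPoint hn hk : I) : ℝ)⌋₊ = k := by
  have : (n * (gridPoint hn hk : I) : ℝ) = k := by
    have : (n : ℝ) ≠ 0 := by exact_mod_cast hn.ne'
    simp only [gridPoint]; field_simp
  rw [this, Nat.floor_natCast]

theorem floor_eq_iff_mem_Ico {k : ℕ} (hn : 0 < n) (hk : k < n) (t : I) :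
    ⌊(n * t : ℝ)⌋₊ = k ↔ t ∈ Ico (gridPoint hn hk.le) (gridPoint hn (Nat.succ_le_of_lt hk)) := by
  have hn' : (0 : ℝ) < n := by exact_mod_cast hn
  rw [Nat.floor_eq_iff (mul_nonneg hn'.le t.2.1), mem_Ico, ← Subtype.coe_le_coe,
    ← Subtype.coe_lt_coe]
  simp only [gridPoint, div_le_iff₀ hn', lt_div_iff₀ hn']
  push_cast
  rw [mul_comm (t : ℝ)]

theorem volume_floor_eq {k : ℕ} (hn : 0 < n) (hk : k < n) :
    volume {t : I | ⌊(n * t : ℝ)⌋₊ = k} = (n : ℝ≥0∞)⁻¹ := by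
  have : {t : I | ⌊(n * t : ℝ)⌋₊ = k} =
      Ico (gridPoint hn hk.le) (gridPoint hn (Nat.succ_le_of_lt hk)) := by
    ext t; exact floor_eq_iff_mem_Ico hn hk t
  have hn' : (0 : ℝ) < n := by exact_mod_cast hn
  rw [this, volume_Ico]
  simp only [gridPoint]
  rw [← ENNReal.ofReal_natCast n, ← ENNReal.ofReal_inv_of_pos hn']
  congr 1
  push_cast
  field_simp
  ring

theorem volume_floor_eq_zero {k : ℕ} (hn : 0 < n) (hk : n ≤ k) :
    volume {t : I | ⌊(n * t : ℝ)⌋₊ = k} = 0 := by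
  refine measure_mono_null (t := {1}) (fun t ht => ?_) (by simp)
  have ht : ⌊(n * t : ℝ)⌋₊ = k := ht
  have hn' : (0 : ℝ) < n := by exact_mod_cast hn
  have h1 := Nat.floor_le (mul_nonneg hn'.le t.2.1)
  rw [ht] at h1
  have h2 : (n : ℝ) ≤ k := by exact_mod_cast hk
  have h3 : (1 : ℝ) ≤ t := by nlinarith [t.2.2]
  exact Subtype.ext (le_antisymm t.2.2 h3)

theorem lintegral_floor (hn : 0 < n) (f : ℕ → ℝ≥0∞) :
    ∫⁻ t : I, f ⌊(n * t : ℝ)⌋₊ = (n : ℝ≥0∞)⁻¹ * ∑ i ∈ Finset.range n, f i := by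
  have hm := measurable_floor_mul n
  rw [← lintegral_map (f := f) measurable_from_nat hm, lintegral_countable',
    tsum_eq_sum (s := Finset.range n)]
  · rw [Finset.mul_sum]
    refine Finset.sum_congr rfl fun i hi => ?_
    rw [Measure.map_apply hm (measurableSet_singleton i), mul_comm]
    congr 1
    exact volume_floor_eq hn (Finset.mem_range.1 hi)
  · intro i hi
    rw [Measure.map_apply hm (measurableSet_singleton i)]
    have := volume_floor_eq_zero hn (k := i) (by simpa using hi)
    have h2 : (fun t : I => ⌊(n * t : ℝ)⌋₊) ⁻¹' {i} = {t : I | ⌊(n * t : ℝ)⌋₊ = i} := rfl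
    rw [h2, this, mul_zero]

variable {F : Type*} [NormedAddCommGroup F]

theorem stronglyMeasurable_floor (z : ℕ → F) :
    StronglyMeasurable fun t : I => z ⌊(n * t : ℝ)⌋₊ :=
  (StronglyMeasurable.of_discrete (f := z)).comp_measurable (measurable_floor_mul n)

theorem norm_floor_le (z : ℕ → F) (t : I) :
    ‖z ⌊(n * t : ℝ)⌋₊‖ ≤ ∑ i ∈ Finset.range (n + 1), ‖z i‖ :=
  Finset.single_le_sum (f := fun i => ‖z i‖) (fun _ _ => norm_nonneg _)
    (Finset.mem_range.2 (Nat.lt_succ_of_le (floor_le_of_unitInterval n t)))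

theorem integrable_floor (z : ℕ → F) : Integrable fun t : I => z ⌊(n * t : ℝ)⌋₊ :=
  Integrable.of_bound (stronglyMeasurable_floor z).aestronglyMeasurable _
    (ae_of_all _ (norm_floor_le z))

variable [NormedSpace ℝ F]

theorem setIntegral_floor [CompleteSpace F] (hn : 0 < n) (z : ℕ → F) (τ : I) {k : ℕ}
    (hk : ⌊(n * τ : ℝ)⌋₊ = k) :
    ∫ s in Iic τ, z ⌊(n * s : ℝ)⌋₊ =
      ∑ i ∈ Finset.range k, (1 / n : ℝ) • z i + ((τ : ℝ) - k / n) • z k := by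
  have hn' : (0 : ℝ) < n := by exact_mod_cast hn
  have hkn : k ≤ n := hk ▸ floor_le_of_unitInterval n τ
  have hkτ : (k : ℝ) ≤ n * τ := hk ▸ Nat.floor_le (mul_nonneg hn'.le τ.2.1)
  have hcell : ∀ i, MeasurableSet {t : I | ⌊(n * t : ℝ)⌋₊ = i} := fun i =>
    measurable_floor_mul n (measurableSet_singleton i)
  have hdec : ∀ s : I, s ∈ Iic τ → z ⌊(n * s : ℝ)⌋₊ =
      ∑ i ∈ Finset.range (k + 1), {t : I | ⌊(n * t : ℝ)⌋₊ = i}.indicator (fun _ => z i) s := by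
    intro s hs
    have hsk : ⌊(n * s : ℝ)⌋₊ ≤ k := hk ▸ Nat.floor_mono (by
      have : (s : ℝ) ≤ τ := hs
      gcongr)
    rw [Finset.sum_eq_single ⌊(n * s : ℝ)⌋₊]
    · rw [indicator_of_mem (by rfl)]
    · intro i _ hi
      rw [indicator_of_notMem]
      exact fun h => hi (Eq.symm h)
    · intro h; exact absurd (Finset.mem_range.2 (Nat.lt_succ_of_le hsk)) h
  rw [setIntegral_congr_fun measurableSet_Iic hdec, integral_finsetSum _ fun i _ =>
    ((integrable_const (z i)).indicator (hcell i))]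
  simp only [integral_indicator (hcell _), setIntegral_const]
  rw [Finset.sum_range_succ]
  congr 1
  · refine Finset.sum_congr rfl fun i hi => ?_
    have hik := Finset.mem_range.1 hi
    congr 1
    rw [Measure.real, Measure.restrict_apply (hcell i), inter_eq_left.2]
    · rw [volume_floor_eq hn (hik.trans_le hkn)]; simp
    · intro t ht
      have ht : ⌊(n * t : ℝ)⌋₊ = i := ht
      have h1 := Nat.lt_floor_add_one (n * t : ℝ)
      rw [ht] at h1
      have h2 : (i : ℝ) + 1 ≤ k := by exact_mod_cast hik
      have h3 : (t : ℝ) ≤ τ := by nlinarith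
      exact h3
  · congr 1
    rw [Measure.real, Measure.restrict_apply (hcell k)]
    have : {t : I | ⌊(n * t : ℝ)⌋₊ = k} ∩ Iic τ = Icc (gridPoint hn hkn) τ := by
      ext t
      simp only [mem_inter_iff, mem_ofPred_eq, mem_Iic, mem_Icc]
      refine and_congr_left fun hle => ?_
      rw [← Subtype.coe_le_coe]
      simp only [gridPoint, div_le_iff₀ hn']
      constructor
      · intro h
        have := Nat.floor_le (mul_nonneg hn'.le t.2.1)
        rw [h] at this; linarith
      · intro h
        refine le_antisymm ?_ (Nat.le_floor (by linarith))
        rw [← hk]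
        have : (t : ℝ) ≤ τ := hle
        exact Nat.floor_mono (by gcongr)
    rw [this, volume_Icc, ENNReal.toReal_ofReal]
    · rfl
    · simp only [gridPoint, sub_nonneg, div_le_iff₀ hn']; linarith

theorem setIntegral_floor_gridPoint [CompleteSpace F] (hn : 0 < n) (z : ℕ → F) {k : ℕ}
    (hk : k ≤ n) :
    ∫ s in Iic (gridPoint hn hk), z ⌊(n * s : ℝ)⌋₊ = ∑ i ∈ Finset.range k, (1 / n : ℝ) • z i := by
  rw [setIntegral_floor hn z _ (floor_gridPoint hn hk)]
  simp [gridPoint]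

theorem integral_floor [CompleteSpace F] (hn : 0 < n) (z : ℕ → F) :
    ∫ s : I, z ⌊(n * s : ℝ)⌋₊ = ∑ i ∈ Finset.range n, (1 / n : ℝ) • z i := by
  have h := setIntegral_floor_gridPoint hn z le_rfl
  have : Iic (gridPoint hn (le_refl n)) = (univ : Set I) := by
    refine eq_univ_of_forall fun t => ?_
    have h1 : (t : ℝ) ≤ n / n := by
      rw [div_self (by exact_mod_cast hn.ne')]; exact t.2.2
    exact h1
  rwa [this, Measure.restrict_univ] at h

/-- Integrals of step functions are piecewise linear interpolations of the partial sums. -/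
theorem setIntegral_floor_eq_interpFun {d : ℕ} (hn : 0 < n) (z : ℕ → E d) (τ : I) :
    ∫ s in Iic τ, z ⌊(n * s : ℝ)⌋₊ =
      interpFun n (fun k => ∑ i ∈ Finset.range k, (1 / n : ℝ) • z i) τ := by
  rw [setIntegral_floor hn z τ rfl, interpFun, Finset.sum_range_succ, smul_add, ← add_assoc,
    ← add_smul, smul_smul]
  have hn' : (n : ℝ) ≠ 0 := by exact_mod_cast hn.ne'
  congr 1
  · rw [show ((⌊(n * τ : ℝ)⌋₊ : ℝ) + 1 - n * τ) + (n * τ - ⌊(n * τ : ℝ)⌋₊) = 1 by ring, one_smul]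
  · congr 1; field_simp

theorem norm_interpFun_le {d : ℕ} {z : ℕ → E d} {C : ℝ} (h : ∀ k ≤ n, ‖z k‖ ≤ C) (t : I) :
    ‖interpFun n z t‖ ≤ C := by
  have h0 : (0 : ℝ) ≤ n * t := mul_nonneg (Nat.cast_nonneg n) t.2.1
  have h1 := Nat.floor_le h0
  have h2 := (Nat.lt_floor_add_one (n * t : ℝ)).le
  have hk := floor_le_of_unitInterval n t
  rw [interpFun]
  set k := ⌊(n * t : ℝ)⌋₊
  refine (norm_add_le _ _).trans ?_
  rw [norm_smul, norm_smul, Real.norm_of_nonneg (by linarith), Real.norm_of_nonneg (by linarith)]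
  rcases hk.lt_or_eq with hlt | heq
  · nlinarith [h k hk, h (k + 1) hlt]
  · have h3 : (n * t : ℝ) ≤ n := mul_le_of_le_one_right (Nat.cast_nonneg n) t.2.2
    have h4 : (n * t : ℝ) = k := le_antisymm (heq ▸ h3) h1
    rw [h4]; simpa using h k hk

theorem interpFun_add {d : ℕ} (z z' : ℕ → E d) (t : I) :
    interpFun n (fun k => z k + z' k) t = interpFun n z t + interpFun n z' t := by
  simp only [interpFun, smul_add]; abel

theorem norm_floor_sub_interpFun_le {d : ℕ} (z : ℕ → E d) (t : I) :
    ‖z ⌊(n * t : ℝ)⌋₊ - interpFun n z t‖ ≤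
      ‖z (⌊(n * t : ℝ)⌋₊ + 1) - z ⌊(n * t : ℝ)⌋₊‖ := by
  have h0 : (0 : ℝ) ≤ n * t := mul_nonneg (Nat.cast_nonneg n) t.2.1
  have h1 := Nat.floor_le h0
  have h2 := (Nat.lt_floor_add_one (n * t : ℝ)).le
  rw [interpFun]
  set k := ⌊(n * t : ℝ)⌋₊
  have : z k - (((k : ℝ) + 1 - n * t) • z k + ((n * t : ℝ) - k) • z (k + 1)) =
      -(((n * t : ℝ) - k) • (z (k + 1) - z k)) := by
    module
  rw [this, norm_neg, norm_smul, Real.norm_of_nonneg (by linarith)]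
  exact mul_le_of_le_one_left (norm_nonneg _) (by linarith)

/-- Discrete Grönwall inequality. -/
theorem le_mul_exp_of_le_add_sum {u : ℕ → ℝ} {C K : ℝ} (hn : 0 < n) (hK : 0 ≤ K) (hC : 0 ≤ C)
    (h : ∀ k ≤ n, u k ≤ C + K / n * ∑ i ∈ Finset.range k, u i) :
    ∀ k ≤ n, u k ≤ C * Real.exp K := by
  have hn' : (0 : ℝ) < n := by exact_mod_cast hn
  have h1 : ∀ k ≤ n, u k ≤ C * (1 + K / n) ^ k := by
    intro k
    induction k using Nat.strong_induction_on with
    | _ k ih =>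
      intro hk
      have hgeom : ∀ k : ℕ, C + K / n * ∑ i ∈ Finset.range k, C * (1 + K / n) ^ i =
          C * (1 + K / n) ^ k := by
        intro k
        induction k with
        | zero => simp
        | succ k ih => rw [Finset.sum_range_succ, mul_add, ← add_assoc, ih]; ring
      rw [← hgeom k]
      refine (h k hk).trans ?_
      gcongr with i hi
      exact ih i (Finset.mem_range.1 hi) ((Finset.mem_range.1 hi).le.trans hk)
  intro k hk
  refine (h1 k hk).trans (mul_le_mul_of_nonneg_left ?_ hC)
  calc (1 + K / n) ^ k ≤ Real.exp (K / n) ^ k := by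
        gcongr
        linarith [Real.add_one_le_exp (K / n)]
    _ = Real.exp (k * (K / n)) := by rw [← Real.exp_nat_mul]
    _ ≤ Real.exp K := by
        refine Real.exp_le_exp.2 ?_
        have : (k : ℝ) ≤ n := by exact_mod_cast hk
        calc (k : ℝ) * (K / n) ≤ n * (K / n) := by gcongr
          _ = K := by field_simp

end Steps

/-! ### Euler approximation of the noiseless dynamics -/

section Euler

variable {d n : ℕ} {b : E d → E d} {x₀ : E d} {X0 : C(I, E d)} {K : ℝ}

theorem noiselessX_eq_sum (n : ℕ) (k : ℕ) :
    noiselessX b x₀ n k = x₀ + ∑ i ∈ Finset.range k, (1 / n : ℝ) • b (noiselessX b x₀ n i) := by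
  induction k with
  | zero => simp [noiselessX]
  | succ k ih => rw [noiselessX, Finset.sum_range_succ, ← add_assoc, ← ih]

theorem setIntegral_Iic_sub_Iic {F : Type*} [NormedAddCommGroup F] [NormedSpace ℝ F]
    {f : I → F} (hf : Integrable f) {s t : I} (hst : s ≤ t) :
    (∫ r in Iic t, f r) - ∫ r in Iic s, f r = ∫ r in Ioc s t, f r := by
  rw [← Iic_union_Ioc_eq_Iic hst, setIntegral_union (Iic_disjoint_Ioc le_rfl) measurableSet_Ioc
    hf.integrableOn hf.integrableOn, add_sub_cancel_left]

theorem norm_setIntegral_Iic_sub_le {F : Type*} [NormedAddCommGroup F] [NormedSpace ℝ F]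
    {f : I → F} (hf : Integrable f) {C : ℝ} (hC : ∀ r, ‖f r‖ ≤ C) (s t : I) :
    ‖(∫ r in Iic t, f r) - ∫ r in Iic s, f r‖ ≤ C * |(t : ℝ) - s| := by
  wlog hst : s ≤ t generalizing s t
  · rw [norm_sub_rev, abs_sub_comm]
    exact this t s (le_of_not_ge hst)
  rw [setIntegral_Iic_sub_Iic hf hst]
  refine (norm_setIntegral_le_of_norm_le_const (by simp) fun r _ => hC r).trans ?_
  have : (s : ℝ) ≤ t := hst
  rw [Measure.real, volume_Ioc, ENNReal.toReal_ofReal (by linarith), abs_of_nonneg (by linarith)]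

theorem ContinuousMap.integrable_unitInterval {F : Type*} [NormedAddCommGroup F]
    (f : C(I, F)) : Integrable (fun t => f t) :=
  f.continuous.integrableOn_Icc (a := 0) (b := 1) (μ := volume) |>.mono_set
    (fun t _ => ⟨t.2.1, t.2.2⟩) |> integrableOn_univ.1

theorem norm_noiselessX_sub_le (hn : 0 < n) (hX0 : IsNoiselessLimit b x₀ X0) (hK : 0 ≤ K)
    (hbc : Continuous b) (hb : ∀ x, ‖b x‖ ≤ K) (hlip : ∀ x y, ‖b x - b y‖ ≤ K * ‖x - y‖) (t : I) :
    ‖noiselessX b x₀ n ⌊(n * t : ℝ)⌋₊ - X0 t‖ ≤ (K ^ 2 * Real.exp K + K) / n := by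
  have hn' : (0 : ℝ) < n := by exact_mod_cast hn
  have hiX : Integrable (fun s => b (X0 s)) :=
    ContinuousMap.integrable_unitInterval ⟨fun s => b (X0 s), by fun_prop⟩
  have hXlip : ∀ s t : I, ‖X0 t - X0 s‖ ≤ K * |(t : ℝ) - s| := fun s t => by
    rw [hX0 t, hX0 s, add_sub_add_left_eq_sub]
    exact norm_setIntegral_Iic_sub_le hiX (fun r => hb _) s t
  have hgrid : ∀ (s : I) (k : ℕ) (hk : ⌊(n * s : ℝ)⌋₊ = k) (hkn : k ≤ n),
      ‖X0 s - X0 (gridPoint hn hkn)‖ ≤ K / n := fun s k hk hkn => by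
    refine (hXlip _ _).trans ?_
    have h1 := Nat.floor_le (mul_nonneg hn'.le s.2.1)
    have h2 := (Nat.lt_floor_add_one (n * s : ℝ)).le
    rw [hk] at h1 h2
    simp only [gridPoint]
    rw [div_eq_mul_one_div K]
    refine mul_le_mul_of_nonneg_left ?_ hK
    rw [abs_of_nonneg (by rw [sub_nonneg, div_le_iff₀ hn']; linarith), sub_le_iff_le_add,
      ← add_div, le_div_iff₀ hn']
    linarith
  set u : ℕ → ℝ := fun k => if hk : k ≤ n then ‖noiselessX b x₀ n k - X0 (gridPoint hn hk)‖ else 0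
    with hu
  have huk : ∀ k (hk : k ≤ n), u k = ‖noiselessX b x₀ n k - X0 (gridPoint hn hk)‖ :=
    fun k hk => by simp [hu, hk]
  have hrec : ∀ k ≤ n, u k ≤ K ^ 2 / n + K / n * ∑ i ∈ Finset.range k, u i := by
    intro k hk
    rw [huk k hk, hX0, noiselessX_eq_sum, add_sub_add_left_eq_sub,
      ← setIntegral_floor_gridPoint hn (fun i => b (noiselessX b x₀ n i)) hk,
      ← integral_sub (integrable_floor fun i => b (noiselessX b x₀ n i)).integrableOn
        hiX.integrableOn]
    have hiu : Integrable fun s : I => K * u ⌊(n * s : ℝ)⌋₊ := (integrable_floor u).const_mul K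
    calc ‖∫ s in Iic (gridPoint hn hk), (b (noiselessX b x₀ n ⌊(n * s : ℝ)⌋₊) - b (X0 s))‖
        ≤ ∫ s in Iic (gridPoint hn hk), (K * u ⌊(n * s : ℝ)⌋₊ + K ^ 2 / n) := by
          refine norm_integral_le_of_norm_le (hiu.add (integrable_const _)).integrableOn
            (ae_of_all _ fun s => ?_)
          have hsn := floor_le_of_unitInterval n s
          have h1 := hlip (noiselessX b x₀ n ⌊(n * s : ℝ)⌋₊) (X0 s)
          have h2 := hgrid s _ rfl hsn
          have h3 := norm_sub_le_norm_sub_add_norm_sub (noiselessX b x₀ n ⌊(n * s : ℝ)⌋₊)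
            (X0 (gridPoint hn hsn)) (X0 s)
          rw [norm_sub_rev (X0 (gridPoint hn hsn)), ← huk _ hsn] at h3
          calc _ ≤ K * (u ⌊(n * s : ℝ)⌋₊ + K / n) := h1.trans (by gcongr; linarith)
            _ = _ := by ring
      _ ≤ _ := by
          rw [integral_add hiu.integrableOn (integrable_const _), integral_const_mul,
            setIntegral_floor_gridPoint hn u hk, setIntegral_const]
          have hvol : (volume : Measure I).real (Iic (gridPoint hn hk)) ≤ 1 := measureReal_le_one
          have h0 : 0 ≤ K ^ 2 / n := by positivity
          rw [smul_eq_mul, ← Finset.smul_sum, smul_eq_mul]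
          have : K * (1 / n * ∑ i ∈ Finset.range k, u i) =
            K / n * ∑ i ∈ Finset.range k, u i := by ring
          rw [this, add_comm]
          exact add_le_add_left (mul_le_of_le_one_left h0 hvol) _
  have htn := floor_le_of_unitInterval n t
  have h1 := le_mul_exp_of_le_add_sum hn hK (by positivity) hrec _ htn
  rw [huk _ htn] at h1
  have h2 := hgrid t _ rfl htn
  have h3 := norm_sub_le_norm_sub_add_norm_sub (noiselessX b x₀ n ⌊(n * t : ℝ)⌋₊)
            (X0 (gridPoint hn htn)) (X0 t)
  rw [norm_sub_rev (X0 (gridPoint hn htn))] at h3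
  refine (h3.trans (add_le_add h1 h2)).trans (le_of_eq ?_)
  ring

end Euler

/-! ### Discrete paths driven by a drift, a control and a perturbation -/

section DiscretePath

variable {d n : ℕ} {Y B w M : ℕ → E d} {K m W S : ℝ}

/-- `Y_k = ∑_{i<k} (B_i + w_i) / n + M_k`, where the drift satisfies `‖B_i‖ ≤ K ‖Y_i‖`, the
perturbation `‖M_k‖ ≤ m`, and the control `∑_{i<n} ‖w_i‖ / n ≤ W`. -/
structure IsDiscretePath (n : ℕ) (Y B w M : ℕ → E d) (K m W : ℝ) : Prop where
  pos : 0 < n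
  lip_nonneg : 0 ≤ K
  eq_sum : ∀ k, Y k = ∑ i ∈ Finset.range k, (1 / n : ℝ) • (B i + w i) + M k
  drift_le : ∀ k, ‖B k‖ ≤ K * ‖Y k‖
  pert_le : ∀ k, ‖M k‖ ≤ m
  control_le : ∑ i ∈ Finset.range n, (1 / n : ℝ) * ‖w i‖ ≤ W

namespace IsDiscretePath

theorem pert_nonneg (h : IsDiscretePath n Y B w M K m W) : 0 ≤ m :=
  (norm_nonneg _).trans (h.pert_le 0)

theorem control_nonneg (h : IsDiscretePath n Y B w M K m W) : 0 ≤ W :=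
  (Finset.sum_nonneg fun i _ => by positivity).trans h.control_le

theorem norm_le (h : IsDiscretePath n Y B w M K m W) :
    ∀ k ≤ n, ‖Y k‖ ≤ (W + m) * Real.exp K := by
  refine le_mul_exp_of_le_add_sum h.pos h.lip_nonneg (add_nonneg h.control_nonneg h.pert_nonneg)
    fun k hk => ?_
  rw [h.eq_sum k]
  refine (norm_add_le _ _).trans ?_
  have h1 : ‖∑ i ∈ Finset.range k, (1 / n : ℝ) • (B i + w i)‖ ≤
      ∑ i ∈ Finset.range k, (1 / n : ℝ) * (K * ‖Y i‖) +
        ∑ i ∈ Finset.range k, (1 / n : ℝ) * ‖w i‖ := by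
    rw [← Finset.sum_add_distrib]
    refine norm_sum_le_of_le _ fun i _ => ?_
    rw [norm_smul, Real.norm_of_nonneg (by positivity), ← mul_add]
    gcongr
    exact (norm_add_le _ _).trans (add_le_add_left (h.drift_le i) _)
  have h2 : ∑ i ∈ Finset.range k, (1 / n : ℝ) * ‖w i‖ ≤ W :=
    (Finset.sum_le_sum_of_subset_of_nonneg (Finset.range_mono hk)
      fun _ _ _ => by positivity).trans h.control_le
  have h3 : ∑ i ∈ Finset.range k, (1 / n : ℝ) * (K * ‖Y i‖) =
      K / n * ∑ i ∈ Finset.range k, ‖Y i‖ := by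
    rw [Finset.mul_sum]; exact Finset.sum_congr rfl fun i _ => by ring
  linarith [h.pert_le k]

theorem norm_drift_floor_le (h : IsDiscretePath n Y B w M K m W) (s : I) :
    ‖B ⌊(n * s : ℝ)⌋₊‖ ≤ K * ((W + m) * Real.exp K) :=
  (h.drift_le _).trans
    (mul_le_mul_of_nonneg_left (h.norm_le _ (floor_le_of_unitInterval n s)) h.lip_nonneg)

theorem interpFun_eq (h : IsDiscretePath n Y B w M K m W) (t : I) :
    interpFun n Y t = (∫ s in Iic t, (B ⌊(n * s : ℝ)⌋₊ + w ⌊(n * s : ℝ)⌋₊)) + interpFun n M t := by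
  rw [setIntegral_floor_eq_interpFun h.pos (fun k => B k + w k), ← interpFun_add]
  congr 1
  exact funext h.eq_sum

/-- Replacing the control `w` by `w'` changes the path by the `L¹` distance of the controls. -/
theorem norm_interpFun_sub_le (h : IsDiscretePath n Y B w M K m W) (w' : ℕ → E d) (t : I) :
    ‖interpFun n Y t - ∫ s in Iic t, (B ⌊(n * s : ℝ)⌋₊ + w' ⌊(n * s : ℝ)⌋₊)‖ ≤
      m + ∑ i ∈ Finset.range n, (1 / n : ℝ) * ‖w i - w' i‖ := by
  have hi : ∀ z : ℕ → E d, IntegrableOn (fun s : I => B ⌊(n * s : ℝ)⌋₊ + z ⌊(n * s : ℝ)⌋₊)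
      (Iic t) := fun z => (integrable_floor fun k => B k + z k).integrableOn
  rw [h.interpFun_eq t, add_sub_right_comm, ← integral_sub (hi w) (hi w')]
  simp only [add_sub_add_left_eq_sub]
  refine (norm_add_le _ _).trans ?_
  rw [add_comm]
  refine add_le_add (_root_.norm_interpFun_le (fun k _ => h.pert_le k) t) ?_
  have hi2 : Integrable fun s : I => ‖w ⌊(n * s : ℝ)⌋₊ - w' ⌊(n * s : ℝ)⌋₊‖ :=
    (integrable_floor fun k => w k - w' k).norm
  calc _ ≤ ∫ s in Iic t, ‖w ⌊(n * s : ℝ)⌋₊ - w' ⌊(n * s : ℝ)⌋₊‖ := norm_integral_le_integral_norm _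
    _ ≤ ∫ s : I, ‖w ⌊(n * s : ℝ)⌋₊ - w' ⌊(n * s : ℝ)⌋₊‖ :=
      setIntegral_le_integral hi2 (ae_of_all _ fun _ => norm_nonneg _)
    _ = _ := integral_floor h.pos (fun k => ‖w k - w' k‖)

/-- If the drift is close to the linear drift `A s Y`, the path almost solves the corresponding
linear equation. -/
theorem norm_limit_equation_le (h : IsDiscretePath n Y B w M K m W) {A : I → E d →L[ℝ] E d}
    (hA : Continuous A) (hAK : ∀ s, ‖A s‖ ≤ K) {δ : ℝ}
    (hδ : ∀ s : I, ‖B ⌊(n * s : ℝ)⌋₊ - A s (Y ⌊(n * s : ℝ)⌋₊)‖ ≤ δ) (t : I) :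
    ‖interpFun n Y t - (∫ s in Iic t, A s (interpFun n Y s)) -
        ∫ s in Iic t, w ⌊(n * s : ℝ)⌋₊‖ ≤
      m + δ + K * ((K * ((W + m) * Real.exp K) + W) / n + 2 * m) := by
  have hn' : (0 : ℝ) < n := by exact_mod_cast h.pos
  have hK := h.lip_nonneg
  have hm := h.pert_nonneg
  have hδ0 : 0 ≤ δ := (norm_nonneg _).trans (hδ 0)
  have hiw := integrable_floor (n := n) w
  have hiB := integrable_floor (n := n) B
  have hiA : Integrable fun s : I => A s (interpFun n Y s) :=
    ContinuousMap.integrable_unitInterval ⟨fun s : I => A s (interpFun n Y s),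
      hA.clm_apply (continuous_interpFun n Y)⟩
  set S := (W + m) * Real.exp K with hS
  have hstep : ∀ s : I, ‖B ⌊(n * s : ℝ)⌋₊ - A s (interpFun n Y s)‖ ≤
      K * (1 / n) * ‖w ⌊(n * s : ℝ)⌋₊‖ + (δ + K * (K * S / n + 2 * m)) := fun s => by
    set k := ⌊(n * s : ℝ)⌋₊ with hk
    have h1 := norm_floor_sub_interpFun_le (n := n) Y s
    rw [← hk] at h1
    have h2 : Y (k + 1) - Y k = (1 / n : ℝ) • (B k + w k) + (M (k + 1) - M k) := by
      rw [h.eq_sum (k + 1), h.eq_sum k, Finset.sum_range_succ]; abel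
    have h3 : ‖Y (k + 1) - Y k‖ ≤ 1 / n * (K * S + ‖w k‖) + (m + m) := by
      rw [h2]
      refine (norm_add_le _ _).trans (add_le_add ?_ ((norm_sub_le _ _).trans
        (add_le_add (h.pert_le _) (h.pert_le _))))
      rw [norm_smul, Real.norm_of_nonneg (by positivity)]
      gcongr
      exact (norm_add_le _ _).trans (add_le_add_left (h.norm_drift_floor_le s) _)
    have h4 : ‖A s (Y k) - A s (interpFun n Y s)‖ ≤
        K * (1 / n * (K * S + ‖w k‖) + (m + m)) := by
      rw [← map_sub]
      refine ((A s).le_opNorm _).trans ?_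
      exact mul_le_mul (hAK s) (h1.trans h3) (norm_nonneg _) hK
    have h5 := norm_sub_le_norm_sub_add_norm_sub (B k) (A s (Y k)) (A s (interpFun n Y s))
    have h6 := hδ s
    calc _ ≤ δ + K * (1 / n * (K * S + ‖w k‖) + (m + m)) := by linarith
      _ = _ := by ring
  have hi2 : Integrable fun s : I => K * (1 / n) * ‖w ⌊(n * s : ℝ)⌋₊‖ :=
    hiw.norm.const_mul _
  have hint : ‖∫ s in Iic t, (B ⌊(n * s : ℝ)⌋₊ - A s (interpFun n Y s))‖ ≤
      K * (1 / n) * W + (δ + K * (K * S / n + 2 * m)) := by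
    have hS0 : 0 ≤ S := mul_nonneg (add_nonneg h.control_nonneg hm) (Real.exp_nonneg _)
    have hi3 : Integrable fun s : I => K * (1 / n) * ‖w ⌊(n * s : ℝ)⌋₊‖ +
      (δ + K * (K * S / n + 2 * m)) := hi2.add (integrable_const _)
    calc _ ≤ ∫ s in Iic t, (K * (1 / n) * ‖w ⌊(n * s : ℝ)⌋₊‖ + (δ + K * (K * S / n + 2 * m))) :=
          norm_integral_le_of_norm_le hi3.integrableOn (ae_of_all _ hstep)
      _ ≤ ∫ s : I, (K * (1 / n) * ‖w ⌊(n * s : ℝ)⌋₊‖ + (δ + K * (K * S / n + 2 * m))) :=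
          setIntegral_le_integral hi3 (ae_of_all _ fun s => by positivity)
      _ ≤ _ := by
          rw [integral_add hi2 (integrable_const _), integral_const_mul,
            integral_floor h.pos (fun k => ‖w k‖)]
          simp only [integral_const, probReal_univ, smul_eq_mul, one_mul]
          gcongr
          exact h.control_le
  have hsplit : interpFun n Y t - (∫ s in Iic t, A s (interpFun n Y s)) -
        ∫ s in Iic t, w ⌊(n * s : ℝ)⌋₊ =
      (∫ s in Iic t, (B ⌊(n * s : ℝ)⌋₊ - A s (interpFun n Y s))) + interpFun n M t := by
    rw [h.interpFun_eq t, integral_add hiB.integrableOn hiw.integrableOn,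
      integral_sub hiB.integrableOn hiA.integrableOn]
    abel
  rw [hsplit]
  refine (norm_add_le _ _).trans
    ((add_le_add hint (_root_.norm_interpFun_le (fun k _ => h.pert_le k) t)).trans (le_of_eq ?_))
  ring

end IsDiscretePath

end DiscretePath

/-! ### The controlled processes as discrete paths -/

section Controlled

variable {d : ℕ} {a : ℕ → ℝ} {b : E d → E d} {x₀ : E d} {n : ℕ}

theorem div_sqrt_eq (x : ℝ) : x / √n = x * √n * (1 / n) := by
  have : (√n : ℝ) * √n = n := Real.mul_self_sqrt (Nat.cast_nonneg n)
  rcases eq_or_ne (√n : ℝ) 0 with h | h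
  · simp [h]
  · have hn : (n : ℝ) ≠ 0 := by rw [← this]; exact mul_ne_zero h h
    field_simp
    rw [sq, this]

theorem controlledX_eq (ha : a n * √n ≠ 0) (v : Fin n → E d) (k : ℕ) :
    controlledX b x₀ v k = noiselessX b x₀ n k + (a n * √n)⁻¹ • controlledY a b x₀ v k := by
  have hc : (a n * √n)⁻¹ * (a n / √n) = 1 / n := by
    rw [div_sqrt_eq, ← mul_assoc, inv_mul_cancel₀ ha, one_mul]
  induction k with
  | zero => simp [controlledX, noiselessX, controlledY]
  | succ k ih =>
    rw [controlledX, noiselessX, controlledY, smul_add, smul_add, smul_smul, smul_smul, hc,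
      smul_sub]
    nth_rewrite 1 [ih]
    abel

/-- The amplified drift increment. -/
noncomputable def ampDrift (a : ℕ → ℝ) (b : E d → E d) (x₀ : E d) (v : Fin n → E d) (k : ℕ) :
    E d :=
  (a n * √n) • (b (controlledX b x₀ v k) - b (noiselessX b x₀ n k))

variable (η : Measure (Fin n → E d)) [IsProbabilityMeasure η]

/-- The amplified conditional mean of the `k`-th noise. -/
noncomputable def ampControl (a : ℕ → ℝ) (v : Fin n → E d) (k : ℕ) : E d :=
  (a n * √n) • predMean η id k v

theorem ampMean_eq (v : Fin n → E d) (t : I) :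
    ampMean a η v t = ampControl η a v ⌊(n * t : ℝ)⌋₊ := rfl

/-- The amplified centred sums. -/
noncomputable def ampNoise (a : ℕ → ℝ) (v : Fin n → E d) (k : ℕ) : E d :=
  (a n / √n) • centredSum η k v

theorem centredSum_of_ge (v : Fin n → E d) {k : ℕ} (hk : n ≤ k) :
    centredSum η k v = centredSum η n v := by
  rw [centredSum, centredSum, ← Finset.sum_subset (Finset.range_mono hk)]
  intro i _ hi
  simp only [Finset.mem_range] at hi
  simp [noise, predMean, hi]

theorem controlledY_eq (v : Fin n → E d) (k : ℕ) :
    controlledY a b x₀ v k =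
      ∑ i ∈ Finset.range k, (1 / n : ℝ) • (ampDrift a b x₀ v i + ampControl η a v i) +
        ampNoise η a v k := by
  induction k with
  | zero => simp [controlledY, ampNoise, centredSum]
  | succ k ih =>
    have hN : ampNoise η a v (k + 1) =
        ampNoise η a v k + (a n / √n) • (noise v k - predMean η id k v) := by
      rw [ampNoise, centredSum, Finset.sum_range_succ, smul_add]; rfl
    rw [controlledY, Finset.sum_range_succ, hN, ih, ampDrift, ampControl]
    simp only [div_sqrt_eq]
    module

theorem isDiscretePath_controlledY (hn : 0 < n) (ha : 0 < a n * √n) {K : ℝ} (hK : 0 ≤ K)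
    (hlip : ∀ x y, ‖b x - b y‖ ≤ K * ‖x - y‖) {v : Fin n → E d} {m W : ℝ}
    (hm : ∀ k ≤ n, ‖ampNoise η a v k‖ ≤ m)
    (hW : ∑ i ∈ Finset.range n, (1 / n : ℝ) * ‖ampControl η a v i‖ ≤ W) :
    IsDiscretePath n (controlledY a b x₀ v) (ampDrift a b x₀ v) (ampControl η a v)
      (ampNoise η a v) K m W where
  pos := hn
  lip_nonneg := hK
  eq_sum := controlledY_eq η v
  drift_le k := by
    rw [ampDrift, norm_smul, Real.norm_of_nonneg ha.le]
    have h := hlip (controlledX b x₀ v k) (noiselessX b x₀ n k)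
    rw [controlledX_eq ha.ne', add_sub_cancel_left, norm_smul, norm_inv,
      Real.norm_of_nonneg ha.le] at h
    calc _ ≤ a n * √n * (K * ((a n * √n)⁻¹ * ‖controlledY a b x₀ v k‖)) := by
          rw [controlledX_eq ha.ne']; gcongr
      _ = _ := by
          rw [mul_left_comm K, ← mul_assoc, mul_inv_cancel₀ ha.ne', one_mul]
  pert_le k := by
    rcases le_total k n with h | h
    · exact hm k h
    · rw [ampNoise, centredSum_of_ge η v h]; exact hm n le_rfl
  control_le := hW

/-- Linearization of the amplified drift along the noiseless limit. -/
theorem norm_ampDrift_sub_le (ha : 0 < a n * √n) (hb : Differentiable ℝ b)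
    {v : Fin n → E d} {k : ℕ} {x : E d} {ρ ε : ℝ} (hρ : ∀ y, ‖y - x‖ < ρ →
      ‖fderiv ℝ b y - fderiv ℝ b x‖ ≤ ε)
    (hclose : ‖noiselessX b x₀ n k - x‖ + (a n * √n)⁻¹ * ‖controlledY a b x₀ v k‖ < ρ) :
    ‖ampDrift a b x₀ v k - fderiv ℝ b x (controlledY a b x₀ v k)‖ ≤
      ε * ‖controlledY a b x₀ v k‖ := by
  set s := a n * √n
  set X := noiselessX b x₀ n k
  set Y := controlledY a b x₀ v k
  have hs : 0 < s⁻¹ := inv_pos.2 ha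
  have hX : X ∈ Metric.ball x ρ := by
    rw [mem_ball_iff_norm]
    have := norm_nonneg Y
    have := mul_nonneg hs.le this
    linarith
  have hX' : X + s⁻¹ • Y ∈ Metric.ball x ρ := by
    rw [mem_ball_iff_norm, add_sub_right_comm]
    refine (norm_add_le _ _).trans_lt ?_
    rwa [norm_smul, Real.norm_of_nonneg hs.le]
  have h := (convex_ball x ρ).norm_image_sub_le_of_norm_fderiv_le' (𝕜 := ℝ) (f := b)
    (φ := fderiv ℝ b x) (C := ε) (fun y _ => hb y)
    (fun y hy => hρ y (by rwa [mem_ball_iff_norm] at hy)) hX hX'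
  rw [add_sub_cancel_left, map_smul] at h
  have e : ampDrift a b x₀ v k - fderiv ℝ b x Y =
      s • (b (X + s⁻¹ • Y) - b X - s⁻¹ • fderiv ℝ b x Y) := by
    rw [smul_sub, smul_smul, mul_inv_cancel₀ ha.ne', one_smul, ampDrift, controlledX_eq ha.ne']
  rw [e, norm_smul, Real.norm_of_nonneg ha.le]
  calc _ ≤ s * (ε * ‖s⁻¹ • Y‖) := by gcongr
    _ = _ := by
      rw [norm_smul, Real.norm_of_nonneg hs.le]; field_simp

/-! ### Continuity and measurability of the random elements -/

theorem continuous_noise (k : ℕ) : Continuous fun v : Fin n → E d => noise v k := by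
  unfold noise
  split_ifs <;> fun_prop

theorem continuous_controlledX (hb : Continuous b) (k : ℕ) :
    Continuous fun v : Fin n → E d => controlledX b x₀ v k := by
  induction k with
  | zero => exact continuous_const
  | succ k ih =>
    have := continuous_noise (d := d) (n := n) k
    simp only [controlledX]; fun_prop

theorem continuous_controlledY (hb : Continuous b) (k : ℕ) :
    Continuous fun v : Fin n → E d => controlledY a b x₀ v k := by
  induction k with
  | zero => exact continuous_const
  | succ k ih =>
    have := continuous_noise (d := d) (n := n) k
    have := continuous_controlledX (x₀ := x₀) (n := n) hb k
    simp only [controlledY]; fun_prop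

theorem continuous_controlledPath (hb : Continuous b) :
    Continuous fun v : Fin n → E d => controlledPath a b x₀ v := by
  rw [continuous_iff_continuousAt]
  intro v₀
  rw [ContinuousAt, tendsto_iff_dist_tendsto_zero]
  have hlim : Tendsto (fun v : Fin n → E d => ∑ k ∈ Finset.range (n + 1),
      ‖controlledY a b x₀ v k - controlledY a b x₀ v₀ k‖) (𝓝 v₀) (𝓝 0) := by
    have hc : Continuous fun v : Fin n → E d => ∑ k ∈ Finset.range (n + 1),
        ‖controlledY a b x₀ v k - controlledY a b x₀ v₀ k‖ :=
      continuous_finsetSum _ fun k _ => ((continuous_controlledY hb k).sub continuous_const).norm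
    have := hc.tendsto v₀
    simpa using this
  refine squeeze_zero (fun _ => dist_nonneg) (fun v => ?_) hlim
  rw [ContinuousMap.dist_le (Finset.sum_nonneg fun _ _ => norm_nonneg _)]
  intro t
  have e : interpFun n (controlledY a b x₀ v) t = interpFun n (fun k =>
      (controlledY a b x₀ v k - controlledY a b x₀ v₀ k) + controlledY a b x₀ v₀ k) t := by
    simp
  rw [dist_eq_norm]
  change ‖interpFun n (controlledY a b x₀ v) t - interpFun n (controlledY a b x₀ v₀) t‖ ≤ _
  rw [e, interpFun_add, add_sub_cancel_right]
  exact norm_interpFun_le (fun k hk => Finset.single_le_sum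
    (f := fun k => ‖controlledY a b x₀ v k - controlledY a b x₀ v₀ k‖)
    (fun _ _ => norm_nonneg _) (Finset.mem_range.2 (Nat.lt_succ_of_le hk))) t

/-- The index `⌊n t⌋` of the grid interval that contains `t`. -/
noncomputable def floorIndex (n : ℕ) (t : I) : Fin (n + 1) :=
  ⟨⌊(n * t : ℝ)⌋₊, Nat.lt_succ_of_le (floor_le_of_unitInterval n t)⟩

theorem measurable_floorIndex (n : ℕ) : Measurable (floorIndex n) :=
    measurable_to_countable' fun k => by
      have : floorIndex n ⁻¹' {k} = (fun t : I => ⌊(n * t : ℝ)⌋₊) ⁻¹' {(k : ℕ)} := by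
        ext t; simp [floorIndex, Fin.ext_iff]
      rw [this]
      exact measurable_floor_mul n (measurableSet_singleton _)

theorem measurable_prodMk_floorIndex (w : Fin (n + 1) → E d) :
    Measurable fun t : I => (w (floorIndex n t), t) :=
  ((measurable_from_top (f := w)).comp (measurable_floorIndex n)).prodMk measurable_id

/-- The joint law of `(w_{⌊nt⌋}, t)` under Lebesgue measure. The occupation measures are of this
form, and measurability of the random pairs follows from continuity in the finitely many values
`w`. -/
noncomputable def stepLaw (w : Fin (n + 1) → E d) : ProbabilityMeasure (E d × I) :=
  ⟨(volume : Measure I).map fun t => (w (floorIndex n t), t),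
    Measure.isProbabilityMeasure_map (measurable_prodMk_floorIndex w).aemeasurable⟩

theorem continuous_stepLaw : Continuous (stepLaw (d := d) (n := n)) := by
  rw [ProbabilityMeasure.continuous_iff_forall_continuous_integral]
  intro f
  have hm := measurable_prodMk_floorIndex (d := d) (n := n)
  have he : ∀ w : Fin (n + 1) → E d, ∫ p, f p ∂(stepLaw w : Measure (E d × I)) =
      ∫ t : I, f (w (floorIndex n t), t) :=
    fun w => integral_map (hm w).aemeasurable f.continuous.measurable.aestronglyMeasurable
  simp only [he]
  refine continuous_of_dominated (bound := fun _ => ‖f‖)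
    (fun w => (f.continuous.measurable.comp (hm w)).aestronglyMeasurable)
    (fun w => ae_of_all _ fun t => f.norm_coe_le_norm _) (integrable_const _)
    (ae_of_all _ fun t => ?_)
  fun_prop

theorem measurable_ampControl (k : ℕ) : Measurable fun v => ampControl η a v k := by
  change Measurable ((a n * √n) • predMean η id k)
  exact ((measurable_predMean η measurable_id k).mono
    ((noiseFiltration d n).le _) le_rfl).const_smul _

theorem measurable_ampControl_pi : Measurable fun (v : Fin n → E d) (k : Fin (n + 1)) =>
    ampControl η a v k :=
  measurable_pi_lambda _ fun k => measurable_ampControl η k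

theorem measurable_controlPair (hb : Continuous b) :
    Measurable fun v => controlPair a b x₀ η v := by
  have hc : Continuous (Y := PairSpace d) fun p : (Fin (n + 1) → E d) × (Fin n → E d) =>
      (stepLaw p.1, controlledPath a b x₀ p.2) :=
    (continuous_stepLaw.comp continuous_fst).prodMk
      ((continuous_controlledPath hb).comp continuous_snd)
  exact (Continuous.measurable (γ := PairSpace d) hc).comp
    ((measurable_ampControl_pi η).prodMk measurable_id)

end Controlled

/-! ### Asymptotic estimates under a bounded scaled cost -/

section Asymptotics

variable {d : ℕ}

/-- The moderate deviation setting: a noise kernel and a drift satisfying the standing assumptions,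
a moderate scaling `a(n)`, and controls with bounded scaled costs. -/
structure ModerateRegime (μ : Kernel (E d) (E d)) [IsMarkovKernel μ] (b : E d → E d) (x₀ : E d)
    (X0 : C(I, E d)) (a : ℕ → ℝ) (η : (n : ℕ) → Measure (Fin n → E d))
    [∀ n, IsProbabilityMeasure (η n)] (KE : ℝ≥0) : Prop where
  std : StandingAssumptions μ b
  limit : IsNoiselessLimit b x₀ X0
  scale_zero : Tendsto a atTop (𝓝 0)
  scale_top : Tendsto (fun n : ℕ => a n * √n) atTop atTop
  cost_le : ∀ n : ℕ, 1 ≤ n → scaledCost a μ b x₀ (η n) ≤ KE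

theorem scaledCost_eq {n : ℕ} (hn : 0 < n) (a : ℕ → ℝ) (μ : Kernel (E d) (E d)) (b : E d → E d)
    (x₀ : E d) (η : Measure (Fin n → E d)) [IsProbabilityMeasure η] :
    scaledCost a μ b x₀ η =
      ENNReal.ofReal (a n ^ 2) * totalEntropy η (fun i v => μ (controlledX b x₀ v i)) := by
  have hn' : (0 : ℝ) < n := by exact_mod_cast hn
  have h0 : (n : ℝ≥0∞) ≠ 0 := by exact_mod_cast hn.ne'
  rw [scaledCost, lintegral_const_mul' _ _ (ENNReal.inv_ne_top.2 h0), ← mul_assoc,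
    ENNReal.ofReal_mul (sq_nonneg _), ENNReal.ofReal_natCast, mul_assoc (ENNReal.ofReal _),
    ENNReal.mul_inv_cancel h0 (ENNReal.natCast_ne_top n), mul_one]
  rfl

theorem drift_lipschitz {b : E d → E d} (hb : Differentiable ℝ b) {K : ℝ}
    (hK : ∀ x, ‖fderiv ℝ b x‖ ≤ K) (x y : E d) : ‖b x - b y‖ ≤ K * ‖x - y‖ :=
  convex_univ.norm_image_sub_le_of_norm_fderiv_le (𝕜 := ℝ) (fun z _ => hb z) (fun z _ => hK z)
    (mem_univ y) (mem_univ x)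

namespace ModerateRegime

variable {μ : Kernel (E d) (E d)} [IsMarkovKernel μ] {b : E d → E d} {x₀ : E d}
  {X0 : C(I, E d)} {a : ℕ → ℝ} {η : (n : ℕ) → Measure (Fin n → E d)}
  [∀ n, IsProbabilityMeasure (η n)] {KE : ℝ≥0}

theorem exists_lipschitz (h : ModerateRegime μ b x₀ X0 a η KE) :
    ∃ K : ℝ, 0 ≤ K ∧ (∀ x, ‖b x‖ ≤ K) ∧ (∀ x, ‖fderiv ℝ b x‖ ≤ K) ∧
      ∀ x y, ‖b x - b y‖ ≤ K * ‖x - y‖ := by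
  obtain ⟨K, hK⟩ := h.std.drift_bound
  exact ⟨K, (norm_nonneg _).trans (hK 0).1, fun x => (hK x).1, fun x => (hK x).2,
    drift_lipschitz (h.std.drift_contDiff.differentiable one_ne_zero) fun x => (hK x).2⟩

theorem eventually_pos (h : ModerateRegime μ b x₀ X0 a η KE) (B : ℝ) :
    ∀ᶠ n : ℕ in atTop, 0 < n ∧ 0 < a n ∧ 0 < a n * √n ∧ B ≤ a n * √n := by
  filter_upwards [h.scale_top.eventually_ge_atTop B, h.scale_top.eventually_gt_atTop 0,
    eventually_gt_atTop 0] with n h1 h2 h3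
  exact ⟨h3, (pos_iff_pos_of_mul_pos h2).2 (Real.sqrt_pos.2 (by exact_mod_cast h3)), h2, h1⟩

theorem totalEntropy_le (h : ModerateRegime μ b x₀ X0 a η KE) {n : ℕ} (hn : 0 < n)
    (ha : 0 < a n) :
    totalEntropy (η n) (fun i v => μ (controlledX b x₀ v i)) ≠ ∞ ∧
    (totalEntropy (η n) (fun i v => μ (controlledX b x₀ v i))).toReal ≤ KE / a n ^ 2 := by
  have h1 := h.cost_le n hn
  rw [scaledCost_eq hn] at h1
  have ha2 : 0 < a n ^ 2 := by positivity
  have hne : totalEntropy (η n) (fun i v => μ (controlledX b x₀ v i)) ≠ ∞ := by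
    intro htop
    rw [htop, ENNReal.mul_top (by simpa using ha.ne')] at h1
    exact absurd h1 (by simp)
  refine ⟨hne, ?_⟩
  have h2 := ENNReal.toReal_mono ENNReal.coe_ne_top h1
  rw [ENNReal.toReal_mul, ENNReal.toReal_ofReal ha2.le, ENNReal.coe_toReal] at h2
  rw [le_div_iff₀ ha2]; linarith

/-- The centred parts of the controls disappear in the limit, uniformly in time. Truncation at
level `√n` balances the two error terms of the maximal inequality. -/
theorem tendsto_ampNoise (h : ModerateRegime μ b x₀ X0 a η KE) {ε : ℝ} (hε : 0 < ε) :
    Tendsto (fun n => η n {v | ∃ k ≤ n, ε ≤ ‖ampNoise (η n) a v k‖}) atTop (𝓝 0) := by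
  obtain ⟨c, D, hc, hD, hm⟩ := h.std.exists_expMoment
  have hs := h.scale_top
  have hsqrt : Tendsto (fun n : ℕ => √(n : ℝ)) atTop atTop :=
    Real.tendsto_sqrt_atTop.comp tendsto_natCast_atTop_atTop
  have hlim1 : Tendsto (fun n : ℕ => (KE / c * (√(n : ℝ))⁻¹ + 2 * D / c ^ 2 * a n ^ 2) /
      (ε / 2) ^ 2) atTop (𝓝 0) := by
    have := ((hsqrt.inv_tendsto_atTop.const_mul (KE / c : ℝ)).add
      ((h.scale_zero.pow 2).const_mul (2 * D / c ^ 2))).div_const ((ε / 2) ^ 2)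
    simpa using this
  have hlim2 : Tendsto (fun n : ℕ => (2 * KE / c * (a n * √(n : ℝ))⁻¹ + 2 * D / c ^ 2 * a n) /
      (ε / 2)) atTop (𝓝 0) := by
    have := ((hs.inv_tendsto_atTop.const_mul (2 * KE / c : ℝ)).add
      (h.scale_zero.const_mul (2 * D / c ^ 2))).div_const (ε / 2)
    simpa using this
  have hlim := (ENNReal.tendsto_ofReal hlim1).add (ENNReal.tendsto_ofReal hlim2)
  rw [ENNReal.ofReal_zero, add_zero] at hlim
  refine tendsto_of_tendsto_of_tendsto_of_le_of_le' tendsto_const_nhds hlim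
    (Eventually.of_forall fun _ => zero_le) ?_
  filter_upwards [h.eventually_pos 0] with n hn
  obtain ⟨hn, ha, hs, -⟩ := hn
  have hn' : (0 : ℝ) < n := by exact_mod_cast hn
  have hr : 0 < √(n : ℝ) := Real.sqrt_pos.2 hn'
  have hr2 : √(n : ℝ) * √(n : ℝ) = n := Real.mul_self_sqrt hn'.le
  obtain ⟨hT, hTle⟩ := h.totalEntropy_le hn ha
  set T := totalEntropy (η n) (fun i v => μ (controlledX b x₀ v i))
  have hθ : 0 < a n / √(n : ℝ) := by positivity
  set r := √(n : ℝ) with hrdef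
  have hδ : 0 < ε / 2 / (a n / r) := by positivity
  have hset : {v | ∃ k ≤ n, ε ≤ ‖ampNoise (η n) a v k‖} =
      {v | ∃ k ≤ n, 2 * (ε / 2 / (a n / r)) ≤ ‖centredSum (η n) k v‖} := by
    ext v
    simp only [mem_ofPred_eq]
    refine exists_congr fun k => and_congr_right fun _ => ?_
    rw [ampNoise, norm_smul, Real.norm_of_nonneg hθ.le,
      show 2 * (ε / 2 / (a n / r)) = ε / (a n / r) by ring, div_le_iff₀ hθ, mul_comm]
  rw [hset]
  refine (measure_centredSum_ge_le hc (fun i v => hm _) hD hT hr hδ).trans (add_le_add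
    (ENNReal.ofReal_le_ofReal ?_) (ENNReal.ofReal_le_ofReal ?_))
  · calc r / c * (T.toReal + n * (2 * D / (c * r))) / (ε / 2 / (a n / r)) ^ 2
        ≤ r / c * (KE / a n ^ 2 + n * (2 * D / (c * r))) / (ε / 2 / (a n / r)) ^ 2 := by gcongr
      _ = _ := by rw [← hr2]; field_simp
  · calc 2 * (1 / c * (T.toReal + n * (D / (c * r)))) / (ε / 2 / (a n / r))
        ≤ 2 * (1 / c * (KE / a n ^ 2 + n * (D / (c * r)))) / (ε / 2 / (a n / r)) := by gcongr
      _ = _ := by rw [← hr2]; field_simp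

end ModerateRegime

/-- The `L¹([0,1])` size of the part of the control exceeding level `L`. -/
noncomputable def controlExcess {n : ℕ} (η : Measure (Fin n → E d)) [IsProbabilityMeasure η]
    (a : ℕ → ℝ) (L : ℝ) (v : Fin n → E d) : ℝ :=
  ∑ i ∈ Finset.range n, (1 / n : ℝ) * max (‖ampControl η a v i‖ - L) 0

theorem measurable_controlExcess {n : ℕ} (η : Measure (Fin n → E d)) [IsProbabilityMeasure η]
    (a : ℕ → ℝ) (L : ℝ) : Measurable (controlExcess η a L) :=
  Finset.measurable_fun_sum _ fun i _ =>
    ((((measurable_ampControl η i).norm).sub_const L).max measurable_const).const_mul _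

theorem controlExcess_nonneg {n : ℕ} (η : Measure (Fin n → E d)) [IsProbabilityMeasure η]
    (a : ℕ → ℝ) (L : ℝ) (v : Fin n → E d) : 0 ≤ controlExcess η a L v :=
  Finset.sum_nonneg fun _ _ => mul_nonneg (by positivity) (le_max_right _ _)

theorem sum_norm_ampControl_le {n : ℕ} (hn : 0 < n) (η : Measure (Fin n → E d))
    [IsProbabilityMeasure η] (a : ℕ → ℝ) (L : ℝ) (v : Fin n → E d) :
    ∑ i ∈ Finset.range n, (1 / n : ℝ) * ‖ampControl η a v i‖ ≤ L + controlExcess η a L v := by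
  have hn' : (0 : ℝ) < n := by exact_mod_cast hn
  calc _ ≤ ∑ i ∈ Finset.range n, ((1 / n : ℝ) * L + (1 / n : ℝ) *
          max (‖ampControl η a v i‖ - L) 0) := by
        refine Finset.sum_le_sum fun i _ => ?_
        rw [← mul_add]
        gcongr
        linarith [le_max_left (‖ampControl η a v i‖ - L) 0]
    _ = _ := by
        rw [Finset.sum_add_distrib, controlExcess]
        congr 1
        simp only [Finset.sum_const, Finset.card_range, nsmul_eq_mul]
        field_simp

namespace ModerateRegime

variable {μ : Kernel (E d) (E d)} [IsMarkovKernel μ] {b : E d → E d} {x₀ : E d}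
  {X0 : C(I, E d)} {a : ℕ → ℝ} {η : (n : ℕ) → Measure (Fin n → E d)}
  [∀ n, IsProbabilityMeasure (η n)] {KE : ℝ≥0}

/-- The amplified conditional means are uniformly integrable. -/
theorem exists_lintegral_controlExcess_le (h : ModerateRegime μ b x₀ X0 a η KE) :
    ∃ C : ℝ, 0 ≤ C ∧ ∀ M : ℝ, 0 < M → ∀ᶠ n in atTop,
      ∫⁻ v, ENNReal.ofReal (controlExcess (η n) a (C * M) v) ∂(η n) ≤ ENNReal.ofReal (KE / M) := by
  obtain ⟨c, D, hc, hD, hm⟩ := h.std.exists_expMoment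
  refine ⟨7 * D / c ^ 2, by positivity, fun M hM => ?_⟩
  filter_upwards [h.eventually_pos (M / c)] with n hn
  obtain ⟨hn, ha, hs, hMs⟩ := hn
  have hn' : (0 : ℝ) < n := by exact_mod_cast hn
  have hMs' : M ≤ c * (a n * √n) := by rw [div_le_iff₀ hc] at hMs; linarith
  have hcost := h.cost_le n hn
  have hs2 : (a n * √n) ^ 2 = a n ^ 2 * n := by rw [mul_pow, Real.sq_sqrt hn'.le]
  have hpt : ∀ v, ENNReal.ofReal (controlExcess (η n) a (7 * D / c ^ 2 * M) v) ≤
      ENNReal.ofReal (1 / M) * (ENNReal.ofReal (a n ^ 2 * n) * ((n : ℝ≥0∞)⁻¹ *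
        ∑ i : Fin n, klDiv (control (η n) i v) (μ (controlledX b x₀ v i)))) := by
    intro v
    rw [controlExcess, ENNReal.ofReal_sum_of_nonneg fun _ _ =>
      mul_nonneg (by positivity) (le_max_right _ _),
      ← Fin.sum_univ_eq_sum_range (fun i => ENNReal.ofReal ((1 / n : ℝ) *
        max (‖ampControl (η n) a v i‖ - 7 * D / c ^ 2 * M) 0)),
      Finset.mul_sum, Finset.mul_sum, Finset.mul_sum]
    refine Finset.sum_le_sum fun i _ => ?_
    have h1 := ofReal_norm_mean_le (ν := control (η n) i v) hc hD
      (hm (controlledX b x₀ v i)) hs hM.le hMs'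
    have h2 : ampControl (η n) a v i = (a n * √n) • ∫ y, y ∂(control (η n) i v) := by
      simp [ampControl, predMean]
    rw [h2, ← hs2, mul_left_comm (ENNReal.ofReal ((a n * √n) ^ 2)), ENNReal.ofReal_mul (by
      positivity), one_div (n : ℝ), ENNReal.ofReal_inv_of_pos hn', ENNReal.ofReal_natCast,
      ENNReal.ofReal_max, ENNReal.ofReal_zero, max_eq_left zero_le,
      mul_left_comm (ENNReal.ofReal (1 / M))]
    refine mul_le_mul_right ?_ _
    calc _ = ENNReal.ofReal (1 / M) * ENNReal.ofReal
          (M * (‖(a n * √n) • ∫ y, y ∂(control (η n) i v)‖ - 7 * D / c ^ 2 * M)) := by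
          rw [← ENNReal.ofReal_mul (by positivity), ← mul_assoc, one_div_mul_cancel hM.ne', one_mul]
      _ ≤ _ := mul_le_mul_right h1 _
  calc _ ≤ ∫⁻ v, ENNReal.ofReal (1 / M) * (ENNReal.ofReal (a n ^ 2 * n) * ((n : ℝ≥0∞)⁻¹ *
        ∑ i : Fin n, klDiv (control (η n) i v) (μ (controlledX b x₀ v i)))) ∂(η n) :=
        lintegral_mono hpt
    _ = ENNReal.ofReal (1 / M) * scaledCost a μ b x₀ (η n) := by
        rw [lintegral_const_mul' _ _ ENNReal.ofReal_ne_top,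
          lintegral_const_mul' _ _ ENNReal.ofReal_ne_top, scaledCost]
    _ ≤ ENNReal.ofReal (1 / M) * KE := mul_le_mul_right hcost _
    _ = _ := by
        rw [← ENNReal.ofReal_coe_nnreal, ← ENNReal.ofReal_mul (by positivity)]
        congr 1; ring

theorem measure_controlExcess_ge_le {n : ℕ} {L B ε : ℝ} (hε : 0 < ε)
    (h : ∫⁻ v, ENNReal.ofReal (controlExcess (η n) a L v) ∂(η n) ≤ ENNReal.ofReal B) :
    η n {v | ε ≤ controlExcess (η n) a L v} ≤ ENNReal.ofReal (B / ε) := by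
  calc _ ≤ η n {v | ENNReal.ofReal ε ≤ ENNReal.ofReal (controlExcess (η n) a L v)} :=
        measure_mono fun v hv => ENNReal.ofReal_le_ofReal hv
    _ ≤ _ := meas_ge_le_lintegral_div
        (measurable_controlExcess (η n) a L).ennreal_ofReal.aemeasurable
        (by simpa using hε) ENNReal.ofReal_ne_top
    _ ≤ _ := by rw [ENNReal.ofReal_div_of_pos hε]; gcongr

/-- With high probability the control is bounded in `L¹` and the perturbation is small. -/
theorem exists_eventually_good (h : ModerateRegime μ b x₀ X0 a η KE) {ε : ℝ} (hε : 0 < ε) :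
    ∃ W : ℝ, 0 ≤ W ∧ ∀ m : ℝ, 0 < m → ∀ᶠ n in atTop,
      η n {v | ¬ (∑ i ∈ Finset.range n, (1 / n : ℝ) * ‖ampControl (η n) a v i‖ ≤ W ∧
        ∀ k ≤ n, ‖ampNoise (η n) a v k‖ ≤ m)} ≤ ENNReal.ofReal ε := by
  obtain ⟨C, hC, hCM⟩ := h.exists_lintegral_controlExcess_le
  have hB : 0 < 2 * ((KE : ℝ) + 1) / ε := by positivity
  refine ⟨C * 1 + 2 * ((KE : ℝ) + 1) / ε, by positivity, fun m hm => ?_⟩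
  have hev := (h.tendsto_ampNoise hm).eventually_le_const
    (u := ENNReal.ofReal (ε / 2)) (by simpa using hε)
  filter_upwards [hev, hCM 1 one_pos, h.eventually_pos 0] with n h1 h2 h3
  have h4 := measure_controlExcess_ge_le hB h2
  have hsub : {v | ¬ (∑ i ∈ Finset.range n, (1 / n : ℝ) * ‖ampControl (η n) a v i‖ ≤
        C * 1 + 2 * ((KE : ℝ) + 1) / ε ∧ ∀ k ≤ n, ‖ampNoise (η n) a v k‖ ≤ m)} ⊆
      {v | ∃ k ≤ n, m ≤ ‖ampNoise (η n) a v k‖} ∪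
      {v | 2 * ((KE : ℝ) + 1) / ε ≤ controlExcess (η n) a (C * 1) v} := by
    intro v hv
    by_contra hcon
    simp only [mem_union, mem_ofPred_eq, not_or, not_exists, not_and, not_le] at hcon
    refine hv ⟨?_, fun k hk => (hcon.1 k hk).le⟩
    exact (sum_norm_ampControl_le h3.1 (η n) a (C * 1) v).trans (by linarith [hcon.2])
  calc _ ≤ _ := (measure_mono hsub).trans (measure_union_le _ _)
    _ ≤ ENNReal.ofReal (ε / 2) + ENNReal.ofReal (ε / 2) := by
        refine add_le_add h1 (h4.trans (ENNReal.ofReal_le_ofReal ?_))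
        rw [div_one, div_div_eq_mul_div, div_le_iff₀ (by positivity)]
        nlinarith [KE.2]
    _ = _ := by rw [← ENNReal.ofReal_add (by positivity) (by positivity), add_halves]

end ModerateRegime

end Asymptotics

/-! ### Tightness -/

section Tightness

/-- In a complete metric space, a sequence of tight measures is uniformly tight as soon as, for each
`ε` and `r`, eventually all but mass `ε` lies within `r` of a compact set. -/
theorem exists_isCompact_of_approx {X : Type*} [MetricSpace X] [CompleteSpace X]
    [MeasurableSpace X] {ν : ℕ → Measure X} (h1 : ∀ n, IsTightMeasureSet {ν n})
    (h2 : ∀ ε : ℝ≥0∞, 0 < ε → ∀ r : ℝ, 0 < r → ∃ K : Set X, IsCompact K ∧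
      ∀ᶠ n in atTop, ν n (Metric.cthickening r K)ᶜ ≤ ε) {ε : ℝ≥0∞} (hε : 0 < ε) :
    ∃ K : Set X, IsCompact K ∧ ∀ n, ν n Kᶜ ≤ ε := by
  have h3 : ∀ ε : ℝ≥0∞, 0 < ε → ∀ r : ℝ, 0 < r → ∃ K : Set X, IsCompact K ∧
      ∀ n, ν n (Metric.cthickening r K)ᶜ ≤ ε := by
    intro ε hε r hr
    obtain ⟨K, hK, hev⟩ := h2 ε hε r hr
    obtain ⟨N, hN⟩ := eventually_atTop.1 hev
    choose L hL hLν using fun n =>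
      isTightMeasureSet_iff_exists_isCompact_measure_compl_le.1 (h1 n) ε hε
    refine ⟨K ∪ ⋃ n ∈ Finset.range N, L n,
      hK.union ((Finset.range N).isCompact_biUnion fun n _ => hL n), fun n => ?_⟩
    rcases le_or_gt N n with h | h
    · refine (measure_mono (compl_subset_compl.2 ?_)).trans (hN n h)
      exact Metric.cthickening_subset_of_subset _ subset_union_left
    · refine (measure_mono (compl_subset_compl.2 ?_)).trans (hLν n _ rfl)
      refine Subset.trans ?_ (Metric.self_subset_cthickening _)
      exact subset_union_of_subset_right
        (subset_biUnion_of_mem (u := L) (Finset.mem_coe.2 (Finset.mem_range.2 h))) _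
  obtain ⟨δ, hδ, hδsum⟩ := ENNReal.exists_pos_sum_of_countable' hε.ne' ℕ
  choose K hK hKν using fun j : ℕ => h3 (δ j) (hδ j) (1 / (j + 1)) (by positivity)
  refine ⟨⋂ j : ℕ, Metric.cthickening (1 / ((j : ℝ) + 1)) (K j), ?_, fun n => ?_⟩
  · refine TotallyBounded.isCompact_of_isClosed ?_
      (isClosed_iInter fun j => Metric.isClosed_cthickening)
    rw [Metric.totallyBounded_iff]
    intro r hr
    obtain ⟨j, hj⟩ := exists_nat_one_div_lt (half_pos hr)
    obtain ⟨t, ht, hcov⟩ := Metric.totallyBounded_iff.1 (hK j).totallyBounded (r / 2) (half_pos hr)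
    refine ⟨t, ht, fun x hx => ?_⟩
    have hx' := Metric.cthickening_subset_thickening' (half_pos hr) hj (K j)
      (mem_iInter.1 hx j)
    obtain ⟨y, hy, hxy⟩ := Metric.mem_thickening_iff.1 hx'
    obtain ⟨z, hz, hyz⟩ := mem_iUnion₂.1 (hcov hy)
    refine mem_iUnion₂.2 ⟨z, hz, ?_⟩
    rw [Metric.mem_ball] at hyz ⊢
    linarith [dist_triangle x y z]
  · rw [compl_iInter]
    exact (measure_iUnion_le _).trans ((ENNReal.tsum_le_tsum fun j => hKν j n).trans hδsum.le)

variable {d : ℕ}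

/-- Arzelà–Ascoli for paths that start at zero and share a Lipschitz constant. -/
theorem isCompact_lipschitz_paths (Λ : ℝ) :
    IsCompact {f : C(I, E d) | f 0 = 0 ∧ ∀ s t : I, ‖f t - f s‖ ≤ Λ * |(t : ℝ) - s|} := by
  set A := {f : C(I, E d) | f 0 = 0 ∧ ∀ s t : I, ‖f t - f s‖ ≤ Λ * |(t : ℝ) - s|}
  have hA : IsClosed A := by
    have h1 : IsClosed {f : C(I, E d) | f 0 = 0} :=
      isClosed_eq (continuous_eval_const 0) continuous_const
    have h2 : IsClosed {f : C(I, E d) | ∀ s t : I, ‖f t - f s‖ ≤ Λ * |(t : ℝ) - s|} := by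
      simp only [Set.ofPred_forall]
      refine isClosed_iInter fun s => isClosed_iInter fun t => isClosed_le ?_ continuous_const
      exact ((continuous_eval_const t).sub
        (continuous_eval_const s)).norm
    exact h1.inter h2
  let e := ContinuousMap.isometryEquivBoundedOfCompact I (E d)
  have hB : IsCompact (e.symm ⁻¹' A) := by
    refine BoundedContinuousFunction.arzela_ascoli₂ (Metric.closedBall 0 |Λ|)
      (isCompact_closedBall 0 _) _ (hA.preimage e.symm.continuous) ?_ ?_
    · intro f t hf
      obtain ⟨h0, hlip⟩ := hf
      have h := hlip 0 t
      rw [h0, sub_zero] at h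
      rw [mem_closedBall_zero_iff]
      refine h.trans ?_
      have ht : |(t : ℝ) - ((0 : I) : ℝ)| ≤ 1 := by
        rw [abs_le]; simp only [Icc.coe_zero]; constructor <;> linarith [t.2.1, t.2.2]
      exact (mul_le_mul_of_nonneg_right (le_abs_self Λ) (abs_nonneg _)).trans
        (mul_le_of_le_one_right (abs_nonneg _) ht)
    · refine Metric.equicontinuous_of_continuity_modulus (fun x => |Λ| * x) ?_ _ ?_
      · have : Tendsto (fun x : ℝ => |Λ| * x) (𝓝 0) (𝓝 (|Λ| * 0)) :=
          (continuous_const.mul continuous_id).tendsto 0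
        simpa using this
      · intro s t f
        have h := f.2.2 t s
        rw [dist_eq_norm, Subtype.dist_eq, Real.dist_eq]
        exact h.trans (mul_le_mul_of_nonneg_right (le_abs_self Λ) (abs_nonneg _))
  have himg : e.symm '' (e.symm ⁻¹' A) = A := image_preimage_eq _ e.symm.surjective
  rw [← himg]
  exact hB.image e.symm.continuous

/-- The radial retraction onto the ball of radius `L`. -/
noncomputable def clip (L : ℝ) (y : E d) : E d := (L / max L ‖y‖) • y

theorem continuous_clip {L : ℝ} (hL : 0 < L) : Continuous (clip (d := d) L) := by
  unfold clip
  refine Continuous.smul (Continuous.div continuous_const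
    (continuous_const.max continuous_norm) fun y => ?_) continuous_id
  exact (lt_max_of_lt_left hL).ne'

theorem norm_clip_le {L : ℝ} (hL : 0 < L) (y : E d) : ‖clip L y‖ ≤ L := by
  have h0 : 0 < max L ‖y‖ := lt_max_of_lt_left hL
  rw [clip, norm_smul, Real.norm_of_nonneg (by positivity), div_mul_eq_mul_div, div_le_iff₀ h0]
  exact mul_le_mul_of_nonneg_left (le_max_right _ _) hL.le

theorem norm_sub_clip {L : ℝ} (hL : 0 < L) (y : E d) : ‖y - clip L y‖ = max (‖y‖ - L) 0 := by
  have h0 : 0 < max L ‖y‖ := lt_max_of_lt_left hL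
  rcases le_total ‖y‖ L with h | h
  · rw [clip, max_eq_left h, div_self hL.ne', one_smul, sub_self, norm_zero,
      max_eq_right (by linarith)]
  · have hy : 0 < ‖y‖ := hL.trans_le h
    have : y - clip L y = (1 - L / ‖y‖) • y := by
      rw [clip, max_eq_right h, sub_smul, one_smul]
    rw [this, norm_smul, Real.norm_of_nonneg (by rw [sub_nonneg, div_le_one hy]; exact h),
      max_eq_left (by linarith)]
    field_simp

namespace ModerateRegime

variable {μ : Kernel (E d) (E d)} [IsMarkovKernel μ] {b : E d → E d} {x₀ : E d}
  {X0 : C(I, E d)} {a : ℕ → ℝ} {η : (n : ℕ) → Measure (Fin n → E d)}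
  [∀ n, IsProbabilityMeasure (η n)] {KE : ℝ≥0}

theorem continuous_drift (h : ModerateRegime μ b x₀ X0 a η KE) : Continuous b :=
  h.std.drift_contDiff.continuous

/-- Up to a small perturbation, the controlled path is the integral of a bounded function, namely of
the drift plus the clipped control. -/
theorem exists_isCompact_path_approx (h : ModerateRegime μ b x₀ X0 a η KE) {ε : ℝ} (hε : 0 < ε)
    {r : ℝ} (hr : 0 < r) : ∃ K : Set C(I, E d), IsCompact K ∧ ∀ᶠ n in atTop,
      η n {v | controlledPath a b x₀ v ∉ Metric.cthickening r K} ≤ ENNReal.ofReal ε := by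
  obtain ⟨K, hK, -, -, hlip⟩ := h.exists_lipschitz
  obtain ⟨W, hW, hgood⟩ := h.exists_eventually_good (half_pos hε)
  obtain ⟨C, hC, hCM⟩ := h.exists_lintegral_controlExcess_le
  set M : ℝ := 4 * (KE + 1) / (ε * r) with hMdef
  have hM : 0 < M := by positivity
  set L := C * M + 1 with hL
  have hLp : 0 < L := by positivity
  refine ⟨_, isCompact_lipschitz_paths (K * ((W + r / 2) * Real.exp K) + L), ?_⟩
  filter_upwards [hgood (r / 2) (half_pos hr), hCM M hM, h.eventually_pos 0] with n h1 h2 h3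
  have h4 := measure_controlExcess_ge_le (half_pos hr) h2
  obtain ⟨hn, -, hs, -⟩ := h3
  have hsub : {v | controlledPath a b x₀ v ∉ Metric.cthickening r {f : C(I, E d) | f 0 = 0 ∧
        ∀ s t : I, ‖f t - f s‖ ≤ (K * ((W + r / 2) * Real.exp K) + L) * |(t : ℝ) - s|}} ⊆
      {v | ¬ (∑ i ∈ Finset.range n, (1 / n : ℝ) * ‖ampControl (η n) a v i‖ ≤ W ∧
        ∀ k ≤ n, ‖ampNoise (η n) a v k‖ ≤ r / 2)} ∪
      {v | r / 2 ≤ controlExcess (η n) a (C * M) v} := by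
    intro v hv
    by_contra hcon
    simp only [mem_union, mem_ofPred_eq, not_or, not_not, not_le] at hcon
    obtain ⟨⟨hvW, hvm⟩, hvE⟩ := hcon
    have hp := isDiscretePath_controlledY (x₀ := x₀) (η n) hn hs hK hlip hvm hvW
    refine hv ?_
    set z : ℕ → E d := fun k => ampDrift a b x₀ v k + clip L (ampControl (η n) a v k)
    set U : C(I, E d) := interp n fun k => ∑ i ∈ Finset.range k, (1 / n : ℝ) • z i
    have hU : ∀ t : I, U t = ∫ s in Iic t, z ⌊(n * s : ℝ)⌋₊ := fun t =>
      (setIntegral_floor_eq_interpFun hn z t).symm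
    refine Metric.mem_cthickening_of_dist_le _ U _ _ ⟨?_, fun s t => ?_⟩ ?_
    · have h0 : U 0 = interpFun n (fun k => ∑ i ∈ Finset.range k, (1 / n : ℝ) • z i) 0 := rfl
      rw [h0, interpFun]; simp
    · rw [hU, hU]
      refine norm_setIntegral_Iic_sub_le (integrable_floor z) (fun q => ?_) s t
      exact (norm_add_le _ _).trans (add_le_add (hp.norm_drift_floor_le q) (norm_clip_le hLp _))
    · rw [ContinuousMap.dist_le hr.le]
      intro t
      rw [dist_eq_norm, hU]
      refine (hp.norm_interpFun_sub_le (fun k => clip L (ampControl (η n) a v k)) t).trans ?_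
      have : ∑ i ∈ Finset.range n, (1 / n : ℝ) *
          ‖ampControl (η n) a v i - clip L (ampControl (η n) a v i)‖ ≤
          controlExcess (η n) a (C * M) v := by
        refine Finset.sum_le_sum fun i _ => ?_
        rw [norm_sub_clip hLp]
        gcongr
        linarith
      linarith
  calc _ ≤ _ := (measure_mono hsub).trans (measure_union_le _ _)
    _ ≤ ENNReal.ofReal (ε / 2) + ENNReal.ofReal (ε / 2) := by
        refine add_le_add h1 (h4.trans (ENNReal.ofReal_le_ofReal ?_))
        rw [div_le_iff₀ (by positivity), div_le_iff₀ hM, hMdef]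
        have : ε / 2 * (r / 2) * (4 * (KE + 1) / (ε * r)) = (KE : ℝ) + 1 := by field_simp; ring
        rw [this]; linarith
    _ = _ := by rw [← ENNReal.ofReal_add (by positivity) (by positivity), add_halves]

theorem lintegral_ofReal_norm_ampMean {n : ℕ} (hn : 0 < n) (v : Fin n → E d) :
    ∫⁻ t : I, ENNReal.ofReal ‖ampMean a (η n) v t‖ =
      ENNReal.ofReal (∑ i ∈ Finset.range n, (1 / n : ℝ) * ‖ampControl (η n) a v i‖) := by
  have hn' : (0 : ℝ) < n := by exact_mod_cast hn
  simp only [ampMean_eq]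
  rw [lintegral_floor hn fun k => ENNReal.ofReal ‖ampControl (η n) a v k‖, Finset.mul_sum,
    ENNReal.ofReal_sum_of_nonneg fun _ _ => by positivity]
  refine Finset.sum_congr rfl fun i _ => ?_
  rw [ENNReal.ofReal_mul (by positivity), one_div, ENNReal.ofReal_inv_of_pos hn',
    ENNReal.ofReal_natCast]

/-- Prokhorov's theorem for the occupation measures. -/
theorem exists_isCompact_occMeasure (h : ModerateRegime μ b x₀ X0 a η KE) {ε : ℝ} (hε : 0 < ε) :
    ∃ K : Set (ProbabilityMeasure (E d × I)), IsCompact K ∧ ∀ᶠ n in atTop,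
      η n {v | occMeasure a (η n) v ∉ K} ≤ ENNReal.ofReal ε := by
  obtain ⟨W, hW, hgood⟩ := h.exists_eventually_good hε
  have hu : Tendsto (fun j : ℕ => Real.toNNReal (W / ((j : ℝ) + 1))) atTop (𝓝 0) := by
    have h1 : Tendsto (fun j : ℕ => W / ((j : ℝ) + 1)) atTop (𝓝 0) := by
      have := tendsto_one_div_add_atTop_nhds_zero_nat (𝕜 := ℝ)
      simpa [div_eq_mul_inv] using this.const_mul W
    have := (continuous_real_toNNReal.tendsto 0).comp h1
    rwa [Real.toNNReal_zero] at this
  refine ⟨_, isCompact_setOfPred_probabilityMeasure_mass_eq_compl_isCompact_le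
    (K := fun j : ℕ => Metric.closedBall (0 : E d) (j + 1) ×ˢ (univ : Set I)) hu
    (fun j => (isCompact_closedBall 0 _).prod isCompact_univ) (Or.inl inferInstance), ?_⟩
  filter_upwards [hgood 1 one_pos, h.eventually_pos 0] with n h1 h3
  refine (measure_mono fun v hv => ?_).trans h1
  simp only [mem_ofPred_eq] at hv ⊢
  rintro ⟨hvW, -⟩
  refine hv fun j => ?_
  have hj : (0 : ℝ) < j + 1 := by positivity
  have hmeas := (measurable_ampMean a (η n) v)
  have hset : MeasurableSet (Metric.closedBall (0 : E d) (j + 1) ×ˢ (univ : Set I))ᶜ :=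
    (Metric.isClosed_closedBall.measurableSet.prod MeasurableSet.univ).compl
  rw [← ENNReal.coe_le_coe, ProbabilityMeasure.ennreal_coeFn_eq_coeFn_toMeasure]
  change (volume : Measure I).map (fun t => (ampMean a (η n) v t, t)) _ ≤ _
  rw [Measure.map_apply (f := fun t => (ampMean a (η n) v t, t)) (hmeas.prodMk measurable_id) hset]
  calc _ ≤ volume {t : I | ENNReal.ofReal (j + 1) ≤ ENNReal.ofReal ‖ampMean a (η n) v t‖} := by
        refine measure_mono fun t ht => ENNReal.ofReal_le_ofReal ?_
        simp only [mem_preimage, mem_compl_iff, mem_prod, mem_univ, and_true,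
          mem_closedBall_zero_iff, not_le] at ht
        exact ht.le
    _ ≤ (∫⁻ t : I, ENNReal.ofReal ‖ampMean a (η n) v t‖) / ENNReal.ofReal (j + 1) :=
        meas_ge_le_lintegral_div (by fun_prop) (by simpa using hj) ENNReal.ofReal_ne_top
    _ ≤ ENNReal.ofReal W / ENNReal.ofReal (j + 1) := by
        rw [lintegral_ofReal_norm_ampMean h3.1]
        gcongr
    _ = _ := by rw [← ENNReal.ofReal_div_of_pos hj]; rfl

theorem isTightMeasureSet_map_controlPair (h : ModerateRegime μ b x₀ X0 a η KE) (n : ℕ) :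
    IsTightMeasureSet {(η n).map (controlPair a b x₀ (η n))} := by
  have hb := h.continuous_drift
  have hc : Continuous (Y := PairSpace d) fun p : (Fin (n + 1) → E d) × (Fin n → E d) =>
      (stepLaw p.1, controlledPath a b x₀ p.2) :=
    (continuous_stepLaw.comp continuous_fst).prodMk
      ((continuous_controlledPath hb).comp continuous_snd)
  have hm : Measurable fun v : Fin n → E d =>
      ((fun k : Fin (n + 1) => ampControl (η n) a v k), v) :=
    (measurable_ampControl_pi (η n)).prodMk measurable_id
  have : T2Space (PairSpace d) :=
    inferInstanceAs (T2Space (ProbabilityMeasure (E d × I) × C(I, E d)))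
  have ht := (isTightMeasureSet_singleton (μ := (η n).map fun v : Fin n → E d =>
      ((fun k : Fin (n + 1) => ampControl (η n) a v k), v))).map hc
  rw [image_singleton, Measure.map_map (Continuous.measurable (γ := PairSpace d) hc) hm] at ht
  exact ht

/-- Uniform tightness of the laws of the pairs. -/
theorem isTightMeasureSet_controlPair (h : ModerateRegime μ b x₀ X0 a η KE) :
    IsTightMeasureSet {ρ : Measure (PairSpace d) |
      ∃ n : ℕ, 1 ≤ n ∧ ρ = (η n).map (controlPair a b x₀ (η n))} := by
  rw [isTightMeasureSet_iff_exists_isCompact_measure_compl_le]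
  intro ε' hε'
  obtain ⟨ε, hε, hεε'⟩ : ∃ ε : ℝ, 0 < ε ∧ ENNReal.ofReal ε ≤ ε' := by
    obtain ⟨q, hq0, hq⟩ := ENNReal.lt_iff_exists_nnreal_btwn.1 hε'
    exact ⟨q, by exact_mod_cast hq0, by rw [ENNReal.ofReal_coe_nnreal]; exact hq.le⟩
  have hb := h.continuous_drift
  let : MeasurableSpace C(I, E d) := borel _
  have : BorelSpace C(I, E d) := ⟨rfl⟩
  have hpm : ∀ n, Measurable fun v : Fin n → E d => controlledPath a b x₀ v := fun n =>
    (continuous_controlledPath hb).measurable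
  -- the paths
  obtain ⟨K₂, hK₂, hK₂ν⟩ := exists_isCompact_of_approx
    (ν := fun n => (η n).map fun v => controlledPath a b x₀ v) (fun n => by
      have ht := (isTightMeasureSet_singleton (μ := η n)).map
        (continuous_controlledPath (a := a) (x₀ := x₀) hb)
      rwa [image_singleton] at ht) (fun δ' hδ' r hr => by
      obtain ⟨δ, hδ, hδδ'⟩ : ∃ δ : ℝ, 0 < δ ∧ ENNReal.ofReal δ ≤ δ' := by
        obtain ⟨q, hq0, hq⟩ := ENNReal.lt_iff_exists_nnreal_btwn.1 hδ'
        exact ⟨q, by exact_mod_cast hq0, by rw [ENNReal.ofReal_coe_nnreal]; exact hq.le⟩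
      obtain ⟨K, hK, hev⟩ := h.exists_isCompact_path_approx hδ hr
      refine ⟨K, hK, hev.mono fun n hn => ?_⟩
      rw [Measure.map_apply (hpm n) Metric.isClosed_cthickening.measurableSet.compl]
      exact hn.trans hδδ') (ε := ENNReal.ofReal (ε / 2)) (by simpa using hε)
  -- the occupation measures
  obtain ⟨K₁, hK₁, hev⟩ := h.exists_isCompact_occMeasure (half_pos hε)
  obtain ⟨N, hN⟩ := eventually_atTop.1 hev
  choose L hL hLν using fun n => isTightMeasureSet_iff_exists_isCompact_measure_compl_le.1
    (h.isTightMeasureSet_map_controlPair n) ε' hε'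
  let K₁₂ : Set (PairSpace d) := K₁ ×ˢ K₂
  have hK : IsCompact K₁₂ := hK₁.prod hK₂
  refine ⟨K₁₂ ∪ ⋃ n ∈ Finset.range N, L n,
    hK.union ((Finset.range N).isCompact_biUnion fun n _ => hL n), ?_⟩
  rintro _ ⟨n, -, rfl⟩
  rcases le_or_gt N n with hn | hn
  · have : T2Space (PairSpace d) :=
      inferInstanceAs (T2Space (ProbabilityMeasure (E d × I) × C(I, E d)))
    have hKm : MeasurableSet K₁₂ᶜ := hK.isClosed.measurableSet.compl
    refine (measure_mono (compl_subset_compl.2 subset_union_left)).trans ?_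
    rw [Measure.map_apply (measurable_controlPair (η n) hb) hKm]
    have hsub : (fun v => controlPair a b x₀ (η n) v) ⁻¹' K₁₂ᶜ ⊆
        {v | occMeasure a (η n) v ∉ K₁} ∪ (fun v => controlledPath a b x₀ v) ⁻¹' K₂ᶜ := by
      intro v hv
      by_contra hcon
      rw [mem_union, not_or] at hcon
      exact hv ⟨not_not.1 hcon.1, not_not.1 hcon.2⟩
    have h2 := hK₂ν n
    rw [Measure.map_apply (hpm n) hK₂.isClosed.measurableSet.compl] at h2
    refine (measure_mono hsub).trans ((measure_union_le _ _).trans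
      ((add_le_add (hN n hn) h2).trans ?_))
    rwa [← ENNReal.ofReal_add (by positivity) (by positivity), add_halves]
  · refine (measure_mono (compl_subset_compl.2 ?_)).trans (hLν n _ rfl)
    exact subset_union_of_subset_right
        (subset_biUnion_of_mem (u := L) (Finset.mem_coe.2 (Finset.mem_range.2 hn))) _

end ModerateRegime

end Tightness

/-! ### Convergence of the prelimit dynamics -/

section Prelimit

variable {d : ℕ}

/-- A continuous function is uniformly continuous at the points of a compact curve, also against
points off the curve. -/
theorem exists_uniform_along_path {F : Type*} [PseudoMetricSpace F] {f : E d → F}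
    (hf : Continuous f) (X0 : C(I, E d)) {ε : ℝ} (hε : 0 < ε) :
    ∃ ρ : ℝ, 0 < ρ ∧ ∀ (s : I) (y : E d), ‖y - X0 s‖ < ρ → dist (f y) (f (X0 s)) < ε := by
  have hc : IsCompact (range X0) := isCompact_range X0.continuous
  have h := hc.uniformContinuousAt_of_continuousAt f (fun x _ => hf.continuousAt)
    (Metric.dist_mem_uniformity hε)
  obtain ⟨ρ, hρ, hρs⟩ := Metric.mem_uniformity_dist.1 h
  refine ⟨ρ, hρ, fun s y hy => ?_⟩
  have := hρs (a := X0 s) (b := y) (by rwa [dist_comm, dist_eq_norm]) (mem_range_self s)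
  rw [dist_comm]
  exact this

namespace ModerateRegime

variable {μ : Kernel (E d) (E d)} [IsMarkovKernel μ] {b : E d → E d} {x₀ : E d}
  {X0 : C(I, E d)} {a : ℕ → ℝ} {η : (n : ℕ) → Measure (Fin n → E d)}
  [∀ n, IsProbabilityMeasure (η n)] {KE : ℝ≥0}

/-- The discretized noiseless dynamics are close to `X⁰`, and amplified distances of order one
disappear. -/
theorem eventually_close (h : ModerateRegime μ b x₀ X0 a η KE) (S : ℝ) {ρ : ℝ} (hρ : 0 < ρ) :
    ∀ᶠ n : ℕ in atTop, ∀ t : I,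
      ‖noiselessX b x₀ n ⌊(n * t : ℝ)⌋₊ - X0 t‖ + (a n * √n)⁻¹ * S < ρ := by
  obtain ⟨K, hK, hbK, -, hlip⟩ := h.exists_lipschitz
  have h1 : Tendsto (fun n : ℕ => (K ^ 2 * Real.exp K + K) / n + (a n * √n)⁻¹ * S) atTop (𝓝 0) := by
    have := (tendsto_const_div_atTop_nhds_zero_nat (K ^ 2 * Real.exp K + K)).add
      (h.scale_top.inv_tendsto_atTop.mul_const S)
    simpa using this
  filter_upwards [h1.eventually (gt_mem_nhds hρ), eventually_gt_atTop 0] with n hn hn0 t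
  have := norm_noiselessX_sub_le hn0 h.limit hK h.continuous_drift hbK hlip t
  linarith

theorem eventually_controlledX_close (h : ModerateRegime μ b x₀ X0 a η KE) {ρ : ℝ} (hρ : 0 < ρ)
    {κ : ℝ} (hκ : 0 < κ) :
    ∀ᶠ n in atTop, η n {v | ∃ t : I, ρ ≤ ‖controlledX b x₀ v ⌊(n * t : ℝ)⌋₊ - X0 t‖} ≤
      ENNReal.ofReal κ := by
  obtain ⟨K, hK, hbK, -, hlip⟩ := h.exists_lipschitz
  obtain ⟨W, hW, hgood⟩ := h.exists_eventually_good hκ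
  filter_upwards [hgood 1 one_pos, h.eventually_close ((W + 1) * Real.exp K) hρ,
    h.eventually_pos 0] with n h1 h2 h3
  refine (measure_mono ?_).trans h1
  rintro v ⟨t, ht⟩ ⟨hvW, hvm⟩
  have hp := isDiscretePath_controlledY (x₀ := x₀) (η n) h3.1 h3.2.2.1 hK hlip hvm hvW
  have hY := hp.norm_le _ (floor_le_of_unitInterval n t)
  have hi : 0 < (a n * √n)⁻¹ := inv_pos.2 h3.2.2.1
  rw [controlledX_eq h3.2.2.1.ne', add_sub_right_comm] at ht
  have h4 := norm_add_le (noiselessX b x₀ n ⌊(n * t : ℝ)⌋₊ - X0 t)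
    ((a n * √n)⁻¹ • controlledY a b x₀ v ⌊(n * t : ℝ)⌋₊)
  rw [norm_smul, Real.norm_of_nonneg hi.le] at h4
  have h5 := mul_le_mul_of_nonneg_left hY hi.le
  linarith [h2 t]

/-- The paths almost solve the limit equation, with high probability and uniformly in time. -/
theorem eventually_limit_equation (h : ModerateRegime μ b x₀ X0 a η KE) {κ : ℝ} (hκ : 0 < κ) :
    ∀ᶠ n in atTop, η n {v | ∃ t : I, κ < ‖controlledPath a b x₀ v t -
        (∫ s in Iic t, fderiv ℝ b (X0 s) (controlledPath a b x₀ v s)) -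
        ∫ s in Iic t, ampMean a (η n) v s‖} ≤ ENNReal.ofReal κ := by
  obtain ⟨K, hK, hbK, hdK, hlip⟩ := h.exists_lipschitz
  obtain ⟨W, hW, hgood⟩ := h.exists_eventually_good hκ
  have hC1 := h.std.drift_contDiff
  have hDc : Continuous (fderiv ℝ b) := hC1.continuous_fderiv one_ne_zero
  set S := (W + 1) * Real.exp K with hS
  have hS0 : 0 < S := by positivity
  set ε := κ / (4 * S) with hεdef
  have hε : 0 < ε := by positivity
  obtain ⟨ρ, hρ, hρε⟩ := exists_uniform_along_path hDc X0 hε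
  set m := min 1 (κ / (4 * (1 + 2 * K))) with hmdef
  have hm : 0 < m := lt_min one_pos (by positivity)
  have hlim : Tendsto (fun n : ℕ => K * (K * S + W) / n) atTop (𝓝 0) :=
    tendsto_const_div_atTop_nhds_zero_nat _
  filter_upwards [hgood m hm, h.eventually_close S hρ, h.eventually_pos 0,
    hlim.eventually (gt_mem_nhds (show 0 < κ / 4 by positivity))] with n h1 h2 h3 h4
  refine (measure_mono ?_).trans h1
  rintro v ⟨t, ht⟩ ⟨hvW, hvm⟩
  refine absurd ht (not_lt.2 ?_)
  have hn' : (0 : ℝ) < n := by exact_mod_cast h3.1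
  have hp := isDiscretePath_controlledY (x₀ := x₀) (η n) h3.1 h3.2.2.1 hK hlip hvm hvW
  have hSm : (W + m) * Real.exp K ≤ S := by
    rw [hS]; gcongr; exact min_le_left _ _
  have hYS : ∀ s : I, ‖controlledY a b x₀ v ⌊(n * s : ℝ)⌋₊‖ ≤ S := fun s =>
    (hp.norm_le _ (floor_le_of_unitInterval n s)).trans hSm
  have hδ : ∀ s : I, ‖ampDrift a b x₀ v ⌊(n * s : ℝ)⌋₊ -
      fderiv ℝ b (X0 s) (controlledY a b x₀ v ⌊(n * s : ℝ)⌋₊)‖ ≤ κ / 4 := fun s => by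
    have hi : 0 < (a n * √n)⁻¹ := inv_pos.2 h3.2.2.1
    refine (norm_ampDrift_sub_le h3.2.2.1 (hC1.differentiable one_ne_zero) (x := X0 s) (ρ := ρ)
      (ε := ε) (fun y hy => ?_) ?_).trans ?_
    · have := hρε s y hy
      rw [dist_eq_norm] at this
      exact this.le
    · have h5 := mul_le_mul_of_nonneg_left (hYS s) hi.le
      linarith [h2 s]
    · calc _ ≤ ε * S := mul_le_mul_of_nonneg_left (hYS s) hε.le
        _ = κ / 4 := by rw [hεdef]; field_simp
  have hA : Continuous fun s : I => fderiv ℝ b (X0 s) := hDc.comp X0.continuous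
  have hfin := hp.norm_limit_equation_le hA (fun s => hdK _) hδ t
  refine hfin.trans ?_
  have hm2 : m * (1 + 2 * K) ≤ κ / 4 := by
    have : m ≤ κ / (4 * (1 + 2 * K)) := min_le_right _ _
    rw [le_div_iff₀ (by positivity)] at this
    linarith
  have hKS : K * ((K * ((W + m) * Real.exp K) + W) / n) ≤ K * (K * S + W) / n := by
    rw [mul_div_assoc]
    gcongr
  nlinarith

end ModerateRegime

end Prelimit

/-! ### Functionals of weak limits -/

section WeakLimit

/-- Lower semicontinuity of expectations under convergence in distribution, for an increasing limit
of bounded continuous functions. -/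
theorem lintegral_iSup_le_liminf_of_tendstoInDistribution {X Ω : Type*} {Ω' : ℕ → Type*}
    [TopologicalSpace X] [MeasurableSpace X] [OpensMeasurableSpace X]
    [MeasurableSpace Ω] {mΩ' : ∀ k, MeasurableSpace (Ω' k)}
    {Xs : (k : ℕ) → Ω' k → X} {Z : Ω → X} {μs : (k : ℕ) → Measure (Ω' k)}
    [∀ k, IsProbabilityMeasure (μs k)] {P : Measure Ω} [IsProbabilityMeasure P]
    (hXZ : TendstoInDistribution Xs atTop Z μs P) {G : ℕ → X → ℝ≥0} (hG : ∀ N, Continuous (G N))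
    (hbd : ∀ N, ∃ c : ℝ≥0, ∀ x, G N x ≤ c) (hmono : Monotone G) :
    ∫⁻ ω, ⨆ N, (G N (Z ω) : ℝ≥0∞) ∂P ≤
      liminf (fun k => ∫⁻ v, ⨆ N, (G N (Xs k v) : ℝ≥0∞) ∂(μs k)) atTop := by
  have hZ := hXZ.aemeasurable_limit
  have hm : ∀ N, Measurable fun x => (G N x : ℝ≥0∞) := fun N =>
    (ENNReal.continuous_coe.comp (hG N)).measurable
  rw [lintegral_iSup' (f := fun N ω => (G N (Z ω) : ℝ≥0∞))
    (fun N => (hm N).comp_aemeasurable hZ) (Eventually.of_forall fun ω N N' hN =>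
    ENNReal.coe_le_coe.2 (hmono hN (Z ω)))]
  refine iSup_le fun N => ?_
  obtain ⟨c, hc⟩ := hbd N
  let g : BoundedContinuousFunction X ℝ≥0 :=
    BoundedContinuousFunction.mkOfBound ⟨G N, hG N⟩ c fun x y => by
      rw [NNReal.dist_eq, abs_sub_le_iff]
      have h1 : (G N x : ℝ) ≤ c := NNReal.coe_le_coe.2 (hc x)
      have h2 : (G N y : ℝ) ≤ c := NNReal.coe_le_coe.2 (hc y)
      constructor <;> simp <;> linarith [(G N x).2, (G N y).2]
  have hg : ∀ x, g x = G N x := fun _ => rfl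
  have hlim := ProbabilityMeasure.tendsto_iff_forall_lintegral_tendsto.1 hXZ.tendsto g
  simp only [ProbabilityMeasure.coe_mk, hg] at hlim
  rw [lintegral_map' (hm N).aemeasurable hZ] at hlim
  refine (hlim.liminf_eq.ge).trans (liminf_le_liminf (Eventually.of_forall fun k => ?_))
  rw [lintegral_map' (hm N).aemeasurable (hXZ.forall_aemeasurable k)]
  exact lintegral_mono fun v => le_iSup (fun N => (G N (Xs k v) : ℝ≥0∞)) N

theorem lintegral_le_liminf_of_tendstoInDistribution {X Ω : Type*} {Ω' : ℕ → Type*}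
    [TopologicalSpace X] [MeasurableSpace X] [OpensMeasurableSpace X]
    [MeasurableSpace Ω] {mΩ' : ∀ k, MeasurableSpace (Ω' k)}
    {Xs : (k : ℕ) → Ω' k → X} {Z : Ω → X} {μs : (k : ℕ) → Measure (Ω' k)}
    [∀ k, IsProbabilityMeasure (μs k)] {P : Measure Ω} [IsProbabilityMeasure P]
    (hXZ : TendstoInDistribution Xs atTop Z μs P) {G : X → ℝ≥0} (hG : Continuous G)
    {c : ℝ≥0} (hbd : ∀ x, G x ≤ c) :
    ∫⁻ ω, (G (Z ω) : ℝ≥0∞) ∂P ≤ liminf (fun k => ∫⁻ v, (G (Xs k v) : ℝ≥0∞) ∂(μs k)) atTop := by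
  have := lintegral_iSup_le_liminf_of_tendstoInDistribution hXZ (G := fun _ => G) (fun _ => hG)
    (fun _ => ⟨c, hbd⟩) monotone_const
  simpa using this

theorem iSup_lintegral_min {Y : Type*} [MeasurableSpace Y] (ν : Measure Y) {f : Y → ℝ≥0}
    (hf : Measurable f) :
    ⨆ N : ℕ, ∫⁻ y, ((min (f y) N : ℝ≥0) : ℝ≥0∞) ∂ν = ∫⁻ y, f y ∂ν := by
  rw [← lintegral_iSup (fun N => (hf.min measurable_const).coe_nnreal_ennreal)
    (fun N N' h y => ENNReal.coe_le_coe.2 (min_le_min_left _ (Nat.cast_le.2 h)))]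
  refine lintegral_congr fun y => le_antisymm (iSup_le fun N => ENNReal.coe_le_coe.2
    (min_le_left _ _)) ?_
  obtain ⟨N, hN⟩ := exists_nat_ge (f y)
  refine le_iSup_of_le N ?_
  rw [min_eq_left hN]

/-- The integral of `f ∧ N`, as a continuous function of the measure. -/
theorem continuous_toNNReal_lintegral_min {Y : Type*} [TopologicalSpace Y] [MeasurableSpace Y]
    [OpensMeasurableSpace Y] {f : Y → ℝ≥0} (hf : Continuous f) (N : ℕ) :
    Continuous fun ν : ProbabilityMeasure Y =>
      (∫⁻ y, ((min (f y) N : ℝ≥0) : ℝ≥0∞) ∂(ν : Measure Y)).toNNReal := by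
  let g : BoundedContinuousFunction Y ℝ≥0 :=
    BoundedContinuousFunction.mkOfBound ⟨fun y => min (f y) N, hf.min continuous_const⟩ N
      fun x y => by
      have h1 : ((min (f x) N : ℝ≥0) : ℝ) ≤ N := NNReal.coe_le_coe.2 (min_le_right (f x) N)
      have h2 : ((min (f y) N : ℝ≥0) : ℝ) ≤ N := NNReal.coe_le_coe.2 (min_le_right (f y) N)
      rw [NNReal.dist_eq, abs_sub_le_iff]
      have h3 := (min (f x) N : ℝ≥0).2
      have h4 := (min (f y) N : ℝ≥0).2
      constructor <;> (dsimp at *; linarith)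
  exact (FiniteMeasure.continuous_testAgainstNN_eval g).comp
    ProbabilityMeasure.toFiniteMeasure_continuous

theorem lintegral_min_le {Y : Type*} [MeasurableSpace Y] (ν : ProbabilityMeasure Y) (f : Y → ℝ≥0)
    (N : ℕ) : ∫⁻ y, ((min (f y) N : ℝ≥0) : ℝ≥0∞) ∂(ν : Measure Y) ≤ N := by
  calc _ ≤ ∫⁻ y, (N : ℝ≥0∞) ∂(ν : Measure Y) := lintegral_mono fun y => by
          rw [← ENNReal.coe_natCast]
          exact ENNReal.coe_le_coe.2 (min_le_right (f y) N)
    _ = N := by simp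

theorem continuous_integral_of_norm_le {Y : Type*} [TopologicalSpace Y] [MeasurableSpace Y]
    [OpensMeasurableSpace Y] {d : ℕ} {f : Y → E d} (hf : Continuous f) {c : ℝ}
    (hc : ∀ y, ‖f y‖ ≤ c) :
    Continuous fun ν : ProbabilityMeasure Y => ∫ y, f y ∂(ν : Measure Y) := by
  have hint : ∀ ν : ProbabilityMeasure Y, Integrable f (ν : Measure Y) := fun ν =>
    Integrable.of_bound hf.stronglyMeasurable.aestronglyMeasurable c (Eventually.of_forall hc)
  refine (PiLp.continuous_toLp 2 _).comp (g := fun x => WithLp.toLp 2 x)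
    (f := fun (ν : ProbabilityMeasure Y) (i : Fin d) => (∫ y, f y ∂(ν : Measure Y)) i)
    (continuous_pi fun i => ?_)
  have h : ∀ ν : ProbabilityMeasure Y, (∫ y, f y ∂(ν : Measure Y)) i =
      ∫ y, f y i ∂(ν : Measure Y) := fun ν =>
    ((EuclideanSpace.proj (𝕜 := ℝ) i).integral_comp_comm (hint ν)).symm
  simp only [h]
  exact ProbabilityMeasure.continuous_integral_boundedContinuousFunction
    (BoundedContinuousFunction.ofNormedAddCommGroup (fun y => f y i)
      ((EuclideanSpace.proj (𝕜 := ℝ) i).continuous.comp hf) c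
      fun y => (PiLp.norm_apply_le (f y) i).trans (hc y))

end WeakLimit

section Disintegration

variable {d : ℕ} {ν : ProbabilityMeasure (E d × I)}

/-- The disintegration of a measure whose second marginal is Lebesgue measure. -/
theorem swap_eq_compProd (hν : (ν : Measure (E d × I)).map Prod.snd = volume) :
    (volume : Measure I) ⊗ₘ condDistrib Prod.fst Prod.snd (ν : Measure (E d × I)) =
      (ν : Measure (E d × I)).map fun p => (p.2, p.1) := by
  have := compProd_map_condDistrib (mβ := inferInstance) (X := Prod.snd) (Y := Prod.fst)
    (μ := (ν : Measure (E d × I))) measurable_fst.aemeasurable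
  rwa [hν] at this

theorem lintegral_eq_lintegral_condDistrib
    (hν : (ν : Measure (E d × I)).map Prod.snd = volume) {f : E d × I → ℝ≥0∞} (hf : Measurable f) :
    ∫⁻ p, f p ∂(ν : Measure (E d × I)) =
      ∫⁻ t, ∫⁻ y, f (y, t) ∂(condDistrib Prod.fst Prod.snd (ν : Measure (E d × I)) t) := by
  have hf' : Measurable fun q : I × E d => f (q.2, q.1) := hf.comp measurable_swap
  have h := Measure.lintegral_compProd (μ := (volume : Measure I))
    (κ := condDistrib Prod.fst Prod.snd (ν : Measure (E d × I)))
    (f := fun q : I × E d => f (q.2, q.1)) hf'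
  rw [swap_eq_compProd hν, lintegral_map hf'
    (measurable_snd.prodMk measurable_fst)] at h
  exact h

theorem ae_integrable_condDistrib (hν : (ν : Measure (E d × I)).map Prod.snd = volume)
    (hint : Integrable (fun p : E d × I => p.1) (ν : Measure (E d × I))) :
    ∀ᵐ t : I, Integrable (fun y => y)
      (condDistrib Prod.fst Prod.snd (ν : Measure (E d × I)) t) := by
  have h : Integrable (fun q : I × E d => q.2)
      (volume ⊗ₘ condDistrib Prod.fst Prod.snd (ν : Measure (E d × I))) := by
    rw [swap_eq_compProd hν]
    exact (integrable_map_measure measurable_snd.aestronglyMeasurable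
      (measurable_snd.prodMk measurable_fst).aemeasurable).2 hint
  exact ((Measure.integrable_compProd_iff measurable_snd.aestronglyMeasurable).1 h).1

theorem integrable_limitMean (hν : (ν : Measure (E d × I)).map Prod.snd = volume)
    (hint : Integrable (fun p : E d × I => p.1) (ν : Measure (E d × I))) :
    Integrable (limitMean ν) volume := by
  have h : Integrable (fun q : I × E d => q.2)
      ((ν : Measure (E d × I)).map fun p => (p.2, p.1)) :=
    (integrable_map_measure measurable_snd.aestronglyMeasurable
      (measurable_snd.prodMk measurable_fst).aemeasurable).2 hint
  have := h.integral_condDistrib_map (X := Prod.snd) (Y := Prod.fst)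
    measurable_fst.aemeasurable
  rwa [hν] at this

theorem setIntegral_limitMean (hν : (ν : Measure (E d × I)).map Prod.snd = volume)
    (hint : Integrable (fun p : E d × I => p.1) (ν : Measure (E d × I))) (t : I) :
    ∫ s in Iic t, limitMean ν s =
      ∫ p, (Iic t).indicator (fun _ => p.1) p.2 ∂(ν : Measure (E d × I)) := by
  have hm : Measurable fun p : E d × I => (p.2, p.1) := measurable_snd.prodMk measurable_fst
  have h : Integrable (fun q : I × E d => q.2)
      ((ν : Measure (E d × I)).map fun p => (p.2, p.1)) :=
    (integrable_map_measure measurable_snd.aestronglyMeasurable hm.aemeasurable).2 hint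
  rw [← swap_eq_compProd hν] at h
  have h2 := Measure.setIntegral_compProd (s := Iic t) (t := univ) measurableSet_Iic
    MeasurableSet.univ h.integrableOn
  simp only [Measure.restrict_univ] at h2
  change ∫ s in Iic t, ∫ y, y ∂_ = _
  rw [← h2, swap_eq_compProd hν, setIntegral_map (measurableSet_Iic.prod MeasurableSet.univ)
    measurable_snd.aestronglyMeasurable hm.aemeasurable, ← integral_indicator
    (hm (measurableSet_Iic.prod MeasurableSet.univ))]
  refine integral_congr_ae (Eventually.of_forall fun p => ?_)
  by_cases hp : p.2 ∈ Iic t <;> simp [indicator, hp] at *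

end Disintegration

/-! ### The limit equation -/

section LimitEquation

variable {d : ℕ}

/-- A continuous approximation of the indicator of `[0, t]`, falling from `1` to `0` on
`[t, t + ε]`. -/
noncomputable def ramp (t : I) (ε : ℝ) (s : I) : ℝ := max 0 (1 - max ((s : ℝ) - t) 0 / ε)

theorem continuous_ramp (t : I) (ε : ℝ) : Continuous (ramp t ε) := by
  unfold ramp; fun_prop

theorem ramp_nonneg (t : I) (ε : ℝ) (s : I) : 0 ≤ ramp t ε s := le_max_left _ _

theorem ramp_le_one (t : I) {ε : ℝ} (hε : 0 < ε) (s : I) : ramp t ε s ≤ 1 :=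
  max_le zero_le_one (by
    have : 0 ≤ max ((s : ℝ) - t) 0 / ε := div_nonneg (le_max_right _ _) hε.le
    linarith)

theorem ramp_of_le {t s : I} (h : s ≤ t) (ε : ℝ) : ramp t ε s = 1 := by
  have h' : (s : ℝ) ≤ t := h
  rw [ramp, max_eq_right (sub_nonpos.2 h')]
  simp

theorem ramp_of_ge {t s : I} {ε : ℝ} (hε : 0 < ε) (h : (t : ℝ) + ε ≤ s) : ramp t ε s = 0 := by
  rw [ramp, max_eq_left (a := (s : ℝ) - t) (by linarith), max_eq_left]
  have : 1 ≤ ((s : ℝ) - t) / ε := by rw [le_div_iff₀ hε]; linarith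
  linarith

theorem volume_Ioo_add_le (t : I) (ε : ℝ) :
    volume {s : I | (t : ℝ) < s ∧ (s : ℝ) < t + ε} ≤ ENNReal.ofReal ε := by
  have h : volume {s : I | (t : ℝ) < s ∧ (s : ℝ) < t + ε} =
      volume (Subtype.val '' {s : I | (t : ℝ) < s ∧ (s : ℝ) < t + ε}) :=
    (MeasurableEmbedding.subtype_coe measurableSet_Icc).comap_apply _ _
  rw [h]
  calc _ ≤ volume (Ioo (t : ℝ) (t + ε)) := by
        refine measure_mono ?_
        rintro _ ⟨s, hs, rfl⟩
        exact hs
    _ = _ := by rw [Real.volume_Ioo, add_sub_cancel_left]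

theorem continuous_setIntegral_Iic {F : Type*} [NormedAddCommGroup F] [NormedSpace ℝ F]
    {f : I → F} (hf : Integrable f) : Continuous fun t : I => ∫ s in Iic t, f s := by
  simp only [← integral_indicator measurableSet_Iic]
  refine continuous_iff_continuousAt.2 fun t₀ => ?_
  refine continuousAt_of_dominated (bound := fun s => ‖f s‖)
    (Eventually.of_forall fun t => (hf.indicator measurableSet_Iic).aestronglyMeasurable)
    (Eventually.of_forall fun t => Eventually.of_forall fun s => norm_indicator_le_norm_self _ _)
    hf.norm ?_
  have hne : ∀ᵐ s : I, s ≠ t₀ := by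
    have h : (volume : Measure I) {t₀} = volume (Subtype.val '' {t₀}) :=
      (MeasurableEmbedding.subtype_coe measurableSet_Icc).comap_apply _ _
    rw [image_singleton, Real.volume_singleton] at h
    exact measure_eq_zero_iff_ae_notMem.1 h
  filter_upwards [hne] with s hs
  rcases lt_or_gt_of_ne hs with h | h
  · refine ContinuousAt.congr (f := fun _ => f s) continuousAt_const ?_
    filter_upwards [lt_mem_nhds h] with t ht
    rw [indicator_of_mem (mem_Iic.2 ht.le)]
  · refine ContinuousAt.congr (f := fun _ => 0) continuousAt_const ?_
    filter_upwards [gt_mem_nhds h] with t ht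
    rw [indicator_of_notMem (by simpa using ht)]

/-- The defect of a pair in the limit equation at time `t`, with the control clipped at level `L`
and the indicator of `[0, t]` replaced by a ramp of width `ε`. -/
noncomputable def limitResidual (A : I → E d →L[ℝ] E d) (t : I) (ε L : ℝ) (p : PairSpace d) : E d :=
  p.2 t - (∫ s in Iic t, A s (p.2 s)) -
    ∫ q, ramp t ε q.2 • clip L q.1 ∂(p.1 : Measure (E d × I))

theorem norm_ramp_smul_clip_le {L ε : ℝ} (hL : 0 < L) (hε : 0 < ε) (t : I) (q : E d × I) :
    ‖ramp t ε q.2 • clip L q.1‖ ≤ L := by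
  rw [norm_smul, Real.norm_of_nonneg (ramp_nonneg _ _ _)]
  calc _ ≤ 1 * L := mul_le_mul (ramp_le_one t hε _) (norm_clip_le hL _) (norm_nonneg _) zero_le_one
    _ = L := one_mul L

theorem continuous_ramp_smul_clip {L : ℝ} (hL : 0 < L) (ε : ℝ) (t : I) :
    Continuous fun q : E d × I => ramp t ε q.2 • clip L q.1 :=
  ((continuous_ramp t ε).comp continuous_snd).smul ((continuous_clip hL).comp continuous_fst)

theorem continuous_limitResidual {A : I → E d →L[ℝ] E d} (hA : Continuous A) (t : I) {ε L : ℝ}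
    (hε : 0 < ε) (hL : 0 < L) : Continuous (limitResidual A t ε L) := by
  have hint : ∀ y : C(I, E d), Integrable fun s => A s (y s) := fun y =>
    ContinuousMap.integrable_unitInterval ⟨fun s => A s (y s), hA.clm_apply y.continuous⟩
  obtain ⟨K, hK⟩ := (isCompact_range hA).isBounded.exists_norm_le
  have h1 : Continuous fun y : C(I, E d) => ∫ s in Iic t, A s (y s) := by
    refine (LipschitzWith.of_dist_le_mul (K := K.toNNReal) fun y z => ?_).continuous
    rw [dist_eq_norm, ← integral_sub (hint y).integrableOn (hint z).integrableOn]
    have hK0 : 0 ≤ K := (norm_nonneg _).trans (hK _ (mem_range_self t))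
    rw [Real.coe_toNNReal K hK0]
    refine (norm_setIntegral_le_of_norm_le_const (C := K * dist y z) (by simp)
      fun s _ => ?_).trans ?_
    · rw [← map_sub]
      refine (ContinuousLinearMap.le_opNorm _ _).trans ?_
      rw [← dist_eq_norm]
      exact mul_le_mul (hK _ (mem_range_self s)) (ContinuousMap.dist_apply_le_dist s)
        dist_nonneg hK0
    · exact mul_le_of_le_one_right (by positivity) measureReal_le_one
  have hfst : Continuous (X := PairSpace d) fun p : PairSpace d => p.1 :=
    continuous_fst (X := ProbabilityMeasure (E d × I)) (Y := C(I, E d))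
  have hsnd : Continuous (X := PairSpace d) fun p : PairSpace d => p.2 :=
    continuous_snd (X := ProbabilityMeasure (E d × I)) (Y := C(I, E d))
  exact (((continuous_eval_const t).comp hsnd).sub (h1.comp hsnd)).sub
    ((continuous_integral_of_norm_le (continuous_ramp_smul_clip hL ε t)
      (norm_ramp_smul_clip_le hL hε t)).comp hfst)

theorem norm_limitResidual_controlPair_le {A : I → E d →L[ℝ] E d} {a : ℕ → ℝ} {b : E d → E d}
    {x₀ : E d} {n : ℕ} (hn : 0 < n) (η : Measure (Fin n → E d)) [IsProbabilityMeasure η] (t : I)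
    {ε L Λ : ℝ} (hε : 0 < ε) (hL : 0 < L) (hΛ : Λ ≤ L) (v : Fin n → E d) :
    ‖limitResidual A t ε L (controlPair a b x₀ η v)‖ ≤
      ‖controlledPath a b x₀ v t - (∫ s in Iic t, A s (controlledPath a b x₀ v s)) -
        ∫ s in Iic t, ampMean a η v s‖ + controlExcess η a Λ v + L * ε := by
  have hmap : ∫ q, ramp t ε q.2 • clip L q.1 ∂(occMeasure a η v : Measure (E d × I)) =
      ∫ s, ramp t ε s • clip L (ampMean a η v s) :=
    integral_map (φ := fun s : I => (ampMean a η v s, s))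
      ((measurable_ampMean a η v).prodMk measurable_id).aemeasurable
      (continuous_ramp_smul_clip hL ε t).stronglyMeasurable.aestronglyMeasurable
  have hi1 : Integrable fun s : I => ramp t ε s • clip L (ampMean a η v s) := by
    refine Integrable.of_bound (C := L) ?_ (Eventually.of_forall fun s =>
      norm_ramp_smul_clip_le hL hε t (ampMean a η v s, s))
    exact ((continuous_ramp_smul_clip hL ε t).measurable.comp
      ((measurable_ampMean a η v).prodMk measurable_id)).aestronglyMeasurable
  have hi2 : Integrable (ampMean a η v) := integrable_floor (n := n) fun k => ampControl η a v k
  have hex : ∫ s : I, max (‖ampMean a η v s‖ - Λ) 0 = controlExcess η a Λ v :=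
    integral_floor hn fun k => max (‖ampControl η a v k‖ - Λ) 0
  have hi3 : Integrable fun s : I => max (‖ampMean a η v s‖ - Λ) 0 :=
    integrable_floor (n := n) fun k => max (‖ampControl η a v k‖ - Λ) 0
  set S : Set I := {s : I | (t : ℝ) < s ∧ (s : ℝ) < t + ε} with hS
  have hSm : MeasurableSet S := by
    refine MeasurableSet.inter (measurableSet_lt measurable_const measurable_subtype_coe)
      (measurableSet_lt measurable_subtype_coe measurable_const)
  have hSv : (volume : Measure I).real S ≤ ε := by
    have := ENNReal.toReal_mono ENNReal.ofReal_ne_top (volume_Ioo_add_le t ε)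
    rwa [ENNReal.toReal_ofReal hε.le] at this
  have hpt : ∀ s : I,
      ‖(Iic t).indicator (ampMean a η v) s - ramp t ε s • clip L (ampMean a η v s)‖ ≤
      max (‖ampMean a η v s‖ - Λ) 0 + S.indicator (fun _ => L) s := by
    intro s
    rcases le_or_gt s t with hst | hst
    · rw [indicator_of_mem (mem_Iic.2 hst), ramp_of_le hst, one_smul, norm_sub_clip hL]
      refine le_add_of_le_of_nonneg (max_le_max_right _ (by linarith)) ?_
      exact indicator_nonneg (fun _ _ => hL.le) _
    · rw [indicator_of_notMem (by simpa using hst), zero_sub, norm_neg]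
      refine le_add_of_nonneg_of_le (le_max_right _ _) ?_
      rcases lt_or_ge (s : ℝ) (t + ε) with h | h
      · rw [indicator_of_mem (show s ∈ S from ⟨hst, h⟩)]
        exact norm_ramp_smul_clip_le hL hε t (ampMean a η v s, s)
      · rw [ramp_of_ge hε h, zero_smul, norm_zero]
        exact indicator_nonneg (fun _ _ => hL.le) _
  have hdiff : ‖(∫ s in Iic t, ampMean a η v s) - ∫ s, ramp t ε s • clip L (ampMean a η v s)‖ ≤
      controlExcess η a Λ v + L * ε := by
    rw [← integral_indicator measurableSet_Iic,
      ← integral_sub (hi2.indicator measurableSet_Iic) hi1]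
    refine (norm_integral_le_of_norm_le (hi3.add ((integrable_const L).indicator hSm))
      (Eventually.of_forall hpt)).trans ?_
    rw [integral_add' hi3 ((integrable_const L).indicator hSm), hex, integral_indicator hSm,
      setIntegral_const, smul_eq_mul, mul_comm]
    gcongr
  have hdec : limitResidual A t ε L (controlPair a b x₀ η v) =
      (controlledPath a b x₀ v t - (∫ s in Iic t, A s (controlledPath a b x₀ v s)) -
        ∫ s in Iic t, ampMean a η v s) +
      ((∫ s in Iic t, ampMean a η v s) - ∫ s, ramp t ε s • clip L (ampMean a η v s)) := by
    rw [← hmap]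
    change controlledPath a b x₀ v t - _ - _ = _
    simp only [sub_add_sub_cancel]
    rfl
  rw [hdec, add_assoc]
  exact (norm_add_le _ _).trans (by gcongr)

end LimitEquation

section Limit

variable {d : ℕ}

theorem tendsto_integral_ramp_smul_clip (ν : ProbabilityMeasure (E d × I))
    (hint : Integrable (fun p : E d × I => p.1) (ν : Measure (E d × I))) (t : I) {ε L : ℕ → ℝ}
    (hε : ∀ j, 0 < ε j) (hε0 : Tendsto ε atTop (𝓝 0)) (hL : ∀ j, 0 < L j)
    (hLtop : Tendsto L atTop atTop) :
    Tendsto (fun j => ∫ q, ramp t (ε j) q.2 • clip (L j) q.1 ∂(ν : Measure (E d × I))) atTop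
      (𝓝 (∫ q, (Iic t).indicator (fun _ => q.1) q.2 ∂(ν : Measure (E d × I)))) := by
  refine tendsto_integral_of_dominated_convergence (fun q => ‖q.1‖)
    (fun j => (continuous_ramp_smul_clip (hL j) (ε j) t).stronglyMeasurable.aestronglyMeasurable)
    hint.norm (fun j => Eventually.of_forall fun q => ?_) (Eventually.of_forall fun q => ?_)
  · rw [norm_smul, Real.norm_of_nonneg (ramp_nonneg _ _ _), clip, norm_smul]
    have h0 : 0 < max (L j) ‖q.1‖ := lt_max_of_lt_left (hL j)
    have h1 : ‖L j / max (L j) ‖q.1‖‖ ≤ 1 := by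
      rw [Real.norm_of_nonneg (div_nonneg (hL j).le h0.le), div_le_one h0]
      exact le_max_left _ _
    calc _ ≤ 1 * (1 * ‖q.1‖) := by
          gcongr
          exact ramp_le_one t (hε j) _
      _ = _ := by ring
  · have hclip : ∀ᶠ j in atTop, clip (L j) q.1 = q.1 := by
      filter_upwards [hLtop.eventually_ge_atTop ‖q.1‖] with j hj
      rw [clip, max_eq_left hj, div_self (hL j).ne', one_smul]
    rcases le_or_gt q.2 t with h | h
    · rw [indicator_of_mem (mem_Iic.2 h)]
      refine tendsto_const_nhds.congr' ?_
      filter_upwards [hclip] with j hj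
      rw [ramp_of_le h, hj, one_smul]
    · rw [indicator_of_notMem (by simpa using h)]
      refine tendsto_const_nhds.congr' ?_
      have h' : (0 : ℝ) < (q.2 : ℝ) - t := sub_pos.2 h
      filter_upwards [hε0.eventually (gt_mem_nhds h')] with j hj
      rw [ramp_of_ge (hε j) (by linarith), zero_smul]

theorem lintegral_occMeasure {a : ℕ → ℝ} {n : ℕ} (η : Measure (Fin n → E d))
    [IsProbabilityMeasure η] (v : Fin n → E d) {f : E d × I → ℝ≥0∞} (hf : Measurable f) :
    ∫⁻ p, f p ∂(occMeasure a η v : Measure (E d × I)) = ∫⁻ t, f (ampMean a η v t, t) :=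
  lintegral_map hf ((measurable_ampMean a η v).prodMk measurable_id)

namespace ModerateRegime

variable {μ : Kernel (E d) (E d)} [IsMarkovKernel μ] {b : E d → E d} {x₀ : E d}
  {X0 : C(I, E d)} {a : ℕ → ℝ} {η : (n : ℕ) → Measure (Fin n → E d)}
  [∀ n, IsProbabilityMeasure (η n)] {KE : ℝ≥0} {φ : ℕ → ℕ}
  {Ω : Type*} [MeasurableSpace Ω] {P : Measure Ω} [IsProbabilityMeasure P]
  {ηhat : Ω → ProbabilityMeasure (E d × I)} {Yhat : Ω → C(I, E d)}

/-- The second marginal is Lebesgue measure before the limit, and the distance of the second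
marginal from Lebesgue measure is a continuous functional. -/
theorem ae_map_snd_eq
    (hconv : TendstoInDistribution (fun k => controlPair a b x₀ (η (φ k))) atTop
      (fun ω => ((ηhat ω, Yhat ω) : PairSpace d)) (fun k => η (φ k)) P) :
    ∀ᵐ ω ∂P, (ηhat ω : Measure (E d × I)).map Prod.snd = volume := by
  let : MetricSpace (ProbabilityMeasure I) := TopologicalSpace.metrizableSpaceMetric _
  let vol : ProbabilityMeasure I := ⟨volume, inferInstance⟩
  let S : ProbabilityMeasure (E d × I) → ProbabilityMeasure I := fun ν =>
    ν.map measurable_snd.aemeasurable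
  have hS : Continuous S := ProbabilityMeasure.continuous_map continuous_snd
  have hfst : Continuous (X := PairSpace d) fun p : PairSpace d => p.1 :=
    continuous_fst (X := ProbabilityMeasure (E d × I)) (Y := C(I, E d))
  let G : PairSpace d → ℝ≥0 := fun p => min (nndist (S p.1) vol) 1
  have hG : Continuous G := ((hS.comp hfst).nndist continuous_const).min continuous_const
  have h0 : ∀ k v, G (controlPair a b x₀ (η (φ k)) v) = 0 := by
    intro k v
    have : S (occMeasure a (η (φ k)) v) = vol := by
      refine Subtype.ext ?_
      have hm := measurable_ampMean a (η (φ k)) v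
      change Measure.map Prod.snd (Measure.map (fun t : I => (ampMean a (η (φ k)) v t, t)) volume) =
        volume
      rw [Measure.map_map (f := fun t : I => (ampMean a (η (φ k)) v t, t)) measurable_snd
        (hm.prodMk measurable_id)]
      exact Measure.map_id
    change min (nndist (S (occMeasure a (η (φ k)) v)) vol) 1 = 0
    rw [this, nndist_self]
    simp
  have hle := lintegral_le_liminf_of_tendstoInDistribution hconv hG (c := 1) fun p =>
    min_le_right _ _
  simp only [h0, ENNReal.coe_zero, lintegral_zero, liminf_const, nonpos_iff_eq_zero] at hle
  have hle' := (lintegral_eq_zero_iff'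
    ((ENNReal.continuous_coe.comp hG).measurable.comp_aemeasurable hconv.aemeasurable_limit)).1 hle
  filter_upwards [hle'] with ω hω
  have h1 : G (ηhat ω, Yhat ω) = 0 := ENNReal.coe_eq_zero.1 hω
  have h2 : nndist (S (ηhat ω)) vol = 0 := by
    rcases min_choice (nndist (S (ηhat ω)) vol) 1 with h | h
    · exact h.symm.trans h1
    · exact absurd (h.symm.trans h1) one_ne_zero
  have h3 : S (ηhat ω) = vol := by
    rwa [← NNReal.coe_eq_zero, coe_nndist, dist_eq_zero] at h2
  exact congrArg Subtype.val h3

/-- Lower semicontinuity of `E ∫ f dη̂` for continuous, possibly unbounded `f ≥ 0`. -/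
theorem lintegral_lintegral_le_liminf
    (hconv : TendstoInDistribution (fun k => controlPair a b x₀ (η (φ k))) atTop
      (fun ω => ((ηhat ω, Yhat ω) : PairSpace d)) (fun k => η (φ k)) P)
    {f : E d × I → ℝ≥0} (hf : Continuous f) :
    AEMeasurable (fun ω => ∫⁻ p, f p ∂(ηhat ω : Measure (E d × I))) P ∧
    ∫⁻ ω, ∫⁻ p, f p ∂(ηhat ω : Measure (E d × I)) ∂P ≤
      liminf (fun k => ∫⁻ v, (∫⁻ t, f (ampMean a (η (φ k)) v t, t)) ∂(η (φ k))) atTop := by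
  have hfst : Continuous (X := PairSpace d) fun p : PairSpace d => p.1 :=
    continuous_fst (X := ProbabilityMeasure (E d × I)) (Y := C(I, E d))
  let G : ℕ → PairSpace d → ℝ≥0 := fun N p =>
    (∫⁻ y, ((min (f y) N : ℝ≥0) : ℝ≥0∞) ∂(p.1 : Measure (E d × I))).toNNReal
  have hG : ∀ N, Continuous (G N) := fun N => (continuous_toNNReal_lintegral_min hf N).comp hfst
  have hcoe : ∀ N p, (G N p : ℝ≥0∞) =
      ∫⁻ y, ((min (f y) N : ℝ≥0) : ℝ≥0∞) ∂(p.1 : Measure (E d × I)) := fun N p =>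
    ENNReal.coe_toNNReal ((lintegral_min_le p.1 f N).trans_lt (ENNReal.natCast_lt_top N)).ne
  have hsup : ∀ p : PairSpace d, ⨆ N, (G N p : ℝ≥0∞) = ∫⁻ y, f y ∂(p.1 : Measure (E d × I)) := by
    intro p
    simp only [hcoe]
    exact iSup_lintegral_min _ hf.measurable
  have h := lintegral_iSup_le_liminf_of_tendstoInDistribution hconv hG
    (fun N => ⟨N, fun p => by
      rw [← ENNReal.coe_le_coe, hcoe]
      exact (lintegral_min_le p.1 f N)⟩)
    (fun N N' hN p => by
      rw [← ENNReal.coe_le_coe, hcoe, hcoe]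
      exact lintegral_mono fun y => ENNReal.coe_le_coe.2
        (min_le_min_left _ (Nat.cast_le.2 hN)))
  have hmeas : AEMeasurable (fun ω => ⨆ N, (G N (ηhat ω, Yhat ω) : ℝ≥0∞)) P :=
    AEMeasurable.iSup fun N => (ENNReal.continuous_coe.comp (hG N)).measurable.comp_aemeasurable
      hconv.aemeasurable_limit
  simp only [hsup] at h
  refine ⟨hmeas.congr (Eventually.of_forall fun ω => hsup (ηhat ω, Yhat ω)),
    (lintegral_congr fun ω => hsup (ηhat ω, Yhat ω)).ge.trans <| h.trans (le_of_eq ?_)⟩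
  refine congrArg (fun u => liminf u atTop) (funext fun k => lintegral_congr fun v => ?_)
  exact lintegral_occMeasure _ v hf.measurable.coe_nnreal_ennreal

theorem ae_integrable_fst (h : ModerateRegime μ b x₀ X0 a η KE) (hφ : StrictMono φ)
    (hconv : TendstoInDistribution (fun k => controlPair a b x₀ (η (φ k))) atTop
      (fun ω => ((ηhat ω, Yhat ω) : PairSpace d)) (fun k => η (φ k)) P) :
    ∀ᵐ ω ∂P, Integrable (fun p : E d × I => p.1) (ηhat ω : Measure (E d × I)) := by
  obtain ⟨C, hC, hCM⟩ := h.exists_lintegral_controlExcess_le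
  obtain ⟨hm, hle⟩ := lintegral_lintegral_le_liminf hconv (f := fun p : E d × I => ‖p.1‖₊)
    continuous_fst.nnnorm
  have hev : ∀ᶠ k in atTop, ∫⁻ v, (∫⁻ t, (‖ampMean a (η (φ k)) v t‖₊ : ℝ≥0∞)) ∂(η (φ k)) ≤
      ENNReal.ofReal (C * 1) + ENNReal.ofReal (KE / 1) := by
    filter_upwards [hφ.tendsto_atTop.eventually (hCM 1 one_pos),
      hφ.tendsto_atTop.eventually (eventually_gt_atTop 0)] with k h1 h2
    calc _ ≤ ∫⁻ v, (ENNReal.ofReal (C * 1) + ENNReal.ofReal (controlExcess (η (φ k)) a (C * 1) v))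
          ∂(η (φ k)) := by
          refine lintegral_mono fun v => ?_
          have h3 := lintegral_ofReal_norm_ampMean (a := a) (η := η) h2 v
          simp only [ofReal_norm, enorm_eq_nnnorm] at h3
          rw [h3, ← ENNReal.ofReal_add (by positivity) (controlExcess_nonneg _ _ _ _)]
          exact ENNReal.ofReal_le_ofReal (sum_norm_ampControl_le h2 _ _ _ _)
      _ ≤ _ := by
          rw [lintegral_add_left measurable_const, lintegral_const, measure_univ, mul_one]
          gcongr
  have hfin : ∫⁻ ω, ∫⁻ p, (‖p.1‖₊ : ℝ≥0∞) ∂(ηhat ω : Measure (E d × I)) ∂P ≠ ∞ := by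
    refine (hle.trans (liminf_le_of_frequently_le' hev.frequently)).trans_lt ?_ |>.ne
    exact ENNReal.add_lt_top.2 ⟨ENNReal.ofReal_lt_top, ENNReal.ofReal_lt_top⟩
  filter_upwards [ae_lt_top' hm hfin] with ω hω
  exact ⟨measurable_fst.aestronglyMeasurable, hω⟩

/-- The limit equation at a fixed time. -/
theorem ae_limit_equation_at (h : ModerateRegime μ b x₀ X0 a η KE) (hφ : StrictMono φ)
    (hconv : TendstoInDistribution (fun k => controlPair a b x₀ (η (φ k))) atTop
      (fun ω => ((ηhat ω, Yhat ω) : PairSpace d)) (fun k => η (φ k)) P) (t : I) :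
    ∀ᵐ ω ∂P, Yhat ω t = (∫ s in Iic t, fderiv ℝ b (X0 s) (Yhat ω s)) +
      ∫ s in Iic t, limitMean (ηhat ω) s := by
  obtain ⟨C, hC, hCM⟩ := h.exists_lintegral_controlExcess_le
  set A : I → E d →L[ℝ] E d := fun s => fderiv ℝ b (X0 s) with hAdef
  have hA : Continuous A :=
    (h.std.drift_contDiff.continuous_fderiv one_ne_zero).comp X0.continuous
  -- the level exceeds `C (j + 1)`, as uniform integrability requires, and tends to infinity even if
  -- `C = 0`; the width makes the error `L ε` of the ramp equal to `1 / (j + 1)`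
  set L : ℕ → ℝ := fun j => (C + 1) * (j + 1) with hLdef
  have hL : ∀ j, 0 < L j := fun j => by positivity
  have hLtop : Tendsto L atTop atTop :=
    (tendsto_natCast_atTop_atTop.atTop_add tendsto_const_nhds).const_mul_atTop (by positivity)
  set ε : ℕ → ℝ := fun j => 1 / (((j : ℝ) + 1) * L j) with hεdef
  have hε : ∀ j, 0 < ε j := fun j => by
    have := hL j
    positivity
  have hε0 : Tendsto ε atTop (𝓝 0) := by
    have : Tendsto (fun j : ℕ => ((j : ℝ) + 1) * L j) atTop atTop :=
      (tendsto_natCast_atTop_atTop.atTop_add tendsto_const_nhds).atTop_mul_atTop₀ hLtop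
    simp only [hεdef, one_div]
    exact this.inv_tendsto_atTop
  let G : ℕ → PairSpace d → ℝ≥0 := fun j p => min ‖limitResidual A t (ε j) (L j) p‖₊ 1
  have hG : ∀ j, Continuous (G j) := fun j =>
    (continuous_limitResidual hA t (hε j) (hL j)).nnnorm.min continuous_const
  -- the expected defect of the prelimit pairs is of order `1 / j`
  have hpre : ∀ j : ℕ, ∀ᶠ n in atTop, ∫⁻ v, (G j (controlPair a b x₀ (η n) v) : ℝ≥0∞) ∂(η n) ≤
      ENNReal.ofReal ((KE + 3) / (j + 1)) := by
    intro j
    have hj : (0 : ℝ) < j + 1 := by positivity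
    have hκ : (0 : ℝ) < 1 / (j + 1) := by positivity
    filter_upwards [h.eventually_limit_equation hκ, hCM (j + 1) hj, eventually_gt_atTop 0]
      with n h1 h2 h3
    set B := {v : Fin n → E d | ∃ t : I, 1 / ((j : ℝ) + 1) < ‖controlledPath a b x₀ v t -
        (∫ s in Iic t, fderiv ℝ b (X0 s) (controlledPath a b x₀ v s)) -
        ∫ s in Iic t, ampMean a (η n) v s‖}
    -- the exceptional set need not be measurable, so it is replaced by a measurable superset
    have hpt : ∀ v, (G j (controlPair a b x₀ (η n) v) : ℝ≥0∞) ≤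
        (toMeasurable (η n) B).indicator (fun _ => 1) v + (ENNReal.ofReal (2 / (j + 1)) +
          ENNReal.ofReal (controlExcess (η n) a (C * (j + 1)) v)) := by
      intro v
      by_cases hv : v ∈ B
      · rw [indicator_of_mem (subset_toMeasurable _ _ hv)]
        refine le_add_right ?_
        rw [← ENNReal.coe_one]
        exact ENNReal.coe_le_coe.2 (min_le_right _ _)
      · refine le_add_left ?_
        have hv' : ‖controlledPath a b x₀ v t -
            (∫ s in Iic t, fderiv ℝ b (X0 s) (controlledPath a b x₀ v s)) -
            ∫ s in Iic t, ampMean a (η n) v s‖ ≤ 1 / ((j : ℝ) + 1) := by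
          by_contra hcon
          exact hv ⟨t, not_le.1 hcon⟩
        have h4 := norm_limitResidual_controlPair_le (A := A) (a := a) (b := b) (x₀ := x₀) h3 (η n)
          t (hε j) (hL j) (Λ := C * (j + 1)) (by rw [hLdef]; nlinarith) v
        have h5 : L j * ε j = 1 / (j + 1) := by
          have := hL j
          simp only [hεdef]; field_simp
        calc (G j (controlPair a b x₀ (η n) v) : ℝ≥0∞)
            ≤ ‖limitResidual A t (ε j) (L j) (controlPair a b x₀ (η n) v)‖₊ :=
              ENNReal.coe_le_coe.2 (min_le_left _ _)
          _ = ENNReal.ofReal ‖limitResidual A t (ε j) (L j) (controlPair a b x₀ (η n) v)‖ := by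
              rw [ofReal_norm, enorm_eq_nnnorm]
          _ ≤ ENNReal.ofReal (2 / (j + 1) + controlExcess (η n) a (C * (j + 1)) v) := by
              refine ENNReal.ofReal_le_ofReal (h4.trans ?_)
              rw [h5]
              have : (2 : ℝ) / (j + 1) = 1 / (j + 1) + 1 / (j + 1) := by ring
              linarith
          _ = _ := ENNReal.ofReal_add (by positivity) (controlExcess_nonneg _ _ _ _)
    calc _ ≤ _ := lintegral_mono hpt
      _ = η n B + (ENNReal.ofReal (2 / (j + 1)) +
          ∫⁻ v, ENNReal.ofReal (controlExcess (η n) a (C * (j + 1)) v) ∂(η n)) := by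
          rw [lintegral_add_left (measurable_const.indicator (measurableSet_toMeasurable _ _)),
            lintegral_add_left measurable_const,
            lintegral_indicator_const (measurableSet_toMeasurable _ _), measure_toMeasurable,
            lintegral_const, measure_univ, one_mul, mul_one]
      _ ≤ ENNReal.ofReal (1 / (j + 1)) + (ENNReal.ofReal (2 / (j + 1)) +
          ENNReal.ofReal (KE / (j + 1))) := by gcongr
      _ = _ := by
          rw [← ENNReal.ofReal_add (by positivity) (by positivity),
            ← ENNReal.ofReal_add (by positivity) (by positivity)]
          congr 1; ring
  have hlim : ∀ j : ℕ, ∫⁻ ω, (G j (ηhat ω, Yhat ω) : ℝ≥0∞) ∂P ≤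
      ENNReal.ofReal ((KE + 3) / (j + 1)) := fun j =>
    (lintegral_le_liminf_of_tendstoInDistribution hconv (hG j) (c := 1)
      fun p => min_le_right _ _).trans
      (liminf_le_of_frequently_le' (hφ.tendsto_atTop.eventually (hpre j)).frequently)
  have hmeas : ∀ j, AEMeasurable (fun ω => (G j (ηhat ω, Yhat ω) : ℝ≥0∞)) P := fun j =>
    (ENNReal.continuous_coe.comp (hG j)).measurable.comp_aemeasurable hconv.aemeasurable_limit
  have hbound0 : Tendsto (fun j : ℕ => ENNReal.ofReal ((KE + 3) / (j + 1))) atTop (𝓝 0) := by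
    have : Tendsto (fun j : ℕ => ((KE : ℝ) + 3) / (j + 1)) atTop (𝓝 0) :=
      tendsto_const_nhds.div_atTop (tendsto_natCast_atTop_atTop.atTop_add tendsto_const_nhds)
    simpa using ENNReal.tendsto_ofReal this
  have hzero : ∫⁻ ω, liminf (fun j => (G j (ηhat ω, Yhat ω) : ℝ≥0∞)) atTop ∂P = 0 := by
    refine le_antisymm ((lintegral_liminf_le' hmeas).trans ?_) zero_le
    rw [← hbound0.liminf_eq]
    exact liminf_le_liminf (Eventually.of_forall hlim)
  have hZ := hconv.aemeasurable_limit
  have hmeas' :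
      AEMeasurable (fun ω => liminf (fun j => (G j (ηhat ω, Yhat ω) : ℝ≥0∞)) atTop) P := by
    refine ⟨fun ω => liminf (fun j => (G j (hZ.mk _ ω) : ℝ≥0∞)) atTop, Measurable.liminf fun j =>
      (ENNReal.continuous_coe.comp (hG j)).measurable.comp hZ.measurable_mk, ?_⟩
    filter_upwards [hZ.ae_eq_mk] with ω hω
    rw [← hω]
  rw [lintegral_eq_zero_iff' hmeas'] at hzero
  filter_upwards [hzero, ae_map_snd_eq hconv, h.ae_integrable_fst hφ hconv] with ω h1 h2 h3
  rw [setIntegral_limitMean h2 h3]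
  have h4 := tendsto_integral_ramp_smul_clip (ηhat ω) h3 t hε hε0 hL hLtop
  have h5 : Tendsto (fun j => (G j (ηhat ω, Yhat ω) : ℝ≥0∞)) atTop
      (𝓝 ((min ‖Yhat ω t - (∫ s in Iic t, A s (Yhat ω s)) -
        ∫ q, (Iic t).indicator (fun _ => q.1) q.2 ∂(ηhat ω : Measure (E d × I))‖₊ 1 : ℝ≥0) :
        ℝ≥0∞)) :=
    ENNReal.tendsto_coe.2 (((tendsto_const_nhds.sub h4).nnnorm).min tendsto_const_nhds)
  rw [h5.liminf_eq] at h1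
  have h6 : min ‖Yhat ω t - (∫ s in Iic t, A s (Yhat ω s)) -
        ∫ q, (Iic t).indicator (fun _ => q.1) q.2 ∂(ηhat ω : Measure (E d × I))‖₊ 1 = 0 := by
    exact ENNReal.coe_eq_zero.1 h1
  have h7 : ‖Yhat ω t - (∫ s in Iic t, A s (Yhat ω s)) -
        ∫ q, (Iic t).indicator (fun _ => q.1) q.2 ∂(ηhat ω : Measure (E d × I))‖₊ = 0 := by
    rcases min_choice ‖Yhat ω t - (∫ s in Iic t, A s (Yhat ω s)) -
        ∫ q, (Iic t).indicator (fun _ => q.1) q.2 ∂(ηhat ω : Measure (E d × I))‖₊ 1 with h | h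
    · exact h.symm.trans h6
    · exact absurd (h.symm.trans h6) one_ne_zero
  rw [nnnorm_eq_zero, sub_sub, sub_eq_zero] at h7
  exact h7

/-- The structure of the limit points. -/
theorem ae_limit (h : ModerateRegime μ b x₀ X0 a η KE) (hφ : StrictMono φ)
    (hconv : TendstoInDistribution (fun k => controlPair a b x₀ (η (φ k))) atTop
      (fun ω => ((ηhat ω, Yhat ω) : PairSpace d)) (fun k => η (φ k)) P) :
    ∀ᵐ ω ∂P,
      (ηhat ω : Measure (E d × I)).map Prod.snd = volume ∧
      Integrable (fun p : E d × I => p.1) (ηhat ω : Measure (E d × I)) ∧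
      Integrable (limitMean (ηhat ω)) volume ∧
      ∀ t : I, Yhat ω t = (∫ s in Iic t, fderiv ℝ b (X0 s) (Yhat ω s)) +
        ∫ s in Iic t, limitMean (ηhat ω) s := by
  have hA : Continuous fun s : I => fderiv ℝ b (X0 s) :=
    (h.std.drift_contDiff.continuous_fderiv one_ne_zero).comp X0.continuous
  have hdense := ae_all_iff.2 fun k : ℕ =>
    h.ae_limit_equation_at hφ hconv (TopologicalSpace.denseSeq I k)
  filter_upwards [hdense, ae_map_snd_eq hconv, h.ae_integrable_fst hφ hconv] with ω h1 h2 h3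
  have h4 := integrable_limitMean h2 h3
  refine ⟨h2, h3, h4, fun t => ?_⟩
  have h5 : Integrable fun s => fderiv ℝ b (X0 s) (Yhat ω s) :=
    ContinuousMap.integrable_unitInterval ⟨_, hA.clm_apply (Yhat ω).continuous⟩
  have heq := Continuous.ext_on (TopologicalSpace.denseRange_denseSeq I) (Yhat ω).continuous
    ((continuous_setIntegral_Iic h5).add (continuous_setIntegral_Iic h4)) (by
      rintro _ ⟨k, rfl⟩
      exact h1 k)
  exact congrFun heq t

end ModerateRegime

end Limit

/-! ### The quadratic form and its dual -/

section Duality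

variable {d : ℕ} {μ : Kernel (E d) (E d)} {c D : ℝ} {x : E d}

theorem quadForm_eq_inner (h : ExpMoment (μ x) c D) (hc : 0 < c) (β : E d) :
    quadForm (μ x) β = inner ℝ β ((secondMoment μ x).toEuclideanLin β) := by
  have hint : ∀ i j, Integrable (fun y : E d => y i * y j) (μ x) := fun i j =>
    (h.integrable_norm_pow hc 2).mono' (by fun_prop) (Eventually.of_forall fun y => by
      rw [norm_mul, sq]
      exact mul_le_mul (PiLp.norm_apply_le y i) (PiLp.norm_apply_le y j) (norm_nonneg _)
        (norm_nonneg _))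
  have h1 : ∀ y : E d, inner ℝ y β ^ 2 = ∑ i, ∑ j, (β i * β j) * (y i * y j) := fun y => by
    rw [PiLp.inner_apply, sq, Finset.sum_mul_sum]
    refine Finset.sum_congr rfl fun i _ => Finset.sum_congr rfl fun j _ => ?_
    simp only [RCLike.inner_apply, conj_trivial]; ring
  simp only [quadForm, h1]
  rw [integral_finsetSum _ fun i _ => integrable_finsetSum _ fun j _ => (hint i j).const_mul _,
    PiLp.inner_apply]
  refine Finset.sum_congr rfl fun i _ => ?_
  rw [integral_finsetSum _ fun j _ => (hint i j).const_mul _]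
  simp only [integral_const_mul, Matrix.toLpLin_apply, Matrix.mulVec, dotProduct,
    secondMoment, Matrix.of_apply, RCLike.inner_apply, conj_trivial, Finset.sum_mul]
  refine Finset.sum_congr rfl fun j _ => ?_
  ring

theorem toEuclideanLin_eigenvectorBasis {A : Matrix (Fin d) (Fin d) ℝ} (hA : A.IsHermitian)
    (i : Fin d) : A.toEuclideanLin (hA.eigenvectorBasis i) =
      hA.eigenvalues i • hA.eigenvectorBasis i := by
  rw [Matrix.toLpLin_apply, hA.mulVec_eigenvectorBasis]
  rfl

theorem quadForm_eq_sum (h : ExpMoment (μ x) c D) (hc : 0 < c) (β : E d) :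
    quadForm (μ x) β = ∑ i, (secondMoment_isHermitian μ x).eigenvalues i *
      inner ℝ ((secondMoment_isHermitian μ x).eigenvectorBasis i) β ^ 2 := by
  set hA := secondMoment_isHermitian μ x
  rw [quadForm_eq_inner h hc, ← hA.eigenvectorBasis.sum_inner_mul_inner]
  refine Finset.sum_congr rfl fun i _ => ?_
  rw [← Matrix.isSymmetric_toEuclideanLin_iff.2 hA, toEuclideanLin_eigenvectorBasis,
    inner_smul_left, real_inner_comm]
  simp only [conj_trivial]
  ring

theorem eigenvalues_secondMoment_nonneg (h : ExpMoment (μ x) c D) (hc : 0 < c) (i : Fin d) :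
    0 ≤ (secondMoment_isHermitian μ x).eigenvalues i := by
  set hA := secondMoment_isHermitian μ x
  have h1 := quadForm_nonneg (μ x) (hA.eigenvectorBasis i)
  rw [quadForm_eq_inner h hc, toEuclideanLin_eigenvectorBasis, inner_smul_right,
    real_inner_self_eq_norm_sq, hA.eigenvectorBasis.norm_eq_one] at h1
  simpa using h1

/-- The dual description of `½‖w‖²_{A⁻¹}` as the Legendre transform of `½⟨β, Aβ⟩`. If `w` has a
component along an eigenvector with `lᵢ = 0`, multiples of that eigenvector give arbitrarily large
values; otherwise the supremum is attained at the vector with coordinates `wᵢ / lᵢ`. -/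
theorem half_invNormSq_le_iSup (h : ExpMoment (μ x) c D) (hc : 0 < c) (w : E d) :
    (1 / 2 : ℝ≥0∞) * invNormSq (secondMoment_isHermitian μ x) w ≤
      ⨆ β : E d, ENNReal.ofReal (inner ℝ w β - quadForm (μ x) β / 2) := by
  set hA := secondMoment_isHermitian μ x
  set e := hA.eigenvectorBasis with he
  set l := hA.eigenvalues with hl
  have hl0 : ∀ i, 0 ≤ l i := eigenvalues_secondMoment_nonneg h hc
  -- the value at the vector with given coordinates
  have hval : ∀ γ : Fin d → ℝ, inner ℝ w (∑ i, γ i • e i) - quadForm (μ x) (∑ i, γ i • e i) / 2 =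
      ∑ i, (inner ℝ (e i) w * γ i - l i * γ i ^ 2 / 2) := by
    intro γ
    have hco : ∀ i, inner ℝ (e i) (∑ i, γ i • e i) = γ i := fun i => by
      simpa using e.orthonormal.inner_right_fintype γ i
    rw [quadForm_eq_sum h hc, Finset.sum_sub_distrib, ← Finset.sum_div, inner_sum]
    congr 1
    · refine Finset.sum_congr rfl fun i _ => ?_
      rw [inner_smul_right, real_inner_comm, mul_comm]
    · simp only [← he, ← hl, hco]
  by_cases hbad : ∃ i, l i = 0 ∧ inner ℝ (e i) w ≠ 0
  · obtain ⟨i, hi, hwi⟩ := hbad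
    have htop : (⨆ β : E d, ENNReal.ofReal (inner ℝ w β - quadForm (μ x) β / 2)) = ∞ := by
      refine ENNReal.eq_top_of_forall_nnreal_le fun r => ?_
      have h2 := hval (Pi.single i (r / inner ℝ (e i) w))
      rw [Finset.sum_eq_single (M := ℝ) i (fun j _ hj => by simp [hj]) (by simp)] at h2
      refine le_iSup_of_le (∑ j, (Pi.single i (r / inner ℝ (e i) w) : Fin d → ℝ) j • e j) ?_
      rw [h2, Pi.single_eq_same, hi, mul_div_cancel₀ _ hwi, zero_mul, zero_div, sub_zero,
        ENNReal.ofReal_coe_nnreal]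
    rw [htop]
    exact le_top
  · push Not at hbad
    refine le_iSup_of_le (∑ i, (inner ℝ (e i) w / l i) • e i) ?_
    rw [hval, ENNReal.ofReal_sum_of_nonneg, invNormSq, Finset.mul_sum]
    · refine Finset.sum_le_sum fun i _ => ?_
      rcases (hl0 i).eq_or_lt with h0 | hpos
      · simp only [← he, ← hl, ← h0, hbad i h0.symm]
        simp
      · have : inner ℝ (e i) w * (inner ℝ (e i) w / l i) - l i * (inner ℝ (e i) w / l i) ^ 2 / 2 =
            1 / 2 * (inner ℝ (e i) w ^ 2 / l i) := by field_simp; ring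
        rw [this, ENNReal.ofReal_mul (by norm_num), ENNReal.ofReal_div_of_pos hpos]
        simp [e, l]
    · intro i _
      rcases (hl0 i).eq_or_lt with h0 | hpos
      · rw [← h0]; simp
      · have : inner ℝ (e i) w * (inner ℝ (e i) w / l i) - l i * (inner ℝ (e i) w / l i) ^ 2 / 2 =
            1 / 2 * (inner ℝ (e i) w ^ 2 / l i) := by field_simp; ring
        rw [this]; positivity

theorem half_invNormSq_le_iSup_denseSeq (h : ExpMoment (μ x) c D) (hc : 0 < c) (w : E d) :
    (1 / 2 : ℝ≥0∞) * invNormSq (secondMoment_isHermitian μ x) w ≤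
      ⨆ j, ENNReal.ofReal (inner ℝ w (TopologicalSpace.denseSeq (E d) j) -
        quadForm (μ x) (TopologicalSpace.denseSeq (E d) j) / 2) := by
  refine (half_invNormSq_le_iSup h hc w).trans (iSup_le fun β => ?_)
  have hq : Continuous (quadForm (μ x)) := by
    simp only [funext (quadForm_eq_sum h hc)]
    fun_prop
  have hcl : IsClosed {β : E d | ENNReal.ofReal (inner ℝ w β - quadForm (μ x) β / 2) ≤
      ⨆ j, ENNReal.ofReal (inner ℝ w (TopologicalSpace.denseSeq (E d) j) -
        quadForm (μ x) (TopologicalSpace.denseSeq (E d) j) / 2)} :=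
    isClosed_le (ENNReal.continuous_ofReal.comp (by fun_prop)) continuous_const
  exact isClosed_property (TopologicalSpace.denseRange_denseSeq (E d)) hcl
    (fun j => le_iSup (fun j => ENNReal.ofReal (inner ℝ w (TopologicalSpace.denseSeq (E d) j) -
        quadForm (μ x) (TopologicalSpace.denseSeq (E d) j) / 2)) j) β

end Duality

theorem ofReal_integral_le_lintegral {Y : Type*} [MeasurableSpace Y] {ν : Measure Y} {f : Y → ℝ}
    (hf : Integrable f ν) : ENNReal.ofReal (∫ y, f y ∂ν) ≤ ∫⁻ y, ENNReal.ofReal (f y) ∂ν := by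
  rw [integral_eq_lintegral_pos_part_sub_lintegral_neg_part hf]
  refine (ENNReal.ofReal_le_ofReal (sub_le_self _ ENNReal.toReal_nonneg)).trans ?_
  exact ENNReal.ofReal_toReal_le

/-! ### The lower bound on the costs -/

section LowerBound

variable {d : ℕ}

/-- The maximum of `0` and finitely many of the affine functions `w ↦ ⟨w, α⟩ - ½⟨α, A(X⁰(t))α⟩`,
whose supremum over all `α` is `½‖w‖²_{A⁻¹(X⁰(t))}`. -/
noncomputable def affineMax (μ : Kernel (E d) (E d)) (X0 : C(I, E d)) (α : ℕ → E d) (k : ℕ)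
    (p : E d × I) : ℝ≥0 :=
  (Finset.range k).sup fun j => (inner ℝ p.1 (α j) - quadForm (μ (X0 p.2)) (α j) / 2).toNNReal

theorem affineMax_mono (μ : Kernel (E d) (E d)) (X0 : C(I, E d)) (α : ℕ → E d) (p : E d × I) :
    Monotone fun k => affineMax μ X0 α k p := fun _ _ h =>
  Finset.sup_mono (Finset.range_subset_range.2 h)

theorem ofReal_le_iSup_affineMax (μ : Kernel (E d) (E d)) (X0 : C(I, E d)) (α : ℕ → E d)
    (p : E d × I) (j : ℕ) :
    ENNReal.ofReal (inner ℝ p.1 (α j) - quadForm (μ (X0 p.2)) (α j) / 2) ≤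
      ⨆ k, (affineMax μ X0 α k p : ℝ≥0∞) := by
  refine le_iSup_of_le (j + 1) (ENNReal.coe_le_coe.2 ?_)
  exact Finset.le_sup (f := fun j =>
    (inner ℝ p.1 (α j) - quadForm (μ (X0 p.2)) (α j) / 2).toNNReal) (Finset.self_mem_range_succ j)

/-- The scaled entropy inequality: after division by the scale `s`, a test vector is small, and
only the second order part of the moment generating function survives. -/
theorem ExpMoment.ofReal_inner_smul_mean_sub_le {ρ : Measure (E d)} [IsProbabilityMeasure ρ]
    {c D : ℝ} (h : ExpMoment ρ c D) (hc : 0 < c) (ν : Measure (E d)) [IsProbabilityMeasure ν]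
    {s : ℝ} (hs : 0 < s) {α : E d} (hα : ‖α‖ ≤ c * s) {q : ℝ} (hq : 0 ≤ q) :
    ENNReal.ofReal (inner ℝ (s • ∫ y, y ∂ν) α - q) ≤ ENNReal.ofReal (s ^ 2) * klDiv ν ρ +
      ENNReal.ofReal (quadForm ρ α / 2 - q + 6 / c ^ 3 * D * ‖α‖ ^ 3 / s) := by
  have hα' : ‖s⁻¹ • α‖ ≤ c := by
    rw [norm_smul, norm_inv, Real.norm_of_nonneg hs.le, inv_mul_le_iff₀ hs]
    linarith
  have h1 := mul_le_mul_right (h.inner_mean_le hc ν hα') (ENNReal.ofReal (s ^ 2))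
  have h2 : quadForm ρ (s⁻¹ • α) = (s⁻¹) ^ 2 * quadForm ρ α := by
    simp only [quadForm, inner_smul_right, mul_pow, integral_const_mul]
  rw [mul_add, ← ENNReal.ofReal_mul (by positivity), ← ENNReal.ofReal_mul (by positivity), h2,
    inner_smul_right, norm_smul, norm_inv, Real.norm_of_nonneg hs.le,
    show s ^ 2 * (s⁻¹ * inner ℝ (∫ y, y ∂ν) α) = inner ℝ (s • ∫ y, y ∂ν) α by
      rw [real_inner_smul_left]; field_simp,
    show s ^ 2 * ((s⁻¹) ^ 2 * quadForm ρ α / 2 + 6 / c ^ 3 * D * (s⁻¹ * ‖α‖) ^ 3) =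
      quadForm ρ α / 2 + 6 / c ^ 3 * D * ‖α‖ ^ 3 / s by field_simp] at h1
  rw [ENNReal.ofReal_sub _ hq]
  refine (tsub_le_tsub_right h1 _).trans (add_tsub_le_assoc.trans ?_)
  rw [← ENNReal.ofReal_sub _ hq]
  exact le_of_eq (by congr 2; ring)

namespace ModerateRegime

variable {μ : Kernel (E d) (E d)} [IsMarkovKernel μ] {b : E d → E d} {x₀ : E d}
  {X0 : C(I, E d)} {a : ℕ → ℝ} {η : (n : ℕ) → Measure (Fin n → E d)}
  [∀ n, IsProbabilityMeasure (η n)] {KE : ℝ≥0} {φ : ℕ → ℕ}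
  {Ω : Type*} [MeasurableSpace Ω] {P : Measure Ω} [IsProbabilityMeasure P]
  {ηhat : Ω → ProbabilityMeasure (E d × I)} {Yhat : Ω → C(I, E d)}

theorem continuous_affineMax (h : ModerateRegime μ b x₀ X0 a η KE) (α : ℕ → E d) (k : ℕ) :
    Continuous (affineMax μ X0 α k) := by
  obtain ⟨c, D, hc, -, hm⟩ := h.std.exists_expMoment
  unfold affineMax
  refine Continuous.finset_sup_apply fun j _ => continuous_real_toNNReal.comp ?_
  exact (continuous_fst.inner continuous_const).sub
    (((continuous_quadForm h.std hc hm (α j)).comp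
      (X0.continuous.comp continuous_snd)).div_const 2)

/-- The costs dominate the affine functionals of the controls, up to a vanishing error. -/
theorem eventually_lintegral_affineMax_le (h : ModerateRegime μ b x₀ X0 a η KE) (α : ℕ → E d)
    (k : ℕ) {κ : ℝ} (hκ : 0 < κ) :
    ∀ᶠ n in atTop, ∫⁻ v, (∫⁻ t, affineMax μ X0 α k (ampMean a (η n) v t, t)) ∂(η n) ≤
      scaledCost a μ b x₀ (η n) + ENNReal.ofReal κ := by
  obtain ⟨c, D, hc, hD, hm⟩ := h.std.exists_expMoment
  -- a common bound for the test vectors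
  obtain ⟨T, hT0, hT⟩ : ∃ T : ℝ, 0 ≤ T ∧ ∀ j < k, ‖α j‖ ≤ T :=
    ⟨∑ j ∈ Finset.range k, ‖α j‖, by positivity, fun j hj =>
      Finset.single_le_sum (f := fun j => ‖α j‖) (fun _ _ => norm_nonneg _) (Finset.mem_range.2 hj)⟩
  set R := 6 / c ^ 3 * D * T ^ 3 with hR
  have hR0 : 0 ≤ R := by positivity
  set B := 2 * D / c ^ 2 * T ^ 2 + κ with hB
  have hB0 : 0 < B := by positivity
  -- the second moments at the prelimit state are close to those at the limit state
  have hF : Continuous fun x : E d => fun j : Fin k => quadForm (μ x) (α j) :=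
    continuous_pi fun j => continuous_quadForm h.std hc hm (α j)
  obtain ⟨ρ, hρ, hρκ⟩ := exists_uniform_along_path hF X0 (half_pos hκ)
  have hκB : 0 < κ / (2 * B) := by positivity
  filter_upwards [h.eventually_controlledX_close hρ hκB, h.eventually_pos (T / c),
    h.eventually_pos (4 * R / κ)] with n h1 h2 h3
  obtain ⟨hn, ha, hs, hTs⟩ := h2
  have hRs := h3.2.2.2
  have hn' : (0 : ℝ) < n := by exact_mod_cast hn
  have hs2 : (a n * √n) ^ 2 = a n ^ 2 * n := by rw [mul_pow, Real.sq_sqrt hn'.le]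
  set s := a n * √n with hsdef
  set Bad := {v : Fin n → E d | ∃ t : I, ρ ≤ ‖controlledX b x₀ v ⌊(n * t : ℝ)⌋₊ - X0 t‖}
  let kl : (Fin n → E d) → ℕ → ℝ≥0∞ := fun v i =>
    if hi : i < n then klDiv (control (η n) ⟨i, hi⟩ v) (μ (controlledX b x₀ v i)) else 0
  have hpt : ∀ (v : Fin n → E d) (t : I), (affineMax μ X0 α k (ampMean a (η n) v t, t) : ℝ≥0∞) ≤
      ENNReal.ofReal (s ^ 2) * kl v ⌊(n * t : ℝ)⌋₊ + (ENNReal.ofReal (κ / 2) +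
        (toMeasurable (η n) Bad).indicator (fun _ => ENNReal.ofReal B) v) := by
    intro v t
    have key : ∀ j < k, ENNReal.ofReal (inner ℝ (ampMean a (η n) v t) (α j) -
        quadForm (μ (X0 t)) (α j) / 2) ≤
        ENNReal.ofReal (s ^ 2) * kl v ⌊(n * t : ℝ)⌋₊ + (ENNReal.ofReal (κ / 2) +
        (toMeasurable (η n) Bad).indicator (fun _ => ENNReal.ofReal B) v) := by
      intro j hj
      have hq := quadForm_nonneg (μ (X0 t)) (α j)
      by_cases hi : ⌊(n * t : ℝ)⌋₊ < n
      · have h4 := (hm (controlledX b x₀ v ⌊(n * t : ℝ)⌋₊)).ofReal_inner_smul_mean_sub_le hc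
          (control (η n) ⟨_, hi⟩ v) hs (α := α j) (by
            have := hT j hj
            rw [div_le_iff₀ hc] at hTs
            linarith) (q := quadForm (μ (X0 t)) (α j) / 2) (by positivity)
        have h5 : ampMean a (η n) v t = s • ∫ y, y ∂(control (η n) ⟨_, hi⟩ v) := by
          rw [ampMean, condMean, dif_pos hi]
        have h6 : kl v ⌊(n * t : ℝ)⌋₊ = klDiv (control (η n) ⟨_, hi⟩ v)
            (μ (controlledX b x₀ v ⌊(n * t : ℝ)⌋₊)) := dif_pos hi
        have h7 : 6 / c ^ 3 * D * ‖α j‖ ^ 3 / s ≤ κ / 4 := by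
          rw [div_le_iff₀ hs]
          rw [div_le_iff₀ hκ] at hRs
          have : 6 / c ^ 3 * D * ‖α j‖ ^ 3 ≤ R := by
            rw [hR]; gcongr; exact hT j hj
          linarith
        rw [h5, h6]
        refine h4.trans (add_le_add_right ?_ _)
        by_cases hv : v ∈ Bad
        · rw [indicator_of_mem (subset_toMeasurable _ _ hv)]
          refine le_add_left (ENNReal.ofReal_le_ofReal ?_)
          have h8 := (hm (controlledX b x₀ v ⌊(n * t : ℝ)⌋₊)).quadForm_le hc (α j)
          have h9 : 2 * D / c ^ 2 * ‖α j‖ ^ 2 ≤ 2 * D / c ^ 2 * T ^ 2 := by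
            gcongr; exact hT j hj
          have h10 := quadForm_nonneg (μ (controlledX b x₀ v ⌊(n * t : ℝ)⌋₊)) (α j)
          rw [hB]; linarith
        · refine le_add_right (ENNReal.ofReal_le_ofReal ?_)
          have h8 : ‖controlledX b x₀ v ⌊(n * t : ℝ)⌋₊ - X0 t‖ < ρ := by
            by_contra hcon
            exact hv ⟨t, not_lt.1 hcon⟩
          have h9 := (dist_le_pi_dist _ _ (⟨j, hj⟩ : Fin k)).trans (hρκ t _ h8).le
          rw [Real.dist_eq] at h9
          have h10 := (le_abs_self _).trans h9
          dsimp only at h10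
          linarith
      · have h5 : ampMean a (η n) v t = 0 := by
          rw [ampMean, condMean, dif_neg hi, smul_zero]
        rw [h5, inner_zero_left, ENNReal.ofReal_of_nonpos (by linarith)]
        exact zero_le
    have : (affineMax μ X0 α k (ampMean a (η n) v t, t) : ℝ≥0∞) =
        (Finset.range k).sup fun j => ENNReal.ofReal (inner ℝ (ampMean a (η n) v t) (α j) -
          quadForm (μ (X0 t)) (α j) / 2) := by
      rw [affineMax, ENNReal.coe_finset_sup]
      rfl
    rw [this]
    exact Finset.sup_le fun j hj => key j (Finset.mem_range.1 hj)
  have hkl : ∀ v, ∫⁻ t : I, ENNReal.ofReal (s ^ 2) * kl v ⌊(n * t : ℝ)⌋₊ =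
      ENNReal.ofReal (a n ^ 2 * n) * ((n : ℝ≥0∞)⁻¹ *
        ∑ i : Fin n, klDiv (control (η n) i v) (μ (controlledX b x₀ v i))) := by
    intro v
    rw [lintegral_const_mul' _ _ ENNReal.ofReal_ne_top, lintegral_floor hn (kl v), hs2,
      ← Fin.sum_univ_eq_sum_range]
    simp [kl]
  calc ∫⁻ v, (∫⁻ t, affineMax μ X0 α k (ampMean a (η n) v t, t)) ∂(η n)
      ≤ ∫⁻ v, (ENNReal.ofReal (a n ^ 2 * n) * ((n : ℝ≥0∞)⁻¹ *
          ∑ i : Fin n, klDiv (control (η n) i v) (μ (controlledX b x₀ v i))) +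
          (ENNReal.ofReal (κ / 2) +
            (toMeasurable (η n) Bad).indicator (fun _ => ENNReal.ofReal B) v)) ∂(η n) := by
        refine lintegral_mono fun v => (lintegral_mono (hpt v)).trans ?_
        rw [lintegral_add_right _ measurable_const, hkl, lintegral_const, measure_univ, mul_one]
    _ = scaledCost a μ b x₀ (η n) + (ENNReal.ofReal (κ / 2) + ENNReal.ofReal B * η n Bad) := by
        have hi : Measurable fun v => ENNReal.ofReal (κ / 2) +
            (toMeasurable (η n) Bad).indicator (fun _ => ENNReal.ofReal B) v :=
          (measurable_const.indicator (measurableSet_toMeasurable _ _)).const_add _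
        rw [lintegral_add_right _ hi,
          lintegral_const_mul' _ _ ENNReal.ofReal_ne_top, lintegral_add_left measurable_const,
          lintegral_const, measure_univ, mul_one,
          lintegral_indicator_const (measurableSet_toMeasurable _ _), measure_toMeasurable]
        rfl
    _ ≤ scaledCost a μ b x₀ (η n) + (ENNReal.ofReal (κ / 2) +
          ENNReal.ofReal B * ENNReal.ofReal (κ / (2 * B))) := by gcongr
    _ = _ := by
        rw [← ENNReal.ofReal_mul hB0.le, ← ENNReal.ofReal_add (by positivity) (by positivity)]
        congr 2
        field_simp
        ring

theorem lintegral_iSup_affineMax_le (h : ModerateRegime μ b x₀ X0 a η KE) (hφ : StrictMono φ)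
    (hconv : TendstoInDistribution (fun k => controlPair a b x₀ (η (φ k))) atTop
      (fun ω => ((ηhat ω, Yhat ω) : PairSpace d)) (fun k => η (φ k)) P) (α : ℕ → E d) :
    ∫⁻ ω, ∫⁻ p, ⨆ k, (affineMax μ X0 α k p : ℝ≥0∞) ∂(ηhat ω : Measure (E d × I)) ∂P ≤
      liminf (fun k => scaledCost a μ b x₀ (η (φ k))) atTop := by
  have hc := fun k => h.continuous_affineMax α k
  have hmono : ∀ p : E d × I, Monotone fun k => (affineMax μ X0 α k p : ℝ≥0∞) := fun p k l hkl =>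
    ENNReal.coe_le_coe.2 (affineMax_mono μ X0 α p hkl)
  have h1 : ∀ ω, ∫⁻ p, ⨆ k, (affineMax μ X0 α k p : ℝ≥0∞) ∂(ηhat ω : Measure (E d × I)) =
      ⨆ k, ∫⁻ p, (affineMax μ X0 α k p : ℝ≥0∞) ∂(ηhat ω : Measure (E d × I)) := fun ω =>
    lintegral_iSup (fun k => (hc k).measurable.coe_nnreal_ennreal) fun k l hkl p => hmono p hkl
  simp only [h1]
  rw [lintegral_iSup' (fun k => (lintegral_lintegral_le_liminf hconv (hc k)).1)
    (Eventually.of_forall fun ω k l hkl => lintegral_mono fun p => hmono p hkl)]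
  refine iSup_le fun k => ENNReal.le_of_forall_pos_le_add fun κ hκ _ => ?_
  refine (lintegral_lintegral_le_liminf hconv (hc k)).2.trans ?_
  rw [← liminf_add_const atTop _ _ (by isBoundedDefault) (by isBoundedDefault)]
  refine liminf_le_liminf ?_
  filter_upwards [hφ.tendsto_atTop.eventually (h.eventually_lintegral_affineMax_le α k
    (κ := κ) (by exact_mod_cast hκ))] with n hn
  rwa [ENNReal.ofReal_coe_nnreal] at hn

/-- Jensen's inequality for the conditional means of a limit point. -/
theorem lintegral_half_invNormSq_le (h : ModerateRegime μ b x₀ X0 a η KE)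
    {ν : ProbabilityMeasure (E d × I)} (hν : (ν : Measure (E d × I)).map Prod.snd = volume)
    (hint : Integrable (fun p : E d × I => p.1) (ν : Measure (E d × I))) :
    ∫⁻ s : I, (1 / 2 : ℝ≥0∞) *
        invNormSq (secondMoment_isHermitian μ (X0 s)) (limitMean ν s) ≤
      ∫⁻ p, ⨆ k, (affineMax μ X0 (TopologicalSpace.denseSeq (E d)) k p : ℝ≥0∞)
        ∂(ν : Measure (E d × I)) := by
  obtain ⟨c, D, hc, -, hm⟩ := h.std.exists_expMoment
  rw [lintegral_eq_lintegral_condDistrib hν (Measurable.iSup fun k =>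
    (h.continuous_affineMax _ k).measurable.coe_nnreal_ennreal)]
  refine lintegral_mono_ae ?_
  filter_upwards [ae_integrable_condDistrib hν hint] with s hs
  refine (half_invNormSq_le_iSup_denseSeq (hm (X0 s)) hc (limitMean ν s)).trans
    (iSup_le fun j => ?_)
  set α := TopologicalSpace.denseSeq (E d) j
  set κs := condDistrib Prod.fst Prod.snd (ν : Measure (E d × I)) s
  have h1 : Integrable (fun y : E d => inner ℝ y α - quadForm (μ (X0 s)) α / 2) κs :=
    (hs.inner_const α).sub (integrable_const _)
  have h2 : inner ℝ (limitMean ν s) α - quadForm (μ (X0 s)) α / 2 =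
      ∫ y, (inner ℝ y α - quadForm (μ (X0 s)) α / 2) ∂κs := by
    rw [integral_sub (hs.inner_const α) (integrable_const _), integral_const, probReal_univ,
      one_smul]
    congr 1
    have := integral_inner (𝕜 := ℝ) hs α
    simp only [real_inner_comm] at this ⊢
    rw [real_inner_comm]
    exact this.symm
  rw [h2]
  exact (ofReal_integral_le_lintegral h1).trans (lintegral_mono fun y =>
    ofReal_le_iSup_affineMax μ X0 (TopologicalSpace.denseSeq (E d)) (y, s) j)

theorem lintegral_limit_cost_le (h : ModerateRegime μ b x₀ X0 a η KE) (hφ : StrictMono φ)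
    (hconv : TendstoInDistribution (fun k => controlPair a b x₀ (η (φ k))) atTop
      (fun ω => ((ηhat ω, Yhat ω) : PairSpace d)) (fun k => η (φ k)) P) :
    ∫⁻ ω, (∫⁻ s : I, (1 / 2 : ℝ≥0∞) *
        invNormSq (secondMoment_isHermitian μ (X0 s)) (limitMean (ηhat ω) s)) ∂P ≤
      liminf (fun k => scaledCost a μ b x₀ (η (φ k))) atTop := by
  refine (lintegral_mono_ae ?_).trans
    (h.lintegral_iSup_affineMax_le hφ hconv (TopologicalSpace.denseSeq (E d)))
  filter_upwards [ae_map_snd_eq hconv, h.ae_integrable_fst hφ hconv] with ω h1 h2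
  exact h.lintegral_half_invNormSq_le h1 h2

end ModerateRegime

end LowerBound
theorem theorem2 {d : ℕ} (μ : Kernel (E d) (E d)) [IsMarkovKernel μ] (b : E d → E d) (x₀ : E d)
    (hstd : StandingAssumptions μ b)
    (X0 : C(I, E d)) (hX0 : IsNoiselessLimit b x₀ X0)
    (a : ℕ → ℝ) (ha0 : Tendsto a atTop (𝓝 0))
    (ha : Tendsto (fun n : ℕ => a n * √n) atTop atTop)
    (η : (n : ℕ) → Measure (Fin n → E d)) [∀ n, IsProbabilityMeasure (η n)]
    (KE : ℝ≥0) (hcost : ∀ n : ℕ, 1 ≤ n → scaledCost a μ b x₀ (η n) ≤ KE) :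
    -- the pairs are random elements, and their laws are tight
    (∀ n, AEMeasurable (controlPair a b x₀ (η n)) (η n)) ∧
    IsTightMeasureSet {ρ : Measure (PairSpace d) |
      ∃ n : ℕ, 1 ≤ n ∧ ρ = (η n).map (controlPair a b x₀ (η n))} ∧
    -- every weak limit along a subsequence
    ∀ (φ : ℕ → ℕ), StrictMono φ →
      ∀ (Ω : Type*) [MeasurableSpace Ω] (P : Measure Ω) [IsProbabilityMeasure P]
        (ηhat : Ω → ProbabilityMeasure (E d × I)) (Yhat : Ω → C(I, E d)),
        TendstoInDistribution (fun k => controlPair a b x₀ (η (φ k))) atTop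
          (fun ω => ((ηhat ω, Yhat ω) : PairSpace d)) (fun k => η (φ k)) P →
        (∀ᵐ ω ∂P,
          (ηhat ω : Measure (E d × I)).map Prod.snd = volume ∧
          Integrable (fun p : E d × I => p.1) (ηhat ω : Measure (E d × I)) ∧
          Integrable (limitMean (ηhat ω)) volume ∧
          ∀ t : I, Yhat ω t = (∫ s in Iic t, fderiv ℝ b (X0 s) (Yhat ω s)) +
            ∫ s in Iic t, limitMean (ηhat ω) s) ∧
        ∫⁻ ω, (∫⁻ s : I, (1 / 2 : ℝ≥0∞) *
            invNormSq (secondMoment_isHermitian μ (X0 s)) (limitMean (ηhat ω) s)) ∂P ≤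
          liminf (fun k => scaledCost a μ b x₀ (η (φ k))) atTop := by
  have h : ModerateRegime μ b x₀ X0 a η KE := ⟨hstd, hX0, ha0, ha, hcost⟩
  exact ⟨fun n => (measurable_controlPair (η n) h.continuous_drift).aemeasurable,
    h.isTightMeasureSet_controlPair, fun φ hφ Ω _ P _ ηhat Yhat hconv =>
      ⟨h.ae_limit hφ hconv, h.lintegral_limit_cost_le hφ hconv⟩⟩
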